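/- **Setting.** Let $V$ be a finite vertex set, $H$ a set of $3$-element subsets of $V$ and $G$ a graph on $V$ (the size-$3$ and size-$2$ edges of a rank $3$ hypergraph). The independent parameters are real numbers $\Delta,\Delta_2,\delta,\omega,\epsilon,\omega_0,\hat p$. Every vertex is in at most $\Delta$ triples of $H$ and has at most $\Delta_2$ neighbours in $G$, and any two vertices lie together in at most $\delta$ triples of $H$. Put $$C=\Big\lceil\tfrac{\sqrt\Delta}{\sqrt\omega}\Big\rceil,\quad T=\Big\lceil\tfrac{5\omega}{\epsilon}\log\omega\Big\rceil,\quad \theta=\tfrac{\epsilon}{\omega},\quad m=21,\quad \omega_1=T\log C,\quad \omega_2=\tfrac{\omega_0}{16\omega},\quad \omega_3=\omega_4=\omega^2,\quad \omega_5=\Delta^{19/20},\quad \omega_6=\Delta^{1/4}.$$ Every vertex $u$ has a list $C(u)$ of exactly $C$ colours from a finite set of colours. **The algorithm.** Initially no vertex is coloured, $G^0_c=G$ for every colour $c$, $B^0(u)=\emptyset$, and $p^0_u(c)=1/C$ if $c\in C(u)$ and $p_u^0(c)=0$ otherwise. Let $U^i$ be the set of uncoloured vertices after $i$ rounds and $H^i$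 the set of triples of $H$ inside $U^i$. In round $i+1$ ($0\le i<T$), independently for all $u,c$, let $\gamma_u(c)=1$ (“$c$ is chosen at $u$”) with probability $\theta p^i_u(c)$ and $\gamma_u(c)=0$ otherwise, and toss a coin $\eta_u(c)\in\{0,1\}$ with $\Pr[\eta_u(c)=1]=p^i_u(c)/\hat p$. Let $L(u)$ be the set of colours $c$ for which there is an edge $e\in H^i\cup G^i_c$ with $u\in e$ and $\gamma_v(c)=1$ for all $v\in e\setminus\{u\}$. The colour $c$ survives at $u$ if $c\notin B^i(u)\cup L(u)$; put $q^i_u(c)=\Pr[c\notin L(u)]$, where the probability is over the choices $\gamma$ of this round only. If $p^i_u(c)/q^i_u(c)<\hat p$ and $c\notin B^i(u)$, then $p^{i+1}_u(c)=p^i_u(c)/q^i_u(c)$ if $c$ survives at $u$ and $p^{i+1}_u(c)=0$ otherwise; in all other cases $p^{i+1}_u(c)=\hat p\,\eta_u(c)$. Put $B^{i+1}(u)=\{c:p^{i+1}_u(c)=\hat p\}$. Every $u\in U^i$ for which some chosen colour survives receives one such colour, selected by an arbitrary fixed rule (which may depend on the round, the current state and the choices $\gamma$). The graph $G^{i+1}_c$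 on $U^{i+1}$ consists of the pairs $uv$ in $U^{i+1}$ that are edges of $G^i_c$ or for which some triple $uvw\in H^i$ has its vertex $w$ coloured $c$ in this round. After $T$ rounds, in the final step, each uncoloured vertex $u$ independently receives a random colour $c\in C(u)\setminus B^T(u)$ with probability proportional to $p^T_u(c)$ (it stays uncoloured if all these weights are $0$). **Near-independence** of a state at the start of a round (superscript $i$ dropped): for every colour $c$, $\Pr[c\notin L(u)\cup L(v)\cup L(w)]\le q_u(c)q_v(c)q_w(c)(1+1/\omega_0)$ for all $uvw\in H$ with $c\notin B(u)\cup B(v)\cup B(w)$, and $\Pr[c\notin L(u)\cup L(v)]\le q_u(c)q_v(c)(1+1/\omega_0)$ for all pairs of distinct vertices $u,v$ with $c\notin B(u)\cup B(v)$ that are contained in a triple of $H$ or form an edge of $G_c$. **Parameter relations.** (R1) $\theta\log(\hat pC)\ge85$; (R2) $1/\omega_0=o(\theta)$; (R3) $\frac{2}{\omega_1^2C\hat p^2}>6\log\Delta$; (R4) $T/\omega_1=o(1)$; (R5) $(T\log C)/\omega_1<\epsilon/\theta$; (R6) $\frac{2}{4\Delta^2\omega_2^2C\hat p^6}>6\log\Delta$;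 (R7) $\theta T/\omega_2=o(1)$; (R8) $\omega\omega_2+T<\omega_0/2$; (R9) $1/\omega_2\le(1-\theta/4)^T\omega$; (R10) $\frac{1}{4\omega_3^2(6\omega_6T\theta\hat p^5\Delta^2+4m\hat p^5\Delta^{2+1/(2m)}+Cm^2\hat p^6\Delta^{2+1/m})}\ge7\log\Delta$; (R11) $\frac{2}{4\omega_3^2C(m\Delta^{1+1/(2m)}\hat p^3+\delta\Delta^{1/2+1/(2m)}\hat p^3)^2}\ge7\log\Delta$; (R12) $\frac{2}{\omega_4^2C(-\hat p\log\hat p)^2}>6\log\Delta$; (R13) $1/\omega_4\le\epsilon(1-\theta/4)^T$; (R14) $\frac{2\omega_5^2}{C(m\Delta^{1+1/(2m)}\hat p+\Delta^{1/2+1/(2m)}\hat p\delta)^2}\ge7\log\Delta$; (R15) $\omega_5<(\theta/6)(1-\theta/3)^T\Delta$; (R16) $\omega_6\Delta\theta\hat p/(5\delta)\ge6\log\Delta$ (read as false if $\delta=0$); (R17) $\theta\omega(1-\theta/4)^T\ge\theta T/\omega_2+1/\omega_3$; (R18) $1-10\epsilon\ge3/4$; (R19) $\Delta_2\le\omega_6\theta\Delta\hat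 p$; (R20) $\Delta_2\le\sqrt\Delta\sqrt\omega$; (R21) $\hat p\ge\Delta^{-1/2}$. **Theorem.** Consider a family of parameters $(\Delta,\Delta_2,\delta,\omega,\epsilon,\omega_0,\hat p)$ along which $\Delta\to\infty$ and $\omega\to\infty$, such that $\epsilon>0$ and the non-asymptotic relations among (R1)–(R21) hold for all sufficiently large $\Delta$, and (R2), (R4), (R7) hold as $\Delta\to\infty$. Then for all sufficiently large $\Delta$ in the family the following holds for all $V,H,G$ obeying the degree bounds above, all lists with $|C(u)|=C$ for every $u$, and all selection rules: if for every $0\le i<T$ every state that the algorithm reaches with positive probability after $i$ rounds satisfies near-independence, then with positive probability the output of the algorithm ($T$ rounds followed by the final step) is a proper list colouring of $H\cup G$: every vertex $u$ receives a colour from $C(u)$, no triple of $H$ is monochromatic, and no edge of $G$ is monochromatic. -/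

import Mathlib

open Filter Topology Asymptotics

noncomputable section

namespace SemiRandom

/-! ## Finite independent random choices -/

/-- The law of independent random variables, the `i`-th one having law `μ i`. -/
def indepProduct {ι : Type*} [Fintype ι] {α : ι → Type*} [∀ i, Fintype (α i)]
    (μ : ∀ i, PMF (α i)) : PMF (∀ i, α i) :=
  letI := Classical.decEq ι
  PMF.ofFintype (fun x => ∏ i, μ i (x i)) (by
    have h := Finset.prod_univ_sum (fun i => (Finset.univ : Finset (α i))) (fun i a => μ i a)
    rw [Fintype.piFinset_univ] at h
    rw [← h]
    refine Finset.prod_eq_one fun i _ => ?_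
    rw [← tsum_fintype (L := .unconditional _)]
    exact (μ i).tsum_coe)

/-- A biased coin: `true` with probability `r` (truncated to `[0, 1]`). -/
def coin (r : ℝ) : PMF Bool :=
  PMF.ofFintype (fun b => cond b (min (ENNReal.ofReal r) 1) (1 - min (ENNReal.ofReal r) 1)) (by
    simp)

open scoped Classical in
/-- Independent coins, one for every pair of a vertex and a colour. -/
def coins {V K : Type*} [Fintype V] [Fintype K] (r : V → K → ℝ) : PMF (V → K → Bool) :=
  indepProduct fun u => indepProduct fun c => coin (r u c)

/-- The probability of the event `E`, as a real number. -/
def prob {Ω : Type*} (μ : PMF Ω) (E : Set Ω) : ℝ := (μ.toOuterMeasure E).toReal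

/-! ## Rank 3 hypergraphs -/

/-- A hypergraph whose edges have size 3 (the part `H`) or size 2 (the part `G`). -/
structure RankThree (V : Type*) where
  H : Finset (Finset V)
  card_eq_three : ∀ e ∈ H, e.card = 3
  G : SimpleGraph V

/-- The maximum 3-degree is at most `Δ`, the maximum 2-degree is at most `Δ₂`, and the maximum
codegree (number of triples containing two given vertices) is at most `δ`. -/
structure RankThree.DegreesAtMost {V : Type*} (X : RankThree V) (Δ Δ₂ δ : ℝ) : Prop where
  degree_three : ∀ u : V, ({e | e ∈ X.H ∧ u ∈ e}.ncard : ℝ) ≤ Δ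
  degree_two : ∀ u : V, ((X.G.neighborSet u).ncard : ℝ) ≤ Δ₂
  codegree : ∀ u v : V, u ≠ v → ({e | e ∈ X.H ∧ u ∈ e ∧ v ∈ e}.ncard : ℝ) ≤ δ

/-- `χ` is a proper colouring of `H ∪ G` that takes the colour of each vertex from its list. -/
structure RankThree.IsProperListColoring {V K : Type*} (X : RankThree V) (list : V → Finset K)
    (χ : V → K) : Prop where
  mem_list : ∀ u, χ u ∈ list u
  proper_three : ∀ e ∈ X.H, ∃ u ∈ e, ∃ v ∈ e, χ u ≠ χ v
  proper_two : ∀ u v, X.G.Adj u v → χ u ≠ χ v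

/-! ## The algorithm -/

/-- What the algorithm knows at the start of a round: the partial colouring, the colour graphs
`G_c`, the weights `p_u(c)` and the sets `B(u)`. -/
structure State (V K : Type*) where
  color : V → Option K
  graph : K → SimpleGraph V
  p : V → K → ℝ
  B : V → Set K

namespace State

variable {V K : Type*}

/-- The set `U` of uncoloured vertices. -/
def U (S : State V K) : Set V := {u | S.color u = none}

/-- The triples of `H` induced on the uncoloured vertices. -/
def triples (S : State V K) (X : RankThree V) : Set (Finset V) :=
  {e | e ∈ X.H ∧ ∀ u ∈ e, u ∈ S.U}

/-- The set `L(u)` of the colours that are lost at `u` when `γ v c` says whether the colour `c`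
was chosen at `v`. -/
def lost (S : State V K) (X : RankThree V) (γ : V → K → Bool) (u : V) : Set K :=
  {c | (∃ e ∈ S.triples X, u ∈ e ∧ ∀ v ∈ e, v ≠ u → γ v c = true) ∨
    ∃ v, (S.graph c).Adj u v ∧ γ v c = true}

/-- The colours that survive at `u`. -/
def surviving (S : State V K) (X : RankThree V) (γ : V → K → Bool) (u : V) : Set K :=
  {c | c ∉ S.B u ∧ c ∉ S.lost X γ u}

/-- The colours that are chosen at `u` and survive there: those that `u` may receive. -/
def candidates (S : State V K) (X : RankThree V) (γ : V → K → Bool) (u : V) : Set K :=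
  {c | c ∈ S.surviving X γ u ∧ γ u c = true}

/-- The law of the random choices `γ`: colour `c` is chosen at `u` with probability
`θ p_u(c)`. -/
def gammaLaw [Fintype V] [Fintype K] (S : State V K) (θ : ℝ) : PMF (V → K → Bool) :=
  coins fun u c => θ * S.p u c

/-- The law of the coins `η`: heads for `u` and `c` has probability `p_u(c) / p̂`. -/
def etaLaw [Fintype V] [Fintype K] (S : State V K) (phat : ℝ) : PMF (V → K → Bool) :=
  coins fun u c => S.p u c / phat

/-- The probability that none of the vertices of the set `A` loses the colour `c`. -/
def probNotLost [Fintype V] [Fintype K] (S : State V K) (X : RankThree V) (θ : ℝ)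
    (A : Set V) (c : K) : ℝ :=
  prob (S.gammaLaw θ) {γ | ∀ u ∈ A, c ∉ S.lost X γ u}

/-- `q_u(c)`, the probability that `c` survives at `u` (for `c ∉ B(u)`). -/
def q [Fintype V] [Fintype K] (S : State V K) (X : RankThree V) (θ : ℝ) (u : V) (c : K) : ℝ :=
  S.probNotLost X θ {u} c

/-- The near-independence inequalities with error term `1 / ω₀`: for the edges of `H`, for the
pairs of vertices inside edges of `H`, and for the edges of `G_c`. They concern colours for
which the numbers `q` involved are survival probabilities, that is, colours outside `B`. -/
structure NearIndependent [Fintype V] [Fintype K] (S : State V K) (X : RankThree V)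
    (θ ω₀ : ℝ) : Prop where
  triple : ∀ c : K, ∀ e ∈ S.triples X, (∀ u ∈ e, c ∉ S.B u) →
    S.probNotLost X θ e c ≤ (∏ u ∈ e, S.q X θ u c) * (1 + 1 / ω₀)
  pair : ∀ c : K, ∀ e ∈ S.triples X, ∀ u ∈ e, ∀ v ∈ e, u ≠ v → c ∉ S.B u → c ∉ S.B v →
    S.probNotLost X θ {u, v} c ≤ S.q X θ u c * S.q X θ v c * (1 + 1 / ω₀)
  edge : ∀ c : K, ∀ u v : V, (S.graph c).Adj u v → c ∉ S.B u → c ∉ S.B v →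
    S.probNotLost X θ {u, v} c ≤ S.q X θ u c * S.q X θ v c * (1 + 1 / ω₀)

end State

/-- A rule that, in every round, selects a colour for a vertex that has several candidates. It may
depend on the round, on the current state and on the random choices. -/
abbrev Rule (V K : Type*) := ℕ → State V K → (V → K → Bool) → V → K

/-- The rule selects a candidate whenever there is one. -/
def Rule.IsValid {V K : Type*} (pick : Rule V K) (X : RankThree V) : Prop :=
  ∀ i S γ u, (S.candidates X γ u).Nonempty → pick i S γ u ∈ S.candidates X γ u

section Algorithm

variable {V K : Type*}

/-- The initial state: nothing is coloured, all colour graphs are `G`, the weight `1 / C` is put on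
every colour of the list (`C` is the common size of the lists), and all sets `B(u)` are empty. -/
def initial (X : RankThree V) (list : V → Finset K) (C : ℕ) : State V K where
  color _ := none
  graph _ := X.G
  p u c := by
    classical
    exact if c ∈ list u then 1 / (C : ℝ) else 0
  B _ := ∅

open scoped Classical in
/-- The partial colouring after a round. -/
def nextColor (X : RankThree V) (pick : Rule V K) (i : ℕ) (S : State V K) (γ : V → K → Bool)
    (u : V) : Option K :=
  match S.color u with
  | some c => some c
  | none => if (S.candidates X γ u).Nonempty then some (pick i S γ u) else none

/-- The colour graphs after a round: `uv` is joined in colour `c` if it was already, or if it lies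
in a triple of uncoloured vertices whose third vertex has just received the colour `c`; only the
vertices that are still uncoloured are kept. -/
def nextGraph (X : RankThree V) (S : State V K) (color' : V → Option K) (c : K) :
    SimpleGraph V where
  Adj u v := u ≠ v ∧ color' u = none ∧ color' v = none ∧
    ((S.graph c).Adj u v ∨
      ∃ e ∈ S.triples X, u ∈ e ∧ v ∈ e ∧ ∃ w ∈ e, color' w = some c)
  symm := ⟨by
    rintro u v ⟨h, hu, hv, h' | ⟨e, he, hue, hve, hw⟩⟩
    · exact ⟨h.symm, hv, hu, Or.inl h'.symm⟩
    · exact ⟨h.symm, hv, hu, Or.inr ⟨e, he, hve, hue, hw⟩⟩⟩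
  loopless := ⟨fun _ h => h.1 rfl⟩

open scoped Classical in
/-- The mass that the final step gives to a colour at an uncoloured vertex, before
normalisation. -/
def finalMass (list : V → Finset K) (S : State V K) (u : V) : Option K → ENNReal
  | none => 0
  | some c => if c ∈ list u ∧ c ∉ S.B u then ENNReal.ofReal (S.p u c) else 0

theorem finalMass_tsum_ne_top [Fintype K] (list : V → Finset K) (S : State V K) (u : V) :
    ∑' o, finalMass list S u o ≠ ⊤ := by
  rw [tsum_fintype]
  refine ENNReal.sum_ne_top.2 fun o _ => ?_
  cases o with
  | none => simp [finalMass]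
  | some c =>
    simp only [finalMass]
    split_ifs <;> simp

variable [Fintype V] [Fintype K]

open scoped Classical in
/-- The weights after a round. -/
def nextWeight (X : RankThree V) (θ phat : ℝ) (S : State V K) (γ η : V → K → Bool)
    (u : V) (c : K) : ℝ :=
  if S.p u c / S.q X θ u c < phat ∧ c ∉ S.B u then
    if c ∈ S.surviving X γ u then S.p u c / S.q X θ u c else 0
  else
    if η u c = true then phat else 0

/-- The state after a round, as a function of the random choices. -/
def nextState (X : RankThree V) (θ phat : ℝ) (pick : Rule V K) (i : ℕ) (S : State V K)
    (γ η : V → K → Bool) : State V K where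
  color := nextColor X pick i S γ
  graph := nextGraph X S (nextColor X pick i S γ)
  p := nextWeight X θ phat S γ η
  B u := {c | nextWeight X θ phat S γ η u c = phat}

/-- The law of the state after `i` rounds. -/
def run (X : RankThree V) (list : V → Finset K) (C : ℕ) (θ phat : ℝ) (pick : Rule V K) :
    ℕ → PMF (State V K)
  | 0 => PMF.pure (initial X list C)
  | i + 1 => (run X list C θ phat pick i).bind fun S =>
      (S.gammaLaw θ).bind fun γ =>
        (S.etaLaw phat).map fun η => nextState X θ phat pick i S γ η

open scoped Classical in
/-- The colour of `u` after the final step: a coloured vertex keeps its colour, an uncoloured one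
draws a colour of `C(u) - B(u)` with probability proportional to `p_u(c)`. A vertex at which no
colour has positive weight stays uncoloured. -/
def finalChoice (list : V → Finset K) (S : State V K) (u : V) : PMF (Option K) :=
  match S.color u with
  | some c => PMF.pure (some c)
  | none =>
    if h : ∑' o, finalMass list S u o ≠ 0 then
      PMF.normalize (finalMass list S u) h (finalMass_tsum_ne_top list S u)
    else PMF.pure none

/-- The law of the output of the algorithm: `T` rounds, and then the final step, in which the
uncoloured vertices draw their colours independently. -/
def output (X : RankThree V) (list : V → Finset K) (C : ℕ) (θ phat : ℝ) (pick : Rule V K)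
    (T : ℕ) : PMF (V → Option K) :=
  (run X list C θ phat pick T).bind fun S => indepProduct fun u => finalChoice list S u

end Algorithm

/-! ## The parameters -/

/-- The independent parameters. -/
structure Params where
  Δ : ℝ
  Δ₂ : ℝ
  δ : ℝ
  ω : ℝ
  ε : ℝ
  ω₀ : ℝ
  phat : ℝ

namespace Params

variable (P : Params)

/-- The number of colours, `√Δ / √ω` rounded up. -/
def C : ℕ := ⌈√P.Δ / √P.ω⌉₊

/-- The number of rounds, `(5 ω / ε) log ω` rounded up. -/
def T : ℕ := ⌈5 * P.ω / P.ε * Real.log P.ω⌉₊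

def θ : ℝ := P.ε / P.ω

def m : ℝ := 21

def ω₁ : ℝ := P.T * Real.log P.C

def ω₂ : ℝ := P.ω₀ / (16 * P.ω)

def ω₃ : ℝ := P.ω ^ 2

def ω₄ : ℝ := P.ω ^ 2

def ω₅ : ℝ := P.Δ ^ (19 / 20 : ℝ)

def ω₆ : ℝ := P.Δ ^ (1 / 4 : ℝ)

/-- The relations between the parameters that are not asymptotic. -/
structure Relations : Prop where
  r1 : P.θ * Real.log (P.phat * P.C) ≥ 85
  r3 : 2 / (P.ω₁ ^ 2 * P.C * P.phat ^ 2) > 6 * Real.log P.Δ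
  r5 : P.T * Real.log P.C / P.ω₁ < P.ε / P.θ
  r6 : 2 / (4 * P.Δ ^ 2 * P.ω₂ ^ 2 * P.C * P.phat ^ 6) > 6 * Real.log P.Δ
  r8 : P.ω * P.ω₂ + P.T < P.ω₀ / 2
  r9 : 1 / P.ω₂ ≤ (1 - P.θ / 4) ^ P.T * P.ω
  r10 : 1 / (4 * P.ω₃ ^ 2 * (6 * P.ω₆ * P.T * P.θ * P.phat ^ 5 * P.Δ ^ 2
      + 4 * m * P.phat ^ 5 * P.Δ ^ (2 + 1 / (2 * m))
      + P.C * m ^ 2 * P.phat ^ 6 * P.Δ ^ (2 + 1 / m))) ≥ 7 * Real.log P.Δ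
  r11 : 2 / (4 * P.ω₃ ^ 2 * P.C * (m * P.Δ ^ (1 + 1 / (2 * m)) * P.phat ^ 3
      + P.δ * P.Δ ^ (1 / 2 + 1 / (2 * m)) * P.phat ^ 3) ^ 2) ≥ 7 * Real.log P.Δ
  r12 : 2 / (P.ω₄ ^ 2 * P.C * (-P.phat * Real.log P.phat) ^ 2) > 6 * Real.log P.Δ
  r13 : 1 / P.ω₄ ≤ P.ε * (1 - P.θ / 4) ^ P.T
  r14 : 2 * P.ω₅ ^ 2 / (P.C * (m * P.Δ ^ (1 + 1 / (2 * m)) * P.phat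
      + P.Δ ^ (1 / 2 + 1 / (2 * m)) * P.phat * P.δ) ^ 2) ≥ 7 * Real.log P.Δ
  r15 : P.ω₅ < P.θ / 6 * (1 - P.θ / 3) ^ P.T * P.Δ
  r16 : P.ω₆ * P.Δ * P.θ * P.phat / (5 * P.δ) ≥ 6 * Real.log P.Δ
  r17 : P.θ * P.ω * (1 - P.θ / 4) ^ P.T ≥ P.θ * P.T / P.ω₂ + 1 / P.ω₃
  r18 : 1 - 10 * P.ε ≥ 3 / 4
  r19 : P.Δ₂ ≤ P.ω₆ * P.θ * P.Δ * P.phat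
  r20 : P.Δ₂ ≤ √P.Δ * √P.ω
  r21 : P.phat ≥ P.Δ ^ (-(1 / 2) : ℝ)

end Params

/-- The standing assumptions on a family of parameters, where `Δ → ∞` along the filter `l`:
`ω → ∞`, `ε` is positive, and the relations hold, the asymptotic ones as `Δ → ∞`. -/
structure ParamsAssumptions {ι : Type*} (l : Filter ι) (P : ι → Params) : Prop where
  tendsto_Δ : Tendsto (fun n => (P n).Δ) l atTop
  tendsto_ω : Tendsto (fun n => (P n).ω) l atTop
  ε_pos : ∀ᶠ n in l, 0 < (P n).ε
  relations : ∀ᶠ n in l, (P n).Relations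
  r2 : (fun n => 1 / (P n).ω₀) =o[l] fun n => (P n).θ
  r4 : (fun n => (P n).T / (P n).ω₁) =o[l] fun _ => (1 : ℝ)
  r7 : (fun n => (P n).θ * (P n).T / (P n).ω₂) =o[l] fun _ => (1 : ℝ)

end SemiRandom

end

/-! Success with positive probability only needs one reachable outcome, so a single trajectory is
followed. In every round the Lovász local lemma (`local_lemma`) yields an outcome of positive weight
that behaves well at all uncoloured vertices (`Inv.exists_good`). `exists_state` strings these
outcomes together, and one more use of the local lemma settles the final step
(`Inv.exists_coloring`).

Good behaviour is recorded in `Inv`. At an uncoloured vertex u the total weight stays near 1, the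
sum over c of p_u(c) p_v(c) p_w(c) for a triple stays near ω/Δ, the edge mass (the sum of p_u(c)
p_v(c) over the edges uv of the colour graphs) is at most 8(1-θ/4)^i ω, the 3-degree is at most
(1-θ/3)^i Δ, and the entropy of the weights drops by O(ω) over all rounds. Each weight is a
martingale (`ex_pn`). Near-independence together with the FKG inequality bounds the expected
products of weights (`ex_mul_prod_pn_le`).

Entropy keeps the sets B(u) small: a colour in B(u) has weight p̂, far above 1/C, so much weight on
B(u) would cost more entropy than is lost (`Inv.sum_B_le`). The expected number of threats to a
colour, averaged over the weights, is O(ε). Hence most of the weight survives outside B(u)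
(`Inv.lively`), and a vertex is coloured with probability at least about 0.55 θ. In a round the old
edge mass, with coefficient 8, therefore falls by about 4.4 θ(1-θ/4)^i ω, while triples that turn
into edges add about 2 θ(1-θ/4)^i ω. The net loss is enough for the factor 1-θ/4. After T rounds
both kinds of mass are below 1/1000, and the random final colouring has few conflicts at each
vertex.

Concentration comes from an exponential moment bound for functions of independent blocks of bits
(`ex_exp_le`), the blocks mostly being the colours. The delicate quantity is the edge mass towards
vertices that stay uncoloured, since the weights and the event of staying uncoloured use the same
bits. The colours are split into 80 parts, each of little weight at every neighbour. The edge mass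
of a part is compared with the candidates from the other parts only, which are independent of it
(`pr_part_le`).

Properness is deterministic along the trajectory (`Proper.next`): a colour that would spoil an edge
at an uncoloured vertex has weight 0 or p̂ there and is never used again. -/

open Filter Topology Asymptotics
open scoped Classical

set_option linter.unusedSectionVars false

noncomputable section

/-! ### Finite product probability spaces: expectation, independence and concentration -/

namespace FinProb

variable {I A κ : Type*} [Fintype I] [Fintype A]

/-- `w i` is a probability vector for every `i`. -/
structure IsLaw (w : I → A → ℝ) : Prop where
  nonneg : ∀ i a, 0 ≤ w i a
  sum_eq_one : ∀ i, ∑ a, w i a = 1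

/-- The probability of the point `x` under the product law. -/
def weight (w : I → A → ℝ) (x : I → A) : ℝ := ∏ i, w i (x i)

/-- The expectation under the product law. -/
def ex (w : I → A → ℝ) (F : (I → A) → ℝ) : ℝ := ∑ x, weight w x * F x

/-- The indicator of a proposition. -/
def ind (P : Prop) : ℝ := if P then 1 else 0

theorem ind_nonneg (P : Prop) : 0 ≤ ind P := by unfold ind; split_ifs <;> norm_num

theorem ind_le_one (P : Prop) : ind P ≤ 1 := by unfold ind; split_ifs <;> norm_num

theorem ind_of_true {P : Prop} (h : P) : ind P = 1 := if_pos h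

theorem ind_of_false {P : Prop} (h : ¬ P) : ind P = 0 := if_neg h

theorem ind_mono {P Q : Prop} (h : P → Q) : ind P ≤ ind Q := by
  by_cases hP : P
  · rw [ind_of_true (h hP)]; exact ind_le_one P
  · rw [ind_of_false hP]; exact ind_nonneg Q

theorem ind_not (P : Prop) : ind (¬ P) = 1 - ind P := by
  by_cases hP : P <;> simp [ind, hP]

theorem ind_ball {κ : Type*} (s : Finset κ) (P : κ → Prop) :
    ind (∀ k ∈ s, P k) = ∏ k ∈ s, ind (P k) := by
  by_cases h : ∀ k ∈ s, P k
  · rw [ind_of_true h, Finset.prod_eq_one fun k hk => ind_of_true (h k hk)]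
  · rw [ind_of_false h]
    push Not at h
    obtain ⟨k, hk, h⟩ := h
    exact (Finset.prod_eq_zero hk (ind_of_false h)).symm

/-- The probability under the product law. -/
def pr (w : I → A → ℝ) (P : (I → A) → Prop) : ℝ := ex w fun x => ind (P x)

variable {w : I → A → ℝ} {F G : (I → A) → ℝ} {P Q : (I → A) → Prop}

theorem weight_nonneg (hw : IsLaw w) (x : I → A) : 0 ≤ weight w x :=
  Finset.prod_nonneg fun i _ => hw.nonneg i _

theorem sum_weight (hw : IsLaw w) : ∑ x, weight w x = 1 := by
  have h := Finset.prod_univ_sum (fun _ : I => (Finset.univ : Finset A)) (fun i a => w i a)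
  rw [Fintype.piFinset_univ] at h
  simp only [weight]
  rw [← h]
  exact Finset.prod_eq_one fun i _ => hw.sum_eq_one i

theorem ex_const (hw : IsLaw w) (a : ℝ) : ex w (fun _ => a) = a := by
  simp only [ex]
  rw [← Finset.sum_mul, sum_weight hw, one_mul]

theorem ex_add : ex w (fun x => F x + G x) = ex w F + ex w G := by
  simp only [ex, mul_add, Finset.sum_add_distrib]

theorem ex_sub : ex w (fun x => F x - G x) = ex w F - ex w G := by
  simp only [ex, mul_sub, Finset.sum_sub_distrib]

theorem ex_neg : ex w (fun x => -F x) = -ex w F := by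
  simp only [ex, mul_neg, Finset.sum_neg_distrib]

theorem ex_mul_left (a : ℝ) : ex w (fun x => a * F x) = a * ex w F := by
  simp only [ex, Finset.mul_sum]
  exact Finset.sum_congr rfl fun x _ => by ring

theorem ex_mul_right (a : ℝ) : ex w (fun x => F x * a) = ex w F * a := by
  simp only [ex, Finset.sum_mul]
  exact Finset.sum_congr rfl fun x _ => by ring

theorem ex_sum {κ : Type*} (s : Finset κ) (F : κ → (I → A) → ℝ) :
    ex w (fun x => ∑ k ∈ s, F k x) = ∑ k ∈ s, ex w (F k) := by
  simp only [ex, Finset.mul_sum]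
  exact Finset.sum_comm

theorem ex_mono (hw : IsLaw w) (h : ∀ x, F x ≤ G x) : ex w F ≤ ex w G :=
  Finset.sum_le_sum fun x _ => mul_le_mul_of_nonneg_left (h x) (weight_nonneg hw x)

theorem ex_nonneg (hw : IsLaw w) (h : ∀ x, 0 ≤ F x) : 0 ≤ ex w F :=
  Finset.sum_nonneg fun x _ => mul_nonneg (weight_nonneg hw x) (h x)

theorem ex_congr (h : ∀ x, F x = G x) : ex w F = ex w G := by
  rw [funext h]

theorem pr_nonneg (hw : IsLaw w) (P : (I → A) → Prop) : 0 ≤ pr w P :=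
  ex_nonneg hw fun x => ind_nonneg _

theorem pr_mono (hw : IsLaw w) (h : ∀ x, P x → Q x) : pr w P ≤ pr w Q :=
  ex_mono hw fun x => ind_mono (h x)

theorem pr_le_one (hw : IsLaw w) (P : (I → A) → Prop) : pr w P ≤ 1 :=
  (ex_mono hw (G := fun _ => 1) fun x => ind_le_one _).trans_eq (ex_const hw 1)

theorem pr_or (hw : IsLaw w) : pr w (fun x => P x ∨ Q x) ≤ pr w P + pr w Q := by
  rw [pr, pr, pr, ← ex_add]
  refine ex_mono hw fun x => ?_
  by_cases h1 : P x <;> by_cases h2 : Q x <;> simp [ind, h1, h2]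

theorem pr_exists {κ : Type*} (hw : IsLaw w) (s : Finset κ) (P : κ → (I → A) → Prop) :
    pr w (fun x => ∃ k ∈ s, P k x) ≤ ∑ k ∈ s, pr w (P k) := by
  simp only [pr]
  rw [← ex_sum]
  refine ex_mono hw fun x => ?_
  by_cases h : ∃ k ∈ s, P k x
  · obtain ⟨k, hk, hP⟩ := h
    refine le_trans ?_ (Finset.single_le_sum (f := fun k => ind (P k x))
      (fun i _ => ind_nonneg _) hk)
    rw [ind_of_true hP]
    exact ind_le_one _
  · rw [ind_of_false h]
    exact Finset.sum_nonneg fun i _ => ind_nonneg _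

theorem exists_of_pr_lt_one (hw : IsLaw w) (h : pr w P < 1) : ∃ x, ¬ P x := by
  by_contra! hc
  have : pr w P = 1 := by
    rw [pr, ex_congr (G := fun _ => 1) fun x => ind_of_true (hc x), ex_const hw]
  linarith

/-- Exchanging the coordinates in `s` of two independent points does not change their law. -/
theorem ex_swap (s : Finset I) (Ψ : (I → A) → (I → A) → ℝ) :
    ex w (fun x => ex w fun y => Ψ (s.piecewise x y) (s.piecewise y x)) =
      ex w fun x => ex w fun y => Ψ x y := by
  have hinv : ∀ x y : I → A, s.piecewise (s.piecewise x y) (s.piecewise y x) = x := by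
    intro x y; ext i; by_cases h : i ∈ s <;> simp [h]
  let e : (I → A) × (I → A) ≃ (I → A) × (I → A) :=
    { toFun := fun p => (s.piecewise p.1 p.2, s.piecewise p.2 p.1)
      invFun := fun p => (s.piecewise p.1 p.2, s.piecewise p.2 p.1)
      left_inv := fun p => Prod.ext (hinv _ _) (hinv _ _)
      right_inv := fun p => Prod.ext (hinv _ _) (hinv _ _) }
  have hwt : ∀ x y : I → A, weight w (s.piecewise x y) * weight w (s.piecewise y x) =
      weight w x * weight w y := by
    intro x y
    simp only [weight, ← Finset.prod_mul_distrib]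
    refine Finset.prod_congr rfl fun i _ => ?_
    by_cases h : i ∈ s <;> simp [h, mul_comm]
  have hform : ∀ Φ : (I → A) → (I → A) → ℝ, ex w (fun x => ex w fun y => Φ x y) =
      ∑ p : (I → A) × (I → A), weight w p.1 * weight w p.2 * Φ p.1 p.2 := by
    intro Φ
    simp only [ex, Fintype.sum_prod_type, Finset.mul_sum, mul_assoc]
  rw [hform fun x y => Ψ (s.piecewise x y) (s.piecewise y x), hform Ψ]
  refine (Finset.sum_congr rfl fun p _ => ?_).trans (Equiv.sum_comp e _)
  change _ = weight w (s.piecewise p.1 p.2) * weight w (s.piecewise p.2 p.1) * _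
  rw [hwt]
  rfl

/-- Resampling the coordinates in `s` does not change the law. -/
theorem ex_resample (hw : IsLaw w) (s : Finset I) (F : (I → A) → ℝ) :
    ex w (fun x => ex w fun y => F (s.piecewise y x)) = ex w F := by
  have h := ex_swap (w := w) s (fun _ y => F y)
  simpa [ex_const hw] using h

/-- Two groups of coordinates may be drawn separately. -/
theorem ex_diag (hw : IsLaw w) (s : Finset I) (Φ : (I → A) → (I → A) → ℝ)
    (h1 : ∀ y, DependsOn (fun x => Φ x y) (s : Set I))
    (h2 : ∀ x, DependsOn (fun y => Φ x y) (s : Set I)ᶜ) :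
    ex w (fun z => Φ z z) = ex w fun x => ex w fun y => Φ x y := by
  -- The swapped first point agrees with x on `s` and with y off `s`, which are the only coordinates
  -- that the two arguments of Φ see.
  have h := ex_swap (w := w) s (fun x _ => Φ x x)
  simp only [ex_const hw] at h
  rw [← h]
  refine ex_congr fun x => ex_congr fun y => ?_
  have e1 : Φ (s.piecewise x y) (s.piecewise x y) = Φ x (s.piecewise x y) :=
    h1 _ fun i hi => Finset.piecewise_eq_of_mem _ _ _ (by simpa using hi)
  have e2 : Φ x (s.piecewise x y) = Φ x y :=
    h2 _ fun i hi => Finset.piecewise_eq_of_notMem _ _ _ (by simpa using hi)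
  rw [e1, e2]

/-- Functions of disjoint groups of coordinates are independent. -/
theorem ex_mul_of_dependsOn (hw : IsLaw w) (s : Finset I) (hF : DependsOn F (s : Set I))
    (hG : DependsOn G (s : Set I)ᶜ) : ex w (fun x => F x * G x) = ex w F * ex w G := by
  rw [ex_diag hw s (fun x y => F x * G y) (fun y a b h => by simp [hF h])
    (fun x a b h => by simp [hG h])]
  simp only [ex_mul_left, ex_mul_right]

theorem ex_mul_of_disjoint (hw : IsLaw w) {s t : Set I} (hst : Disjoint s t)
    (hF : DependsOn F s) (hG : DependsOn G t) :
    ex w (fun x => F x * G x) = ex w F * ex w G := by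
  refine ex_mul_of_dependsOn hw (Finset.univ.filter fun i => i ∈ s) ?_ ?_
  · exact fun x y h => hF fun i hi => h i (by simpa using hi)
  · exact fun x y h => hG fun i hi => h i (by
      simpa using fun h' => Set.disjoint_left.1 hst h' hi)

theorem dependsOn_prod {κ : Type*} {S : Finset κ} {f : κ → (I → A) → ℝ} {t : Set I}
    (h : ∀ k ∈ S, DependsOn (f k) t) : DependsOn (fun x => ∏ k ∈ S, f k x) t :=
  fun _ _ hxy => Finset.prod_congr rfl fun k hk => h k hk hxy

theorem dependsOn_sum {κ : Type*} {S : Finset κ} {f : κ → (I → A) → ℝ} {t : Set I}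
    (h : ∀ k ∈ S, DependsOn (f k) t) : DependsOn (fun x => ∑ k ∈ S, f k x) t :=
  fun _ _ hxy => Finset.sum_congr rfl fun k hk => h k hk hxy

theorem dependsOn_subset {β : Type*} {f : (I → A) → β} {s t : Set I} (h : DependsOn f s)
    (hst : s ⊆ t) : DependsOn f t := fun _ _ hxy => h fun i hi => hxy i (hst hi)

/-- Functions of pairwise disjoint groups of coordinates are independent. -/
theorem ex_prod {κ : Type*} (hw : IsLaw w) (S : Finset κ) (f : κ → (I → A) → ℝ)
    (t : κ → Set I) (ht : (S : Set κ).PairwiseDisjoint t) (h : ∀ k ∈ S, DependsOn (f k) (t k)) :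
    ex w (fun x => ∏ k ∈ S, f k x) = ∏ k ∈ S, ex w (f k) := by
  induction S using Finset.induction_on with
  | empty => simp [ex_const hw]
  | insert k S hk ih =>
    simp only [Finset.prod_insert hk]
    rw [← ih (ht.subset (by simp)) fun l hl => h l (by simp [hl])]
    refine ex_mul_of_disjoint hw (s := t k) (t := ⋃ l ∈ S, t l) ?_ (h k (by simp)) ?_
    · rw [Set.disjoint_iUnion₂_right]
      intro l hl
      exact ht (by simp) (by simp [hl]) (by rintro rfl; exact hk hl)
    · exact dependsOn_prod fun l hl =>
        dependsOn_subset (h l (by simp [hl])) (Set.subset_biUnion_of_mem (u := t) hl)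

theorem ex_coord (hw : IsLaw w) (i : I) (f : A → ℝ) :
    ex w (fun x => f (x i)) = ∑ a, w i a * f a := by
  have h2 := Finset.prod_univ_sum (fun _ : I => (Finset.univ : Finset A))
    (fun j a => w j a * if j = i then f a else 1)
  rw [Fintype.piFinset_univ] at h2
  have h3 : ∀ x : I → A, ∏ j, (w j (x j) * if j = i then f (x j) else 1) =
      weight w x * f (x i) := by
    intro x
    rw [Finset.prod_mul_distrib, Finset.prod_ite_eq' Finset.univ i fun j => f (x j)]
    simp [weight]
  simp only [h3] at h2
  refine h2.symm.trans ?_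
  rw [Finset.prod_eq_single i]
  · simp
  · intro j _ hj
    simp only [hj, if_false, mul_one]
    exact hw.sum_eq_one j
  · simp

/-- The exponential moment of a function to which every block of coordinates contributes little. -/
theorem ex_exp_le {κ : Type*} [Fintype κ] (hw : IsLaw w) (π : I → κ) (F : (I → A) → ℝ)
    (G g : κ → (I → A) → ℝ) (hG : ∀ k, DependsOn (G k) {i | π i ≠ k})
    (hg : ∀ k, DependsOn (g k) {i | π i = k}) (hFG : ∀ k x, |F x - G k x| ≤ g k x) (r : ℝ)
    (hr : 0 ≤ r) (hrg : ∀ k x, r * g k x ≤ 1) :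
    ex w (fun x => Real.exp (r * F x)) ≤
      Real.exp (r * ex w F + r ^ 2 * ∑ k, ex w fun x => g k x ^ 2) := by
  set U : Finset κ → Finset I := fun S => Finset.univ.filter fun i => π i ∈ S with hU
  set av : Finset κ → ((I → A) → ℝ) → (I → A) → ℝ :=
    fun S f x => ex w fun y => f ((U S).piecewise y x) with hav
  -- Martingale argument: the blocks are averaged out one at a time. `av S F` is the conditional
  -- expectation of F once the blocks in S are integrated, and each new block k costs a factor
  -- exp(r² E g_k²).
  suffices h : ∀ S : Finset κ, ex w (fun x => Real.exp (r * F x)) ≤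
      ex w (fun x => Real.exp (r * av S F x)) * Real.exp (r ^ 2 * ∑ k ∈ S, ex w fun x => g k x ^ 2) by
    refine (h Finset.univ).trans_eq ?_
    have : ∀ x, av Finset.univ F x = ex w F := by
      intro x
      refine ex_congr fun y => ?_
      congr 1
      ext i
      simp [hU]
    simp only [this, ex_const hw]
    rw [← Real.exp_add]
  intro S
  induction S using Finset.induction_on with
  | empty =>
    have h0 : ∀ x, av ∅ F x = F x := fun x => by
      refine (ex_congr fun y => congrArg F ?_).trans (ex_const hw (F x))
      ext i
      simp [hU]
    simp only [h0, Finset.sum_empty, mul_zero, Real.exp_zero, mul_one, le_refl]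
  | insert k S hk ih =>
    refine ih.trans ?_
    rw [Finset.sum_insert hk, mul_add, Real.exp_add, ← mul_assoc]
    refine mul_le_mul_of_nonneg_right ?_ (Real.exp_pos _).le
    rw [← ex_mul_right, ← ex_resample hw (Finset.univ.filter fun i => π i = k)]
    refine ex_mono hw fun x => ?_
    set b := Finset.univ.filter fun i => π i = k
    -- Resampling block k does not change `G k`, so Y is the fluctuation caused by this block alone,
    -- and it inherits the bound `g k`.
    set Y : (I → A) → ℝ := fun y => av S F (b.piecewise y x) - av S (G k) x with hY
    have hGk : ∀ y, av S (G k) (b.piecewise y x) = av S (G k) x := by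
      intro y
      refine ex_congr fun z => hG k fun i hi => ?_
      by_cases h : i ∈ U S
      · simp [h]
      · have : i ∉ b := by simpa [b] using hi
        simp [h, this]
    have hYg : ∀ y, |Y y| ≤ g k y := by
      intro y
      rw [hY]
      simp only
      rw [← hGk y]
      simp only [hav]
      rw [← ex_sub, abs_le, ← ex_const hw (-g k y)]
      have key : ∀ z, |F ((U S).piecewise z (b.piecewise y x)) -
          G k ((U S).piecewise z (b.piecewise y x))| ≤ g k y := by
        intro z
        refine (hFG k _).trans_eq (hg k fun i hi => ?_)
        have h1 : i ∉ U S := by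
          have : π i = k := hi
          simp [hU, this, hk]
        have h2 : i ∈ b := by simpa [b] using hi
        simp [h1, h2]
      refine ⟨ex_mono hw fun z => (abs_le.1 (key z)).1, ?_⟩
      refine (ex_mono hw fun z => (abs_le.1 (key z)).2).trans_eq (ex_const hw _)
    have hcomp : ex w (fun y => av S F (b.piecewise y x)) = av (insert k S) F x := by
      simp only [hav]
      rw [← ex_resample hw (U S) fun y => F ((U (insert k S)).piecewise y x)]
      refine ex_congr fun y => ex_congr fun z => ?_
      congr 1
      ext i
      by_cases h1 : π i ∈ S
      · simp [hU, h1]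
      · by_cases h2 : π i = k
        · simp [hU, h2, b, hk]
        · simp [hU, h1, h2, b]
    -- This is exp z ≤ 1 + z + z² for |z| ≤ 1, with z = rY.
    have hexp : ∀ y, Real.exp (r * av S F (b.piecewise y x)) ≤
        Real.exp (r * av S (G k) x) * (1 + r * Y y + r ^ 2 * g k y ^ 2) := by
      intro y
      have e1 : r * av S F (b.piecewise y x) = r * av S (G k) x + r * Y y := by
        simp only [hY]; ring
      rw [e1, Real.exp_add]
      refine mul_le_mul_of_nonneg_left ?_ (Real.exp_pos _).le
      have h1 : |r * Y y| ≤ 1 := by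
        rw [abs_mul, abs_of_nonneg hr]
        exact (mul_le_mul_of_nonneg_left (hYg y) hr).trans (hrg k y)
      have h2 := (abs_le.1 (Real.abs_exp_sub_one_sub_id_le h1)).2
      have h3 : (r * Y y) ^ 2 ≤ r ^ 2 * g k y ^ 2 := by
        rw [mul_pow]
        refine mul_le_mul_of_nonneg_left ?_ (sq_nonneg r)
        rw [← sq_abs]
        exact pow_le_pow_left₀ (abs_nonneg _) (hYg y) 2
      linarith
    refine (ex_mono hw hexp).trans ?_
    rw [ex_mul_left, ex_add, ex_add, ex_const hw, ex_mul_left, ex_mul_left]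
    have hYe : ex w Y = av (insert k S) F x - av S (G k) x := by
      rw [← hcomp, hY, ex_sub, ex_const hw]
    have h4 : r * av (insert k S) F x = r * av S (G k) x + r * ex w Y := by rw [hYe]; ring
    rw [h4, Real.exp_add, mul_assoc]
    refine mul_le_mul_of_nonneg_left ?_ (Real.exp_pos _).le
    rw [← Real.exp_add]
    linarith [Real.add_one_le_exp (r * ex w Y + r ^ 2 * ex w fun x => g k x ^ 2)]

theorem pr_le_ex_div (hw : IsLaw w) {a : ℝ} (ha : 0 < a) (hF : ∀ x, 0 ≤ F x)
    (h : ∀ x, P x → a ≤ F x) : pr w P ≤ ex w F / a := by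
  rw [le_div_iff₀ ha, pr, ← ex_mul_right]
  refine ex_mono hw fun x => ?_
  by_cases hx : P x
  · simpa [ind, hx] using h x hx
  · simpa [ind, hx] using hF x

/-- The upper tail of a function to which every block of coordinates contributes little. -/
theorem pr_tail_le {κ : Type*} [Fintype κ] (hw : IsLaw w) (π : I → κ) (F : (I → A) → ℝ)
    (G g : κ → (I → A) → ℝ) (hG : ∀ k, DependsOn (G k) {i | π i ≠ k})
    (hg : ∀ k, DependsOn (g k) {i | π i = k}) (hFG : ∀ k x, |F x - G k x| ≤ g k x)
    {t B W μ M : ℝ} (ht : 0 < t) (hM : 0 ≤ M) (hgB : ∀ k x, g k x ≤ B)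
    (hW : ∑ k, ex w (fun x => g k x ^ 2) ≤ W) (hμ : ex w F ≤ μ) (hB : 2 * M * B ≤ t)
    (hWt : 4 * M * W ≤ t ^ 2) : pr w (fun x => μ + t ≤ F x) ≤ Real.exp (-M) := by
  -- With this r the deviation contributes -rt = -2M to the exponent, and the variance term r²W is
  -- at most M by `hWt`. The condition `hB` ensures r g ≤ 1.
  set r := 2 * M / t with hr
  have hr0 : 0 ≤ r := by positivity
  have h1 := ex_exp_le hw π F G g hG hg hFG r hr0 (fun k x => by
    rw [hr, div_mul_eq_mul_div, div_le_one ht]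
    exact (mul_le_mul_of_nonneg_left (hgB k x) (by positivity)).trans hB)
  have h2 : pr w (fun x => μ + t ≤ F x) ≤
      ex w (fun x => Real.exp (r * F x)) / Real.exp (r * (μ + t)) :=
    pr_le_ex_div hw (Real.exp_pos _) (fun x => (Real.exp_pos _).le) fun x hx =>
      Real.exp_le_exp.2 (mul_le_mul_of_nonneg_left hx hr0)
  refine h2.trans ((div_le_div_of_nonneg_right h1 (Real.exp_pos _).le).trans ?_)
  rw [← Real.exp_sub, Real.exp_le_exp]
  have h3 : r * t = 2 * M := by rw [hr]; field_simp
  have h4 : r ^ 2 * W ≤ M := by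
    rw [hr, div_pow, div_mul_eq_mul_div, div_le_iff₀ (by positivity)]
    nlinarith
  have h5 : r * ex w F ≤ r * μ := mul_le_mul_of_nonneg_left hμ hr0
  have h6 := mul_le_mul_of_nonneg_left hW (sq_nonneg r)
  nlinarith

/-- The tails of a sum of independent bounded nonnegative functions. -/
theorem pr_sum_tail_le {κ : Type*} [Fintype κ] (hw : IsLaw w) (π : I → κ)
    (Y : κ → (I → A) → ℝ) (hY : ∀ k, DependsOn (Y k) {i | π i = k})
    {t B μ M : ℝ} (ht : 0 < t) (hM : 0 ≤ M) (hB0 : 0 ≤ B) (hY0 : ∀ k x, 0 ≤ Y k x) (hYB : ∀ k x, Y k x ≤ B)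
    (hμ : ∑ k, ex w (Y k) ≤ μ) (hB : 2 * M * B ≤ t) (hBμ : 4 * M * (B * μ) ≤ t ^ 2) :
    pr w (fun x => μ + t ≤ ∑ k, Y k x) ≤ Real.exp (-M) ∧
      pr w (fun x => ∑ k, Y k x ≤ ∑ k, ex w (Y k) - t) ≤ Real.exp (-M) := by
  have hG : ∀ k, DependsOn (fun x => ∑ l ∈ Finset.univ.erase k, Y l x) {i | π i ≠ k} := by
    intro k
    refine dependsOn_sum fun l hl => dependsOn_subset (hY l) fun i hi => ?_
    have : π i = l := hi
    rw [← this] at hl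
    exact Finset.ne_of_mem_erase hl
  have hd : ∀ k x, ∑ l, Y l x - ∑ l ∈ Finset.univ.erase k, Y l x = Y k x := by
    intro k x
    rw [← Finset.add_sum_erase _ _ (Finset.mem_univ k)]; ring
  -- From 0 ≤ Y ≤ B follows Y² ≤ BY, so the mean also controls the variance.
  have hW : ∑ k, ex w (fun x => Y k x ^ 2) ≤ B * μ := by
    have h0 : ∀ k, ex w (fun x => Y k x ^ 2) ≤ B * ex w (Y k) := by
      intro k
      rw [← ex_mul_left]
      refine ex_mono hw fun x => ?_
      rw [sq]
      exact mul_le_mul_of_nonneg_right (hYB k x) (hY0 k x)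
    refine (Finset.sum_le_sum fun k _ => h0 k).trans ?_
    rw [← Finset.mul_sum]
    exact mul_le_mul_of_nonneg_left hμ hB0
  constructor
  · refine pr_tail_le hw π (fun x => ∑ k, Y k x) _ Y hG hY (fun k x => ?_) ht hM hYB hW
      (by rw [ex_sum]; exact hμ) hB hBμ
    rw [hd, abs_of_nonneg (hY0 k x)]
  · refine (pr_mono hw fun x hx => ?_).trans
      (pr_tail_le hw π (fun x => -∑ k, Y k x) (fun k x => -∑ l ∈ Finset.univ.erase k, Y l x) Y
      (fun k x y h => congrArg Neg.neg (hG k h)) hY (fun k x => ?_) ht hM hYB hW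
      (μ := -∑ k, ex w (Y k)) (by rw [ex_neg, ex_sum]) hB hBμ)
    · linarith
    · rw [neg_sub_neg, abs_sub_comm, hd, abs_of_nonneg (hY0 k x)]

end FinProb

/-! ### The local lemma and correlation inequalities -/

namespace FinProb

variable {I A : Type*} [Fintype I] [Fintype A]
variable {w : I → A → ℝ} {F G : (I → A) → ℝ} {P Q : (I → A) → Prop}

theorem pr_and_of_disjoint (hw : IsLaw w) {s t : Set I} (hst : Disjoint s t)
    (hP : DependsOn P s) (hQ : DependsOn Q t) :
    pr w (fun x => P x ∧ Q x) = pr w P * pr w Q := by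
  rw [pr, pr, pr, ← ex_mul_of_disjoint hw hst]
  · refine ex_congr fun x => ?_
    by_cases h1 : P x <;> by_cases h2 : Q x <;> simp [ind, h1, h2]
  · exact fun x y h => by simp only [hP h]
  · exact fun x y h => by simp only [hQ h]

theorem pr_not (hw : IsLaw w) (P : (I → A) → Prop) : pr w (fun x => ¬ P x) = 1 - pr w P := by
  rw [pr, pr, ex_congr fun x => ind_not (P x), ex_sub, ex_const hw]

theorem pr_and_not (P Q : (I → A) → Prop) :
    pr w (fun x => P x ∧ ¬ Q x) = pr w P - pr w (fun x => Q x ∧ P x) := by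
  rw [pr, pr, pr, ← ex_sub]
  exact ex_congr fun x => by by_cases h : P x <;> by_cases h' : Q x <;> simp [ind, h, h']

/-- The Lovász local lemma for events determined by groups of independent coordinates. -/
theorem local_lemma {κ : Type*} [Fintype κ] (hw : IsLaw w) (E : κ → (I → A) → Prop)
    (s : κ → Set I) (hE : ∀ k, DependsOn (E k) (s k)) (hE1 : ∀ k, pr w (E k) ≤ 1 / 4)
    (hsum : ∀ k, ∑ l ∈ Finset.univ.filter (fun l => ¬ Disjoint (s k) (s l)), pr w (E l) ≤ 1 / 4) :
    ∃ x, 0 < weight w x ∧ ∀ k, ¬ E k x := by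
  have hdep : ∀ S : Finset κ, ∀ k, (∀ l ∈ S, Disjoint (s k) (s l)) →
      pr w (fun x => E k x ∧ ∀ l ∈ S, ¬ E l x) = pr w (E k) * pr w (fun x => ∀ l ∈ S, ¬ E l x) := by
    intro S k hS
    refine pr_and_of_disjoint hw (s := s k) (t := ⋃ l ∈ S, s l) ?_ (hE k) ?_
    · rw [Set.disjoint_iUnion₂_right]
      exact hS
    · intro x y h
      refine propext (forall₂_congr fun l hl => not_congr ?_)
      rw [hE l fun i hi => h i (Set.mem_biUnion hl hi)]
  -- The usual simultaneous induction: avoiding S has positive probability, and conditioning on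
  -- avoiding S at most doubles the probability of any event.
  have key : ∀ n, ∀ S : Finset κ, S.card = n →
      0 < pr w (fun x => ∀ l ∈ S, ¬ E l x) ∧
      ∀ k, pr w (fun x => E k x ∧ ∀ l ∈ S, ¬ E l x) ≤
        2 * pr w (E k) * pr w (fun x => ∀ l ∈ S, ¬ E l x) := by
    intro n
    induction n using Nat.strong_induction_on with
    | _ n ih =>
    intro S hS
    constructor
    · rcases S.eq_empty_or_nonempty with rfl | ⟨k, hk⟩
      · simp [pr, ind, ex_const hw]
      · obtain ⟨h1, h2⟩ := ih _ (by rw [← hS]; exact Finset.card_erase_lt_of_mem hk)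
          (S.erase k) rfl
        have h3 : pr w (fun x => ∀ l ∈ S, ¬ E l x) =
            pr w (fun x => ∀ l ∈ S.erase k, ¬ E l x) -
              pr w (fun x => E k x ∧ ∀ l ∈ S.erase k, ¬ E l x) := by
          rw [← pr_and_not]
          congr 1
          ext x
          conv_lhs => rw [← Finset.insert_erase hk]
          rw [Finset.forall_mem_insert, and_comm]
        have h4 := h2 k
        have h5 := hE1 k
        rw [h3]
        nlinarith
    · intro k
      set S2 := S.filter fun l => Disjoint (s k) (s l) with hS2
      set S1 := S.filter fun l => ¬ Disjoint (s k) (s l) with hS1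
      have hle : pr w (fun x => E k x ∧ ∀ l ∈ S, ¬ E l x) ≤
          pr w (E k) * pr w (fun x => ∀ l ∈ S2, ¬ E l x) := by
        rw [← hdep S2 k fun l hl => (Finset.mem_filter.1 hl).2]
        exact pr_mono hw fun x hx => ⟨hx.1, fun l hl => hx.2 l (Finset.mem_filter.1 hl).1⟩
      have hPk := pr_nonneg hw (E k)
      -- Given that the events in S2 are avoided, those in S1 occur with total probability at most 2
      -- · 1/4, so avoiding them as well keeps at least half of the probability.
      suffices h : pr w (fun x => ∀ l ∈ S2, ¬ E l x) ≤ 2 * pr w (fun x => ∀ l ∈ S, ¬ E l x) by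
        nlinarith
      have h0 : pr w (fun x => ∀ l ∈ S2, ¬ E l x) ≤ pr w (fun x => ∀ l ∈ S, ¬ E l x) +
          pr w (fun x => ∃ l ∈ S1, E l x ∧ ∀ l ∈ S2, ¬ E l x) := by
        refine (pr_mono hw fun x hx => ?_).trans (pr_or hw)
        by_cases h : ∀ l ∈ S, ¬ E l x
        · exact Or.inl h
        · push Not at h
          obtain ⟨l, hl, hEl⟩ := h
          refine Or.inr ⟨l, Finset.mem_filter.2 ⟨hl, fun hd => ?_⟩, hEl, hx⟩
          exact hx l (Finset.mem_filter.2 ⟨hl, hd⟩) hEl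
      -- If no event of S meets the coordinates of `E k`, then S2 = S, the induction hypothesis does
      -- not apply, and the claim is trivial.
      by_cases hlt : S2.card < n
      · obtain ⟨h1, h2⟩ := ih _ hlt S2 rfl
        have h3 := pr_exists hw S1 fun l x => E l x ∧ ∀ l ∈ S2, ¬ E l x
        have h4 := Finset.sum_le_sum fun l (_ : l ∈ S1) => h2 l
        rw [← Finset.sum_mul, ← Finset.mul_sum] at h4
        have h5 : ∑ l ∈ S1, pr w (E l) ≤ 1 / 4 :=
          (Finset.sum_le_sum_of_subset_of_nonneg
            (Finset.filter_subset_filter _ (Finset.subset_univ S))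
            fun l _ _ => pr_nonneg hw _).trans (hsum k)
        nlinarith
      · have : S2 = S := Finset.eq_of_subset_of_card_le (Finset.filter_subset _ _) (by omega)
        rw [this]
        linarith [pr_nonneg hw fun x => ∀ l ∈ S, ¬ E l x]
  have hpos := (key _ Finset.univ rfl).1
  by_contra! hc
  refine hpos.ne' (Finset.sum_eq_zero fun x _ => ?_)
  by_cases hx : 0 < weight w x
  · obtain ⟨k, hk⟩ := hc x hx
    beta_reduce
    rw [ind_of_false (P := ∀ l ∈ Finset.univ, ¬ E l x) fun h => h k (Finset.mem_univ k) hk,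
      mul_zero]
  · rw [le_antisymm (not_lt.1 hx) (weight_nonneg hw x), zero_mul]

section FKG

variable [LinearOrder A]

/-- In each coordinate the meet and join only permute the two values, so equality holds. The stated
inequality is the lattice condition of the FKG theorem. -/
theorem weight_mul_weight (x y : I → A) :
    weight w x * weight w y ≤ weight w (x ⊓ y) * weight w (x ⊔ y) := by
  simp only [weight, ← Finset.prod_mul_distrib]
  refine (Finset.prod_congr rfl fun i _ => ?_).le
  rcases le_total (x i) (y i) with h | h
  · simp [h]
  · simp [h, mul_comm]

theorem ex_mul_le_of_monotone (hw : IsLaw w) (hF0 : ∀ x, 0 ≤ F x) (hG0 : ∀ x, 0 ≤ G x)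
    (hF : Monotone F) (hG : Monotone G) : ex w F * ex w G ≤ ex w fun x => F x * G x := by
  have h := fkg (μ := fun x => weight w x) (f := F) (g := G)
    (fun x => weight_nonneg hw x) hF0 hG0 hF hG weight_mul_weight
  rw [sum_weight hw, one_mul] at h
  exact h

/-- FKG for F and the increasing nonnegative function M - G. -/
theorem ex_mul_le_of_monotone_antitone (hw : IsLaw w) {M : ℝ} (hF0 : ∀ x, 0 ≤ F x)
    (hGM : ∀ x, G x ≤ M) (hF : Monotone F) (hG : Antitone G) :
    ex w (fun x => F x * G x) ≤ ex w F * ex w G := by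
  have h := ex_mul_le_of_monotone hw (G := fun x => M - G x) hF0
    (fun x => sub_nonneg.2 (hGM x)) hF (fun x y hxy => sub_le_sub_left (hG hxy) M)
  rw [ex_sub, ex_const hw] at h
  simp only [mul_sub] at h
  rw [ex_sub, ex_mul_right] at h
  linarith

theorem ex_mul_le_of_antitone (hw : IsLaw w) {M : ℝ} (hGM : ∀ x, G x ≤ M)
    (hFM : ∀ x, F x ≤ M)
    (hF : Antitone F) (hG : Antitone G) : ex w F * ex w G ≤ ex w fun x => F x * G x := by
  have h := ex_mul_le_of_monotone_antitone hw (F := fun x => M - F x) (G := G)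
    (fun x => sub_nonneg.2 (hFM x)) hGM (fun x y hxy => sub_le_sub_left (hF hxy) M) hG
  rw [ex_sub, ex_const hw] at h
  simp only [sub_mul] at h
  rw [ex_sub, ex_mul_left] at h
  linarith

theorem prod_ex_le_of_antitone {κ : Type*} (hw : IsLaw w) (S : Finset κ)
    (f : κ → (I → A) → ℝ) (h0 : ∀ k ∈ S, ∀ x, 0 ≤ f k x) (h1 : ∀ k ∈ S, ∀ x, f k x ≤ 1)
    (h : ∀ k ∈ S, Antitone (f k)) :
    ∏ k ∈ S, ex w (f k) ≤ ex w fun x => ∏ k ∈ S, f k x := by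
  induction S using Finset.induction_on with
  | empty => simp [ex_const hw]
  | insert k S hk ih =>
    simp only [Finset.prod_insert hk]
    have e0 : ∀ l ∈ S, ∀ x, 0 ≤ f l x := fun l hl => h0 l (by simp [hl])
    have e1 : ∀ l ∈ S, ∀ x, f l x ≤ 1 := fun l hl => h1 l (by simp [hl])
    refine (mul_le_mul_of_nonneg_left (ih e0 e1 fun l hl => h l (by simp [hl]))
      (ex_nonneg hw (h0 k (by simp)))).trans ?_
    refine ex_mul_le_of_antitone hw (M := 1)
      (fun x => Finset.prod_le_one (fun l hl => e0 l hl x) fun l hl => e1 l hl x)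
      (h1 k (by simp)) (h k (by simp)) ?_
    exact fun x y hxy => Finset.prod_le_prod (fun l hl => e0 l hl y) fun l hl =>
      h l (by simp [hl]) hxy

end FKG

end FinProb

/-! ### The random bits of one round and their law -/

namespace SemiRandom

open FinProb

/-- The probability vector of a coin. -/
def bern (r : ℝ) (b : Bool) : ℝ := cond b r (1 - r)

theorem coin_apply_toReal {r : ℝ} (h0 : 0 ≤ r) (h1 : r ≤ 1) (b : Bool) :
    (coin r b).toReal = bern r b := by
  have h : ENNReal.ofReal r ≤ 1 := by
    rw [← ENNReal.ofReal_one]; exact ENNReal.ofReal_le_ofReal h1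
  cases b
  · simp only [coin, PMF.ofFintype_apply, bern, cond_false, min_eq_left h]
    rw [ENNReal.toReal_sub_of_le h ENNReal.one_ne_top, ENNReal.toReal_ofReal h0,
      ENNReal.toReal_one]
  · simp [coin, PMF.ofFintype_apply, bern, min_eq_left h, ENNReal.toReal_ofReal h0]

theorem indepProduct_apply {ι : Type*} [Fintype ι] {α : ι → Type*} [∀ i, Fintype (α i)]
    (μ : ∀ i, PMF (α i)) (x : ∀ i, α i) : indepProduct μ x = ∏ i, μ i (x i) := by
  simp [indepProduct, PMF.ofFintype_apply]

variable {V K : Type*} [Fintype V] [Fintype K]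

theorem coins_apply_toReal {r : V → K → ℝ} (h0 : ∀ u c, 0 ≤ r u c) (h1 : ∀ u c, r u c ≤ 1)
    (γ : V → K → Bool) : (coins r γ).toReal = ∏ u, ∏ c, bern (r u c) (γ u c) := by
  have e : coins r γ = ∏ u, ∏ c, coin (r u c) (γ u c) := by
    rw [coins]
    refine (indepProduct_apply _ _).trans (Finset.prod_congr rfl fun u _ => ?_)
    exact indepProduct_apply _ _
  rw [e, ENNReal.toReal_prod]
  refine Finset.prod_congr rfl fun u _ => ?_
  rw [ENNReal.toReal_prod]
  exact Finset.prod_congr rfl fun c _ => coin_apply_toReal (h0 u c) (h1 u c) _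

/-- The random bits of a round: the choices `γ` and the coins `η`. -/
abbrev Bits (V K : Type*) := (V × K) ⊕ (V × K) → Bool

/-- The choices. -/
def gam (x : Bits V K) (u : V) (c : K) : Bool := x (Sum.inl (u, c))

/-- The coins. -/
def eta (x : Bits V K) (u : V) (c : K) : Bool := x (Sum.inr (u, c))

/-- The colour to which a bit belongs. -/
def col : (V × K) ⊕ (V × K) → K := Sum.elim Prod.snd Prod.snd

/-- The vertex to which a bit belongs. -/
def vert : (V × K) ⊕ (V × K) → V := Sum.elim Prod.fst Prod.fst

/-- `v` is `u` or lies in an edge together with `u`. -/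
def RankThree.Near (X : RankThree V) (u v : V) : Prop :=
  v = u ∨ X.G.Adj u v ∨ ∃ e ∈ X.H, u ∈ e ∧ v ∈ e

theorem RankThree.Near.symm {X : RankThree V} {u v : V} (h : X.Near u v) : X.Near v u := by
  rcases h with h | h | ⟨e, he, hu, hv⟩
  · exact Or.inl h.symm
  · exact Or.inr (Or.inl h.symm)
  · exact Or.inr (Or.inr ⟨e, he, hv, hu⟩)

namespace State

/-- The elementary properties of the states that occur. -/
structure Basic (S : State V K) (X : RankThree V) (list : V → Finset K) (θ phat : ℝ) : Prop where
  θ_pos : 0 < θ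
  phat_pos : 0 < phat
  θ_phat : θ * phat ≤ 1 / 2
  p_nonneg : ∀ u c, 0 ≤ S.p u c
  p_le : ∀ u c, S.p u c ≤ phat
  p_supp : ∀ u c, c ∉ list u → S.p u c = 0
  mem_B : ∀ u c, c ∈ S.B u ↔ S.p u c = phat
  adj_U : ∀ c u v, (S.graph c).Adj u v → u ∈ S.U
  adj_near : ∀ c u v, (S.graph c).Adj u v → X.Near u v

/-- The law of the bits of a round. -/
def law (S : State V K) (θ phat : ℝ) : (V × K) ⊕ (V × K) → Bool → ℝ :=
  Sum.elim (fun i => bern (θ * S.p i.1 i.2)) (fun i => bern (S.p i.1 i.2 / phat))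

/-- The sets of vertices that make `u` lose the colour `c` when all of them choose `c`. -/
def threats (S : State V K) (X : RankThree V) (u : V) (c : K) : Finset (Finset V) :=
  Finset.univ.filter fun t =>
    (∃ e ∈ S.triples X, u ∈ e ∧ t = e.erase u) ∨ ∃ v, (S.graph c).Adj u v ∧ t = {v}

variable {S : State V K} {X : RankThree V} {list : V → Finset K} {θ phat ω₀ : ℝ}

theorem mem_lost {γ : V → K → Bool} {u : V} {c : K} :
    c ∈ S.lost X γ u ↔ ∃ t ∈ S.threats X u c, ∀ v ∈ t, γ v c = true := by
  constructor
  · rintro (⟨e, he, hu, h⟩ | ⟨v, hv, h⟩)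
    · refine ⟨e.erase u, ?_, fun v hv => h v (Finset.mem_of_mem_erase hv)
        (Finset.ne_of_mem_erase hv)⟩
      simp only [threats, Finset.mem_filter_univ]
      exact Or.inl ⟨e, he, hu, rfl⟩
    · refine ⟨{v}, ?_, by simpa using h⟩
      simp only [threats, Finset.mem_filter_univ]
      exact Or.inr ⟨v, hv, rfl⟩
  · rintro ⟨t, ht, h⟩
    simp only [threats, Finset.mem_filter_univ] at ht
    rcases ht with ⟨e, he, hu, rfl⟩ | ⟨v, hv, rfl⟩
    · exact Or.inl ⟨e, he, hu, fun v hv hvu => h v (Finset.mem_erase.2 ⟨hvu, hv⟩)⟩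
    · exact Or.inr ⟨v, hv, h v (by simp)⟩

theorem not_mem_of_threats {u : V} {c : K} {t : Finset V} (ht : t ∈ S.threats X u c) : u ∉ t := by
  simp only [threats, Finset.mem_filter_univ] at ht
  rcases ht with ⟨e, he, hu, rfl⟩ | ⟨v, hv, rfl⟩
  · simp
  · simpa using hv.ne

theorem Basic.near_of_threats (hS : S.Basic X list θ phat) {u v : V} {c : K} {t : Finset V}
    (ht : t ∈ S.threats X u c) (hv : v ∈ t) : X.Near u v := by
  simp only [threats, Finset.mem_filter_univ] at ht
  rcases ht with ⟨e, he, hu, rfl⟩ | ⟨v', hv', rfl⟩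
  · exact Or.inr (Or.inr ⟨e, he.1, hu, Finset.mem_of_mem_erase hv⟩)
  · rw [Finset.mem_singleton] at hv
    exact hv ▸ hS.adj_near _ _ _ hv'

namespace Basic

variable (hS : S.Basic X list θ phat)
include hS

theorem θp_nonneg (u : V) (c : K) : 0 ≤ θ * S.p u c := mul_nonneg hS.θ_pos.le (hS.p_nonneg u c)

theorem θp_le (u : V) (c : K) : θ * S.p u c ≤ 1 / 2 :=
  (mul_le_mul_of_nonneg_left (hS.p_le u c) hS.θ_pos.le).trans hS.θ_phat

theorem p_div_nonneg (u : V) (c : K) : 0 ≤ S.p u c / phat :=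
  div_nonneg (hS.p_nonneg u c) hS.phat_pos.le

theorem p_div_le (u : V) (c : K) : S.p u c / phat ≤ 1 :=
  (div_le_one hS.phat_pos).2 (hS.p_le u c)

theorem isLaw : IsLaw (S.law θ phat) where
  nonneg := by
    rintro (i | i) a <;> cases a <;> simp only [law, Sum.elim_inl, Sum.elim_inr, bern, cond_true,
      cond_false]
    · linarith [hS.θp_le i.1 i.2]
    · exact hS.θp_nonneg _ _
    · linarith [hS.p_div_le i.1 i.2]
    · exact hS.p_div_nonneg _ _
  sum_eq_one := by rintro (i | i) <;> simp [law, bern]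

/-- The bound θp̂ ≤ 1/2 and p ≤ p̂ keep the coin parameters in [0, 1], so the truncation in `coin`
is inactive. This is the bridge between the product space used in the estimates and the laws of the
algorithm; through it a point of positive weight becomes an outcome in the support. -/
theorem weight_law (x : Bits V K) : weight (S.law θ phat) x =
    (S.gammaLaw θ (gam x)).toReal * (S.etaLaw phat (eta x)).toReal := by
  rw [gammaLaw, etaLaw, coins_apply_toReal hS.θp_nonneg fun u c => (hS.θp_le u c).trans (by norm_num),
    coins_apply_toReal hS.p_div_nonneg hS.p_div_le]
  rw [weight, Fintype.prod_sum_type, Fintype.prod_prod_type, Fintype.prod_prod_type]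
  rfl

theorem mem_support {x : Bits V K} (hx : 0 < weight (S.law θ phat) x) :
    gam x ∈ (S.gammaLaw θ).support ∧ eta x ∈ (S.etaLaw phat).support := by
  rw [hS.weight_law] at hx
  rw [PMF.mem_support_iff, PMF.mem_support_iff]
  constructor <;> intro h <;> simp [h] at hx

theorem ex_gam (F : (V → K → Bool) → ℝ) :
    ex (S.law θ phat) (fun x => F (gam x)) = ∑ γ, (S.gammaLaw θ γ).toReal * F γ := by
  let e : Bits V K ≃ (V → K → Bool) × (V → K → Bool) :=
    (Equiv.sumArrowEquivProdArrow _ _ _).trans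
      ((Equiv.curry V K Bool).prodCongr (Equiv.curry V K Bool))
  have h : ex (S.law θ phat) (fun x => F (gam x)) =
      ∑ y : (V → K → Bool) × (V → K → Bool),
        (S.gammaLaw θ y.1).toReal * (S.etaLaw phat y.2).toReal * F y.1 := by
    unfold ex
    refine Finset.sum_bijective e e.bijective (fun x => by simp) fun x _ => ?_
    rw [hS.weight_law]
    rfl
  have h1 : ∑ η, (S.etaLaw phat η).toReal = 1 := by
    rw [← ENNReal.toReal_sum fun η _ => (S.etaLaw phat).apply_ne_top η,
      ← tsum_fintype (L := .unconditional _), (S.etaLaw phat).tsum_coe, ENNReal.toReal_one]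
  rw [h, Fintype.sum_prod_type]
  refine Finset.sum_congr rfl fun γ _ => ?_
  simp only
  rw [← Finset.sum_mul, ← Finset.mul_sum, h1, mul_one]

theorem probNotLost_eq (A : Set V) (c : K) :
    S.probNotLost X θ A c = pr (S.law θ phat) fun x => ∀ u ∈ A, c ∉ S.lost X (gam x) u := by
  rw [pr, hS.ex_gam fun γ => ind (∀ u ∈ A, c ∉ S.lost X γ u), probNotLost, prob,
    PMF.toOuterMeasure_apply_fintype, ENNReal.toReal_sum]
  · refine Finset.sum_congr rfl fun γ _ => ?_
    by_cases h : ∀ u ∈ A, c ∉ S.lost X γ u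
    · rw [Set.indicator_of_mem (by exact h), ind_of_true h, mul_one]
    · rw [Set.indicator_of_notMem (by exact h), ind_of_false h, mul_zero, ENNReal.toReal_zero]
  · intro γ _
    by_cases h : ∀ u ∈ A, c ∉ S.lost X γ u
    · rw [Set.indicator_of_mem (by exact h)]
      exact PMF.apply_ne_top _ _
    · rw [Set.indicator_of_notMem (by exact h)]
      exact ENNReal.zero_ne_top

theorem q_eq (u : V) (c : K) :
    S.q X θ u c = pr (S.law θ phat) fun x => c ∉ S.lost X (gam x) u := by
  rw [q, hS.probNotLost_eq]
  simp

theorem q_nonneg (u : V) (c : K) : 0 ≤ S.q X θ u c := by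
  rw [hS.q_eq]; exact pr_nonneg hS.isLaw _

theorem q_le_one (u : V) (c : K) : S.q X θ u c ≤ 1 := by
  rw [hS.q_eq]; exact pr_le_one hS.isLaw _

theorem ex_gam_apply (u : V) (c : K) :
    ex (S.law θ phat) (fun x => ind (gam x u c = true)) = θ * S.p u c := by
  refine (ex_coord hS.isLaw (Sum.inl (u, c)) fun a => ind (a = true)).trans ?_
  simp [law, bern, ind]

theorem ex_eta_apply (u : V) (c : K) :
    ex (S.law θ phat) (fun x => ind (eta x u c = true)) = S.p u c / phat := by
  refine (ex_coord hS.isLaw (Sum.inr (u, c)) fun a => ind (a = true)).trans ?_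
  simp [law, bern, ind]

theorem ex_prod_gam (t : Finset V) (c : K) :
    ex (S.law θ phat) (fun x => ∏ v ∈ t, ind (gam x v c = true)) =
      ∏ v ∈ t, θ * S.p v c := by
  rw [ex_prod hS.isLaw t (fun v x => ind (gam x v c = true))
    fun v => {Sum.inl (v, c)}]
  · exact Finset.prod_congr rfl fun v _ => hS.ex_gam_apply v c
  · intro v _ v' _ h
    simpa using h
  · intro v _ x y h
    simp only [gam, h _ rfl]

end Basic

end State

end SemiRandom

/-! ### The weights after a round and their expectations -/

namespace SemiRandom

open FinProb

variable {V K : Type*} [Fintype V] [Fintype K]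

namespace State

/-- The weight of `c` at `u` after the round, as a function of the bits. -/
def pn (S : State V K) (X : RankThree V) (θ phat : ℝ) (u : V) (c : K) (x : Bits V K) : ℝ :=
  nextWeight X θ phat S (gam x) (eta x) u c

/-- The weight of `c` at `u` is determined by the survival of `c`. -/
def Gcase (S : State V K) (X : RankThree V) (θ phat : ℝ) (u : V) (c : K) : Prop :=
  S.p u c / S.q X θ u c < phat ∧ c ∉ S.B u

variable {S : State V K} {X : RankThree V} {list : V → Finset K} {θ phat ω₀ : ℝ}

theorem pn_of_gcase {u : V} {c : K} (h : S.Gcase X θ phat u c) (x : Bits V K) :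
    S.pn X θ phat u c x = S.p u c / S.q X θ u c * ind (c ∉ S.lost X (gam x) u) := by
  rw [pn, nextWeight, if_pos (show _ ∧ _ from h)]
  by_cases hl : c ∈ S.lost X (gam x) u
  · rw [ind_of_false (not_not.2 hl), if_neg, mul_zero]
    exact fun h' => h'.2 hl
  · rw [ind_of_true hl, if_pos ⟨h.2, hl⟩, mul_one]

theorem pn_of_not_gcase {u : V} {c : K} (h : ¬ S.Gcase X θ phat u c) (x : Bits V K) :
    S.pn X θ phat u c x = phat * ind (eta x u c = true) := by
  rw [pn, nextWeight, if_neg (show ¬ (_ ∧ _) from h), ind]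
  split_ifs <;> simp

theorem lost_mono {γ γ' : V → K → Bool} (h : ∀ v c, γ v c = true → γ' v c = true) (u : V) :
    S.lost X γ u ⊆ S.lost X γ' u := by
  intro c hc
  rw [mem_lost] at hc ⊢
  obtain ⟨t, ht, h1⟩ := hc
  exact ⟨t, ht, fun v hv => h v c (h1 v hv)⟩

theorem gam_mono {x y : Bits V K} (h : x ≤ y) (v : V) (c : K) (hx : gam x v c = true) :
    gam y v c = true := by
  have := h (Sum.inl (v, c))
  have hx' : x (Sum.inl (v, c)) = true := hx
  rw [hx'] at this
  exact top_le_iff.1 this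

namespace Basic

variable (hS : S.Basic X list θ phat)
include hS

theorem lost_dependsOn (u : V) (c : K) : DependsOn (fun x : Bits V K => c ∈ S.lost X (gam x) u)
    {i | ∃ v, i = Sum.inl (v, c) ∧ v ≠ u ∧ X.Near u v} := by
  intro x y h
  simp only [mem_lost]
  refine propext (exists_congr fun t => and_congr_right fun ht => forall₂_congr fun v hv => ?_)
  rw [gam, gam, h (Sum.inl (v, c)) ⟨v, rfl, ?_, hS.near_of_threats ht hv⟩]
  rintro rfl
  exact not_mem_of_threats ht hv

theorem pn_dependsOn (u : V) (c : K) :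
    DependsOn (S.pn X θ phat u c) {i | col i = c ∧ X.Near u (vert i)} := by
  intro x y h
  by_cases hg : S.Gcase X θ phat u c
  · have hl : (c ∈ S.lost X (gam x) u) = (c ∈ S.lost X (gam y) u) :=
      hS.lost_dependsOn u c fun i hi => by
        obtain ⟨v, rfl, hv, hn⟩ := hi
        exact h _ ⟨rfl, hn⟩
    rw [pn_of_gcase hg, pn_of_gcase hg, hl]
  · rw [pn_of_not_gcase hg, pn_of_not_gcase hg, eta, eta, h (Sum.inr (u, c)) ⟨rfl, Or.inl rfl⟩]

theorem pn_nonneg (u : V) (c : K) (x : Bits V K) : 0 ≤ S.pn X θ phat u c x := by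
  by_cases hg : S.Gcase X θ phat u c
  · rw [pn_of_gcase hg]
    exact mul_nonneg (div_nonneg (hS.p_nonneg u c) (hS.q_nonneg u c)) (ind_nonneg _)
  · rw [pn_of_not_gcase hg]
    exact mul_nonneg hS.phat_pos.le (ind_nonneg _)

theorem pn_le (u : V) (c : K) (x : Bits V K) : S.pn X θ phat u c x ≤ phat := by
  by_cases hg : S.Gcase X θ phat u c
  · rw [pn_of_gcase hg]
    exact (mul_le_of_le_one_right (div_nonneg (hS.p_nonneg u c) (hS.q_nonneg u c))
      (ind_le_one _)).trans hg.1.le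
  · rw [pn_of_not_gcase hg]
    exact mul_le_of_le_one_right hS.phat_pos.le (ind_le_one _)

theorem pn_eq_zero {u : V} {c : K} (h : S.p u c = 0) (x : Bits V K) :
    S.pn X θ phat u c x = 0 := by
  have hg : S.Gcase X θ phat u c := by
    refine ⟨by rw [h, zero_div]; exact hS.phat_pos, fun hB => ?_⟩
    rw [hS.mem_B, h] at hB
    exact hS.phat_pos.ne hB
  rw [pn_of_gcase hg, h, zero_div, zero_mul]

/-- A lost colour is dead at the vertex afterwards: it has weight 0 or has entered B. Together with
`pn_eq_of_eq_phat` and `pn_eq_zero`, which make deadness permanent, this is what the properness of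
the colouring rests on. -/
theorem pn_eq_zero_of_lost {u : V} {c : K} {x : Bits V K} (hl : c ∈ S.lost X (gam x) u) :
    S.pn X θ phat u c x = 0 ∨ S.pn X θ phat u c x = phat := by
  by_cases hg : S.Gcase X θ phat u c
  · left
    rw [pn_of_gcase hg, ind_of_false (not_not.2 hl), mul_zero]
  · rw [pn_of_not_gcase hg]
    by_cases h : eta x u c = true
    · right; rw [ind_of_true h, mul_one]
    · left; rw [ind_of_false h, mul_zero]

theorem pn_eq_of_eq_phat {u : V} {c : K} (h : S.p u c = phat) (x : Bits V K) :
    S.pn X θ phat u c x = 0 ∨ S.pn X θ phat u c x = phat := by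
  have hg : ¬ S.Gcase X θ phat u c := fun hg => hg.2 ((hS.mem_B u c).2 h)
  rw [pn_of_not_gcase hg]
  by_cases h : eta x u c = true
  · right; rw [ind_of_true h, mul_one]
  · left; rw [ind_of_false h, mul_zero]

/-- The division by q compensates exactly for the chance of losing c, and in the other case the coin
has bias p/p̂. So the weights form a martingale. -/
theorem ex_pn {u : V} {c : K} (hq : 0 < S.q X θ u c) :
    ex (S.law θ phat) (S.pn X θ phat u c) = S.p u c := by
  by_cases hg : S.Gcase X θ phat u c
  · rw [ex_congr (pn_of_gcase hg), ex_mul_left]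
    change _ * pr _ _ = _
    rw [← hS.q_eq]
    field_simp
  · rw [ex_congr (pn_of_not_gcase hg), ex_mul_left, hS.ex_eta_apply]
    have := hS.phat_pos.ne'
    field_simp

theorem noLoss_dependsOn (A : Finset V) (c : K) :
    DependsOn (fun x : Bits V K => ind (∀ u ∈ A, c ∉ S.lost X (gam x) u)) (Set.range Sum.inl) := by
  intro x y h
  refine congrArg ind (propext (forall₂_congr fun u _ => not_congr (iff_of_eq ?_)))
  refine hS.lost_dependsOn u c fun i hi => h i ?_
  obtain ⟨v, rfl, -⟩ := hi
  exact ⟨_, rfl⟩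

/-- On the vertices whose weight is decided by the coins η the factors are independent of everything
else and average to p. On the others the product is ∏ p/q times the indicator that nobody loses c.
That event is decreasing in the choices, so by FKG it is negatively correlated with the increasing
factor h, and the hypothesis `hA` replaces its probability by κ ∏ q, which cancels the denominators.
The factor h will be the indicator that a further vertex chooses c. -/
theorem ex_mul_prod_pn_le (A : Finset V) (c : K) {κ : ℝ}
    (hA : ∀ A' ⊆ A, (∀ u ∈ A', c ∉ S.B u) →
      S.probNotLost X θ (A' : Set V) c ≤ (∏ u ∈ A', S.q X θ u c) * κ)
    (h : Bits V K → ℝ) (h0 : ∀ x, 0 ≤ h x) (hm : Monotone h)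
    (hd : DependsOn h (Set.range Sum.inl)) :
    ex (S.law θ phat) (fun x => h x * ∏ u ∈ A, S.pn X θ phat u c x) ≤
      ex (S.law θ phat) h * ((∏ u ∈ A, S.p u c) * κ) := by
  set A1 := A.filter fun u => S.Gcase X θ phat u c with hA1
  set A2 := A.filter fun u => ¬ S.Gcase X θ phat u c with hA2
  have hsplit : ∀ x, h x * ∏ u ∈ A, S.pn X θ phat u c x =
      ((∏ u ∈ A1, S.p u c / S.q X θ u c) * phat ^ A2.card) *
        ((h x * ind (∀ u ∈ A1, c ∉ S.lost X (gam x) u)) *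
          ∏ u ∈ A2, ind (eta x u c = true)) := by
    intro x
    rw [← Finset.prod_filter_mul_prod_filter_not A fun u => S.Gcase X θ phat u c,
      Finset.prod_congr rfl fun u hu => pn_of_gcase (Finset.mem_filter.1 hu).2 x,
      Finset.prod_congr rfl fun u hu => pn_of_not_gcase (Finset.mem_filter.1 hu).2 x,
      Finset.prod_mul_distrib, Finset.prod_mul_distrib, ind_ball, Finset.prod_const]
    ring
  rw [ex_congr hsplit, ex_mul_left, ex_mul_of_disjoint hS.isLaw (s := Set.range Sum.inl)
    (t := Set.range Sum.inr) (Set.isCompl_range_inl_range_inr).disjoint]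
  rotate_left
  · intro x y hxy
    simp only
    rw [hd hxy]
    congr 1
    exact hS.noLoss_dependsOn A1 c hxy
  · refine dependsOn_prod fun u _ x y hxy => ?_
    rw [eta, eta, hxy _ ⟨(u, c), rfl⟩]
  have e1 : ex (S.law θ phat) (fun x => ∏ u ∈ A2, ind (eta x u c = true)) =
      ∏ u ∈ A2, S.p u c / phat := by
    rw [ex_prod hS.isLaw A2 (fun v x => ind (eta x v c = true)) fun v => {Sum.inr (v, c)}]
    · exact Finset.prod_congr rfl fun v _ => hS.ex_eta_apply v c
    · intro v _ v' _ h
      simpa using h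
    · intro v _ x y h
      simp only [eta, h _ rfl]
  have e2 : ex (S.law θ phat) (fun x => h x * ind (∀ u ∈ A1, c ∉ S.lost X (gam x) u)) ≤
      ex (S.law θ phat) h * ((∏ u ∈ A1, S.q X θ u c) * κ) := by
    refine (ex_mul_le_of_monotone_antitone hS.isLaw h0 (M := 1) (fun x => ind_le_one _) hm
      fun x y hxy => ind_mono fun h u hu hl => h u hu
        (lost_mono (fun v c => gam_mono hxy v c) u hl)).trans ?_
    refine mul_le_mul_of_nonneg_left ?_ (ex_nonneg hS.isLaw h0)
    have := hA A1 (Finset.filter_subset _ _) fun u hu => (Finset.mem_filter.1 hu).2.2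
    rwa [hS.probNotLost_eq] at this
  have hpos : 0 ≤ ∏ u ∈ A2, S.p u c / phat := Finset.prod_nonneg fun u _ => hS.p_div_nonneg u c
  have hpos1 : 0 ≤ ∏ u ∈ A1, S.p u c / S.q X θ u c := Finset.prod_nonneg fun u _ =>
    div_nonneg (hS.p_nonneg u c) (hS.q_nonneg u c)
  have hκ : 0 ≤ κ := by
    have := hA ∅ (by simp) (by simp)
    rw [hS.probNotLost_eq] at this
    exact (pr_nonneg hS.isLaw _).trans (by simpa using this)
  have hph := hS.phat_pos
  have hf2 : phat ^ A2.card * ∏ u ∈ A2, S.p u c / phat = ∏ u ∈ A2, S.p u c := by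
    rw [← Finset.prod_const, ← Finset.prod_mul_distrib]
    exact Finset.prod_congr rfl fun u _ => by field_simp
  have hf1 : (∏ u ∈ A1, S.p u c / S.q X θ u c) * ∏ u ∈ A1, S.q X θ u c ≤ ∏ u ∈ A1, S.p u c := by
    rw [← Finset.prod_mul_distrib]
    refine Finset.prod_le_prod (fun u _ => mul_nonneg
      (div_nonneg (hS.p_nonneg u c) (hS.q_nonneg u c)) (hS.q_nonneg u c)) fun u _ => ?_
    -- If q = 0, the quotient p/q is 0 by convention and the inequality still holds.
    rcases (hS.q_nonneg u c).eq_or_lt with hq | hq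
    · rw [← hq, mul_zero]; exact hS.p_nonneg u c
    · rw [div_mul_cancel₀ _ hq.ne']
  have hf : (∏ u ∈ A1, S.p u c) * ∏ u ∈ A2, S.p u c = ∏ u ∈ A, S.p u c :=
    Finset.prod_filter_mul_prod_filter_not A _ _
  rw [e1]
  have hh := ex_nonneg hS.isLaw h0
  calc _ ≤ ((∏ u ∈ A1, S.p u c / S.q X θ u c) * phat ^ A2.card) *
        ((ex (S.law θ phat) h * ((∏ u ∈ A1, S.q X θ u c) * κ)) * ∏ u ∈ A2, S.p u c / phat) := by
        gcongr
    _ = ex (S.law θ phat) h * κ * (((∏ u ∈ A1, S.p u c / S.q X θ u c) * ∏ u ∈ A1, S.q X θ u c) *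
          (phat ^ A2.card * ∏ u ∈ A2, S.p u c / phat)) := by ring
    _ ≤ ex (S.law θ phat) h * κ * ((∏ u ∈ A1, S.p u c) * ∏ u ∈ A2, S.p u c) := by
        rw [hf2]
        have : 0 ≤ ∏ u ∈ A2, S.p u c := Finset.prod_nonneg fun u _ => hS.p_nonneg u c
        gcongr
    _ = _ := by rw [hf]; ring

/-- Near-independence for a set of at most one vertex. -/
theorem probNotLost_le_of_card {A : Finset V} (c : K) (hA : A.card ≤ 1) {κ : ℝ} (hκ : 1 ≤ κ) :
    S.probNotLost X θ (A : Set V) c ≤ (∏ u ∈ A, S.q X θ u c) * κ := by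
  have hprod : 0 ≤ ∏ u ∈ A, S.q X θ u c := Finset.prod_nonneg fun u _ => hS.q_nonneg u c
  refine le_trans ?_ (le_mul_of_one_le_right hprod hκ)
  rcases Nat.le_one_iff_eq_zero_or_eq_one.1 hA with h | h
  · rw [Finset.card_eq_zero] at h
    subst h
    rw [hS.probNotLost_eq, Finset.prod_empty]
    exact pr_le_one hS.isLaw _
  · obtain ⟨u, rfl⟩ := Finset.card_eq_one.1 h
    rw [Finset.coe_singleton, Finset.prod_singleton, q]

/-- All subsets of a triple are needed, because the vertices governed by coins drop out of the
product. Sizes 2 and 3 are assumptions, and smaller sets satisfy the inequality trivially. -/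
theorem nearIndep_triple (hN : S.NearIndependent X θ ω₀) (hω : 0 < ω₀) {e : Finset V}
    (he : e ∈ S.triples X) (c : K) {A : Finset V} (hA : A ⊆ e) (hB : ∀ u ∈ A, c ∉ S.B u) :
    S.probNotLost X θ (A : Set V) c ≤ (∏ u ∈ A, S.q X θ u c) * (1 + 1 / ω₀) := by
  have hκ : 1 ≤ 1 + 1 / ω₀ := by have : 0 < 1 / ω₀ := by positivity
                                 linarith
  by_cases h1 : A.card ≤ 1
  · exact hS.probNotLost_le_of_card c h1 hκ
  by_cases h2 : A.card = 2
  · obtain ⟨u, v, huv, rfl⟩ := Finset.card_eq_two.1 h2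
    rw [Finset.coe_pair, Finset.prod_pair huv]
    exact hN.pair c e he u (hA (by simp)) v (hA (by simp)) huv (hB u (by simp)) (hB v (by simp))
  · have h3 : e.card = 3 := X.card_eq_three e he.1
    have : A = e := Finset.eq_of_subset_of_card_le hA (by omega)
    subst this
    exact hN.triple c A he hB

theorem nearIndep_edge (hN : S.NearIndependent X θ ω₀) (hω : 0 < ω₀) {u v : V} {c : K}
    (huv : (S.graph c).Adj u v) {A : Finset V} (hA : A ⊆ {u, v}) (hB : ∀ u ∈ A, c ∉ S.B u) :
    S.probNotLost X θ (A : Set V) c ≤ (∏ u ∈ A, S.q X θ u c) * (1 + 1 / ω₀) := by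
  have hκ : 1 ≤ 1 + 1 / ω₀ := by have : 0 < 1 / ω₀ := by positivity
                                 linarith
  by_cases h1 : A.card ≤ 1
  · exact hS.probNotLost_le_of_card c h1 hκ
  · have h3 : ({u, v} : Finset V).card = 2 := Finset.card_pair huv.ne
    have : A = {u, v} := Finset.eq_of_subset_of_card_le hA (by omega)
    subst this
    rw [Finset.coe_pair, Finset.prod_pair huv.ne]
    exact hN.edge c u v huv (hB u (by simp)) (hB v (by simp))

end Basic

end State

end SemiRandom

/-! ### Balanced partitions of the colours -/

namespace FinProb

/-- A partition of the colours that splits every one of the given weight functions evenly. -/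
theorem exists_partition {V K : Type*} [Fintype K] (N : Finset V) (p : V → K → ℝ) {ph s t M : ℝ}
    (J : ℕ) (hJ : 0 < J) (hp0 : ∀ v c, 0 ≤ p v c) (hp : ∀ v c, p v c ≤ ph) (hph : 0 ≤ ph)
    (hs : ∀ v ∈ N, ∑ c, p v c ≤ s) (ht : 0 < t) (hM : 0 ≤ M) (h1 : 2 * M * ph ≤ t)
    (h2 : 4 * M * (ph * (s / J)) ≤ t ^ 2) (hN : N.card * J * Real.exp (-M) < 1) :
    ∃ κ : K → Fin J, ∀ v ∈ N, ∀ j, ∑ c, p v c * ind (κ c = j) ≤ s / J + t := by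
  have hJ' : (0 : ℝ) < J := by exact_mod_cast hJ
  -- Each colour goes to a uniformly random part; a union bound over the vertices and the parts
  -- shows that some partition works.
  let w : K → Fin J → ℝ := fun _ _ => 1 / J
  have hw : IsLaw w := ⟨fun _ _ => by positivity, fun _ => by simp [w, hJ'.ne']⟩
  have hpt : ∀ v ∈ N, ∀ j : Fin J,
      pr w (fun κ => s / J + t ≤ ∑ c, p v c * ind (κ c = j)) ≤ Real.exp (-M) := by
    intro v hv j
    refine (pr_sum_tail_le hw id (fun c κ => p v c * ind (κ c = j)) ?_ ht hM hph ?_ ?_ ?_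
      h1 h2).1
    · intro c x y h
      simp only [h c rfl]
    · exact fun c κ => mul_nonneg (hp0 v c) (ind_nonneg _)
    · exact fun c κ => (mul_le_of_le_one_right (hp0 v c) (ind_le_one _)).trans (hp v c)
    · have e : ∀ c, ex w (fun κ => p v c * ind (κ c = j)) = p v c * (1 / J) := by
        intro c
        rw [ex_mul_left]
        congr 1
        refine (ex_coord hw c fun a => ind (a = j)).trans ?_
        simp [w, ind]
      simp only [e]
      rw [← Finset.sum_mul, div_eq_mul_one_div s]
      exact mul_le_mul_of_nonneg_right (hs v hv) (by positivity)
  have hlt : pr w (fun κ => ∃ a ∈ N ×ˢ (Finset.univ : Finset (Fin J)),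
      s / J + t ≤ ∑ c, p a.1 c * ind (κ c = a.2)) < 1 := by
    refine (pr_exists hw _ _).trans_lt (lt_of_le_of_lt ?_ hN)
    refine (Finset.sum_le_card_nsmul _ _ (Real.exp (-M)) fun a ha => ?_).trans_eq ?_
    · exact hpt a.1 (Finset.mem_product.1 ha).1 a.2
    · rw [Finset.card_product, Finset.card_univ, Fintype.card_fin, nsmul_eq_mul]
      push_cast
      ring
  obtain ⟨κ, hκ⟩ := exists_of_pr_lt_one hw hlt
  refine ⟨κ, fun v hv j => ?_⟩
  by_contra! hc
  exact hκ ⟨(v, j), by simp [hv], hc.le⟩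

end FinProb

/-! ### Survival probabilities and the concentration of uncoloured weight -/

namespace SemiRandom

open FinProb

variable {V K : Type*} [Fintype V] [Fintype K]

theorem exp_neg_two_mul_le {a : ℝ} (h0 : 0 ≤ a) (h1 : a ≤ 1 / 2) : Real.exp (-(2 * a)) ≤ 1 - a := by
  rw [Real.exp_neg, inv_le_comm₀ (Real.exp_pos _) (by linarith)]
  refine le_trans ?_ (Real.add_one_le_exp (2 * a))
  rw [inv_le_iff_one_le_mul₀ (by linarith)]
  nlinarith

namespace State

/-- The triples of uncoloured vertices that contain `u`. -/
def triplesAt (S : State V K) (X : RankThree V) (u : V) : Finset (Finset V) :=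
  Finset.univ.filter fun e => e ∈ S.triples X ∧ u ∈ e

/-- The neighbours of `u` in the graph `G_c`. -/
def nbrs (S : State V K) (c : K) (u : V) : Finset V :=
  Finset.univ.filter fun v => (S.graph c).Adj u v

/-- The expected number of sets of vertices that make `u` lose `c`. -/
def ell (S : State V K) (X : RankThree V) (θ : ℝ) (u : V) (c : K) : ℝ :=
  ∑ t ∈ S.threats X u c, ∏ v ∈ t, θ * S.p v c

variable {S : State V K} {X : RankThree V} {list : V → Finset K} {θ phat ω₀ : ℝ}

theorem mem_triplesAt {u : V} {e : Finset V} :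
    e ∈ S.triplesAt X u ↔ e ∈ S.triples X ∧ u ∈ e := by simp [triplesAt]

theorem mem_nbrs {u v : V} {c : K} : v ∈ S.nbrs c u ↔ (S.graph c).Adj u v := by simp [nbrs]

namespace Basic

variable (hS : S.Basic X list θ phat)
include hS

theorem threat_nonneg (t : Finset V) (c : K) : 0 ≤ ∏ v ∈ t, θ * S.p v c :=
  Finset.prod_nonneg fun v _ => hS.θp_nonneg v c

theorem threat_le {u : V} {c : K} {t : Finset V} (ht : t ∈ S.threats X u c) :
    ∏ v ∈ t, θ * S.p v c ≤ 1 / 2 := by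
  have hne : t.Nonempty := by
    simp only [threats, Finset.mem_filter_univ] at ht
    rcases ht with ⟨e, he, hu, rfl⟩ | ⟨v, hv, rfl⟩
    · rw [← Finset.card_pos, Finset.card_erase_of_mem hu, X.card_eq_three e he.1]
      norm_num
    · simp
  obtain ⟨v, hv⟩ := hne
  rw [← Finset.mul_prod_erase _ _ hv]
  refine (mul_le_of_le_one_right (hS.θp_nonneg v c) ?_).trans (hS.θp_le v c)
  exact Finset.prod_le_one (fun w _ => hS.θp_nonneg w c) fun w _ =>
    (hS.θp_le w c).trans (by norm_num)

theorem ell_nonneg (u : V) (c : K) : 0 ≤ S.ell X θ u c :=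
  Finset.sum_nonneg fun t _ => hS.threat_nonneg t c

theorem pr_threat (t : Finset V) (c : K) :
    pr (S.law θ phat) (fun x => ∀ v ∈ t, gam x v c = true) = ∏ v ∈ t, θ * S.p v c := by
  rw [← hS.ex_prod_gam]
  exact ex_congr fun x => ind_ball _ _

theorem one_sub_q_le (u : V) (c : K) : 1 - S.q X θ u c ≤ S.ell X θ u c := by
  rw [hS.q_eq, pr_not hS.isLaw, sub_sub_cancel]
  have h := pr_exists hS.isLaw (S.threats X u c)
    fun t (x : Bits V K) => ∀ v ∈ t, gam x v c = true
  refine (pr_mono hS.isLaw fun x hx => ?_).trans (h.trans_eq ?_)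
  · exact mem_lost.1 hx
  exact Finset.sum_congr rfl fun t _ => hS.pr_threat t c

/-- Survival is the intersection of the decreasing events that no threat is realised, so by FKG its
probability is at least the product of the single ones. A threat has probability z ≤ 1/2, and 1 - z
≥ exp(-2z). The opposite estimate `one_sub_q_le` is the union bound. -/
theorem exp_neg_ell_le_q (u : V) (c : K) : Real.exp (-(2 * S.ell X θ u c)) ≤ S.q X θ u c := by
  have h1 : S.q X θ u c = ex (S.law θ phat)
      (fun x => ∏ t ∈ S.threats X u c, ind (¬ ∀ v ∈ t, gam x v c = true)) := by
    rw [hS.q_eq]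
    refine ex_congr fun x => ?_
    rw [← ind_ball]
    refine congrArg ind (propext ?_)
    change ¬ c ∈ S.lost X (gam x) u ↔ _
    rw [mem_lost]
    push Not
    rfl
  rw [h1]
  refine le_trans ?_ (prod_ex_le_of_antitone hS.isLaw _ _ (fun _ _ _ => ind_nonneg _)
    (fun _ _ _ => ind_le_one _) fun t _ x y hxy => ind_mono fun h h' => h fun v hv =>
      gam_mono hxy v c (h' v hv))
  rw [ell, Finset.mul_sum, ← Finset.sum_neg_distrib, Real.exp_sum]
  refine Finset.prod_le_prod (fun t _ => (Real.exp_pos _).le) fun t ht => ?_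
  have : ex (S.law θ phat) (fun x => ind (¬ ∀ v ∈ t, gam x v c = true)) =
      1 - ∏ v ∈ t, θ * S.p v c := by
    rw [← hS.pr_threat]
    exact pr_not hS.isLaw _
  rw [this]
  exact exp_neg_two_mul_le (hS.threat_nonneg t c) (hS.threat_le ht)

theorem q_pos (u : V) (c : K) : 0 < S.q X θ u c :=
  (Real.exp_pos _).trans_le (hS.exp_neg_ell_le_q u c)

theorem neg_log_q_le (u : V) (c : K) : -Real.log (S.q X θ u c) ≤ 2 * S.ell X θ u c := by
  have := Real.log_le_log (Real.exp_pos _) (hS.exp_neg_ell_le_q u c)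
  rw [Real.log_exp] at this
  linarith

/-- Distinct triples at u leave distinct sets after removal of u, so indexing the threats by triples
and neighbours loses nothing. -/
theorem ell_le (u : V) (c : K) : S.ell X θ u c ≤
    ∑ e ∈ S.triplesAt X u, ∏ v ∈ e.erase u, θ * S.p v c + ∑ v ∈ S.nbrs c u, θ * S.p v c := by
  have h : S.threats X u c ⊆ (S.triplesAt X u).image (fun e => e.erase u) ∪
      (S.nbrs c u).image fun v => {v} := by
    intro t ht
    simp only [threats, Finset.mem_filter_univ] at ht
    rcases ht with ⟨e, he, hu, rfl⟩ | ⟨v, hv, rfl⟩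
    · exact Finset.mem_union_left _ (Finset.mem_image.2 ⟨e, mem_triplesAt.2 ⟨he, hu⟩, rfl⟩)
    · exact Finset.mem_union_right _ (Finset.mem_image.2 ⟨v, mem_nbrs.2 hv, rfl⟩)
  refine (Finset.sum_le_sum_of_subset_of_nonneg h fun t _ _ => hS.threat_nonneg t c).trans ?_
  rw [← Finset.union_sdiff_self_eq_union, Finset.sum_union Finset.disjoint_sdiff]
  refine add_le_add ?_ ?_
  · rw [Finset.sum_image]
    intro e he e' he' hee
    have h1 := (mem_triplesAt.1 he).2
    have h2 := (mem_triplesAt.1 he').2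
    have h3 : insert u (e.erase u) = insert u (e'.erase u) := congrArg (insert u) hee
    rwa [Finset.insert_erase h1, Finset.insert_erase h2] at h3
  · refine (Finset.sum_le_sum_of_subset_of_nonneg Finset.sdiff_subset
      fun t _ _ => hS.threat_nonneg t c).trans_eq ?_
    rw [Finset.sum_image fun v _ v' _ h => by simpa using h]
    simp

/-- The extra factor p_u(c) completes every threat to a full product over a triple or an edge, which
are the quantities that the invariant bounds. -/
theorem sum_p_mul_ell_le (u : V) {E f : ℝ}
    (hE : ∑ e ∈ S.triplesAt X u, ∑ c, ∏ v ∈ e, S.p v c ≤ E)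
    (hf : ∑ c, ∑ v ∈ S.nbrs c u, S.p u c * S.p v c ≤ f) :
    ∑ c, S.p u c * S.ell X θ u c ≤ θ ^ 2 * E + θ * f := by
  have h1 : ∀ c, S.p u c * S.ell X θ u c ≤
      θ ^ 2 * ∑ e ∈ S.triplesAt X u, ∏ v ∈ e, S.p v c +
        θ * ∑ v ∈ S.nbrs c u, S.p u c * S.p v c := by
    intro c
    refine (mul_le_mul_of_nonneg_left (hS.ell_le u c) (hS.p_nonneg u c)).trans_eq ?_
    rw [mul_add, Finset.mul_sum, Finset.mul_sum, Finset.mul_sum, Finset.mul_sum]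
    congr 1
    · refine Finset.sum_congr rfl fun e he => ?_
      have hu := (mem_triplesAt.1 he).2
      rw [← Finset.mul_prod_erase _ _ hu, Finset.prod_mul_distrib, Finset.prod_const,
        Finset.card_erase_of_mem hu, X.card_eq_three e (mem_triplesAt.1 he).1.1]
      ring
    · exact Finset.sum_congr rfl fun v _ => by ring
  refine (Finset.sum_le_sum fun c _ => h1 c).trans ?_
  rw [Finset.sum_add_distrib, ← Finset.mul_sum, ← Finset.mul_sum, Finset.sum_comm]
  have := hS.θ_pos
  gcongr

theorem cand_dependsOn (v : V) (d : K) :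
    DependsOn (fun x : Bits V K => d ∈ S.candidates X (gam x) v)
      {i | col i = d ∧ X.Near v (vert i)} := by
  intro x y h
  have hl : (d ∈ S.lost X (gam x) v) = (d ∈ S.lost X (gam y) v) :=
    hS.lost_dependsOn v d fun i hi => by
      obtain ⟨v, rfl, hv, hn⟩ := hi
      exact h _ ⟨rfl, hn⟩
  have hg : gam x v d = gam y v d := h (Sum.inl (v, d)) ⟨rfl, Or.inl rfl⟩
  change ((d ∉ S.B v ∧ d ∉ S.lost X (gam x) v) ∧ gam x v d = true) =
    ((d ∉ S.B v ∧ d ∉ S.lost X (gam y) v) ∧ gam y v d = true)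
  rw [hl, hg]

/-- Losing d at v depends only on the choices at other vertices, so it is independent of the choice
of d at v. -/
theorem pr_cand (v : V) (d : K) : pr (S.law θ phat) (fun x => d ∈ S.candidates X (gam x) v) =
    θ * (S.p v d * S.q X θ v d * ind (d ∉ S.B v)) := by
  by_cases hB : d ∈ S.B v
  · rw [ind_of_false (not_not.2 hB), mul_zero, mul_zero, pr,
      ex_congr (G := fun _ => 0) fun x => ind_of_false fun h => h.1.1 hB, ex_const hS.isLaw]
  · rw [ind_of_true hB, mul_one, ← mul_assoc, hS.q_eq, ← hS.ex_gam_apply]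
    change _ = pr _ _ * _
    rw [← pr_and_of_disjoint hS.isLaw (s := {Sum.inl (v, d)})
      (t := {i | ∃ v', i = Sum.inl (v', d) ∧ v' ≠ v ∧ X.Near v v'})]
    · refine le_antisymm (pr_mono hS.isLaw fun x h => ⟨h.2, h.1.2⟩)
        (pr_mono hS.isLaw fun x h => ⟨⟨hB, h.2⟩, h.1⟩)
    · rw [Set.disjoint_singleton_left]
      rintro ⟨v', h, hv, -⟩
      simp only [Sum.inl.injEq, Prod.mk.injEq] at h
      exact hv h.1.symm
    · intro x y h
      simp only [gam, h _ rfl]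
    · intro x y h
      exact congrArg Not (hS.lost_dependsOn v d h)

/-- The diagonal term contributes α, and the others are independent of the choice at v and
contribute at most θp̂s. This serves both the variance and a Markov-type estimate for the truncation
below. -/
theorem ex_gam_mul_sum_le (N : Finset V) (a : V → ℝ) (ha0 : ∀ v, 0 ≤ a v) {α s : ℝ}
    (ha : ∀ v, a v ≤ α) (hs : ∑ v ∈ N, a v ≤ s) (v : V) (d : K) :
    ex (S.law θ phat) (fun x => ind (gam x v d = true) * ∑ v' ∈ N, a v' * ind (gam x v' d = true)) ≤
      θ * S.p v d * (α + θ * phat * s) := by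
  have hα : 0 ≤ α := (ha0 v).trans (ha v)
  have h1 : ∀ v', ex (S.law θ phat) (fun x => ind (gam x v d = true) *
      (a v' * ind (gam x v' d = true))) ≤
      (if v' = v then θ * S.p v d * α else 0) + θ * S.p v d * (θ * phat) * a v' := by
    intro v'
    split_ifs with h
    · subst h
      have : ex (S.law θ phat) (fun x => ind (gam x v' d = true) *
          (a v' * ind (gam x v' d = true))) ≤ θ * S.p v' d * α := by
        rw [← hS.ex_gam_apply, ← ex_mul_right]
        refine ex_mono hS.isLaw fun x => ?_
        refine mul_le_mul_of_nonneg_left ?_ (ind_nonneg _)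
        exact (mul_le_of_le_one_right (ha0 v') (ind_le_one _)).trans (ha v')
      have h2 := hS.θp_nonneg v' d
      have h3 := mul_nonneg (mul_nonneg h2 (mul_nonneg hS.θ_pos.le hS.phat_pos.le)) (ha0 v')
      linarith
    · rw [ex_mul_of_disjoint hS.isLaw (s := {Sum.inl (v, d)}) (t := {Sum.inl (v', d)}),
        ex_mul_left, hS.ex_gam_apply, hS.ex_gam_apply, zero_add, mul_assoc (θ * S.p v d)]
      · refine mul_le_mul_of_nonneg_left ?_ (hS.θp_nonneg v d)
        rw [mul_comm]
        refine mul_le_mul_of_nonneg_right ?_ (ha0 v')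
        exact mul_le_mul_of_nonneg_left (hS.p_le v' d) hS.θ_pos.le
      · simpa using fun h' => h h'.symm
      · intro x y h'
        simp only [gam, h' _ rfl]
      · intro x y h'
        simp only [gam, h' _ rfl]
  simp only [Finset.mul_sum]
  rw [ex_sum]
  refine (Finset.sum_le_sum fun v' _ => h1 v').trans ?_
  rw [Finset.sum_add_distrib, ← Finset.mul_sum, mul_add]
  refine add_le_add ?_ ?_
  · rw [Finset.sum_ite_eq']
    split_ifs
    · exact le_rfl
    · exact mul_nonneg (hS.θp_nonneg v d) hα
  · have h2 := mul_nonneg (hS.θp_nonneg v d) (mul_nonneg hS.θ_pos.le hS.phat_pos.le)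
    calc _ ≤ θ * S.p v d * (θ * phat) * s := mul_le_mul_of_nonneg_left hs h2
      _ = _ := by ring

/-- A weighted sum over vertices without candidates is concentrated. -/
theorem pr_weighted_uncolored_le (N : Finset V) (a : V → ℝ) (ha0 : ∀ v, 0 ≤ a v) {α s t M : ℝ}
    (ha : ∀ v, a v ≤ α) (hα : 0 < α) (hs : ∑ v ∈ N, a v ≤ s) (D : Set K)
    (hθ : θ ≤ 1 / 100) (hw : ∀ v ∈ N, ∑ d, S.p v d ≤ 2)
    (hmass : ∀ v ∈ N, 58 / 100 ≤ ∑ d, ind (d ∈ D) * (S.p v d * S.q X θ v d * ind (d ∉ S.B v)))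
    (ht : 0 < t) (hM : 0 ≤ M) (h1 : 2 * M * (100 * (α + θ * phat * s)) ≤ t)
    (h2 : 4 * M * (2 * θ * s * (α + θ * phat * s)) ≤ t ^ 2) :
    pr (S.law θ phat) (fun x => (1 - 55 / 100 * θ) * ∑ v ∈ N, a v + t ≤
      ∑ v ∈ N, a v * ind (∀ d ∈ D, d ∉ S.candidates X (gam x) v)) ≤ Real.exp (-M) := by
  have hθ0 := hS.θ_pos
  have hph := hS.phat_pos
  have hs0 : 0 ≤ s := (Finset.sum_nonneg fun v _ => ha0 v).trans hs
  set β := α + θ * phat * s with hβ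
  have hβ0 : 0 < β := by positivity
  set g : K → Bits V K → ℝ := fun d x => ∑ v ∈ N, a v * ind (gam x v d = true) with hg
  have hg0 : ∀ d x, 0 ≤ g d x := fun d x =>
    Finset.sum_nonneg fun v _ => mul_nonneg (ha0 v) (ind_nonneg _)
  -- A candidate d is counted only if the total weight g of the vertices choosing d is at most 100β.
  -- Dropping candidates can only enlarge F, and the effect of a single colour on F becomes bounded
  -- by 100β.
  set I : K → V → Bits V K → ℝ := fun d v x =>
    ind (d ∈ D) * ind (d ∈ S.candidates X (gam x) v) * ind (g d x ≤ 100 * β) with hI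
  have hI0 : ∀ d v x, 0 ≤ I d v x := fun d v x =>
    mul_nonneg (mul_nonneg (ind_nonneg _) (ind_nonneg _)) (ind_nonneg _)
  have hI1 : ∀ d v x, I d v x ≤ 1 := fun d v x =>
    mul_le_one₀ (mul_le_one₀ (ind_le_one _) (ind_nonneg _) (ind_le_one _)) (ind_nonneg _)
      (ind_le_one _)
  have hgd : ∀ d, DependsOn (g d) {i | col i = d} := by
    intro d
    refine dependsOn_sum fun v _ x y h => ?_
    simp only [gam, h (Sum.inl (v, d)) rfl]
  have hId : ∀ d v, DependsOn (I d v) {i | col i = d} := by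
    intro d v x y h
    have e1 : (d ∈ S.candidates X (gam x) v) = (d ∈ S.candidates X (gam y) v) :=
      hS.cand_dependsOn v d fun i hi => h i hi.1
    simp only [hI, e1, hgd d h]
  set F : Bits V K → ℝ := fun x => ∑ v ∈ N, a v * ∏ d, (1 - I d v x) with hF
  refine (pr_mono hS.isLaw (Q := fun x => (1 - 55 / 100 * θ) * ∑ v ∈ N, a v + t ≤ F x)
    fun x (hx : _ ≤ _) => hx.trans ?_).trans ?_
  · refine Finset.sum_le_sum fun v _ => mul_le_mul_of_nonneg_left ?_ (ha0 v)
    by_cases h : ∀ d ∈ D, d ∉ S.candidates X (gam x) v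
    · rw [ind_of_true h, Finset.prod_eq_one fun d _ => ?_]
      by_cases hd : d ∈ D
      · simp only [hI, ind_of_false (h d hd), mul_zero, zero_mul, sub_zero]
      · simp only [hI, ind_of_false hd, zero_mul, sub_zero]
    · rw [ind_of_false h]
      exact Finset.prod_nonneg fun d _ => sub_nonneg.2 (hI1 d v x)
  -- The blocks are the colours; F is decoupled from colour d by deleting the factor of d from each
  -- product.
  refine pr_tail_le hS.isLaw col F
    (fun d x => ∑ v ∈ N, a v * ∏ d' ∈ Finset.univ.erase d, (1 - I d' v x))
    (fun d x => g d x * ind (g d x ≤ 100 * β)) ?_ ?_ ?_ ht hM (B := 100 * β)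
    (W := 2 * θ * s * β) ?_ ?_ ?_ h1 h2
  · intro d
    refine dependsOn_sum fun v _ x y h => ?_
    have := dependsOn_prod (S := Finset.univ.erase d) (f := fun d' x => 1 - I d' v x)
      (t := {i | col i ≠ d}) (fun d' hd' x y h => by
        simp only
        rw [hId d' v fun i hi => h i ?_]
        change col i ≠ d
        rw [show col i = d' from hi]
        exact Finset.ne_of_mem_erase hd') h
    simp only at this ⊢
    rw [this]
  · intro d x y h
    simp only [hgd d h]
  · intro d x
    have e : F x - ∑ v ∈ N, a v * ∏ d' ∈ Finset.univ.erase d, (1 - I d' v x) =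
        -∑ v ∈ N, a v * (I d v x * ∏ d' ∈ Finset.univ.erase d, (1 - I d' v x)) := by
      rw [hF, ← Finset.sum_sub_distrib, ← Finset.sum_neg_distrib]
      refine Finset.sum_congr rfl fun v _ => ?_
      rw [← Finset.mul_prod_erase _ _ (Finset.mem_univ d)]
      ring
    have hP0 : ∀ v, 0 ≤ ∏ d' ∈ Finset.univ.erase d, (1 - I d' v x) := fun v =>
      Finset.prod_nonneg fun d' _ => sub_nonneg.2 (hI1 d' v x)
    rw [e, abs_neg, abs_of_nonneg (Finset.sum_nonneg fun v _ =>
      mul_nonneg (ha0 v) (mul_nonneg (hI0 d v x) (hP0 v)))]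
    change _ ≤ (∑ v ∈ N, a v * ind (gam x v d = true)) * ind (g d x ≤ 100 * β)
    rw [Finset.sum_mul]
    refine Finset.sum_le_sum fun v _ => ?_
    rw [mul_assoc (a v)]
    refine mul_le_mul_of_nonneg_left ?_ (ha0 v)
    refine (mul_le_of_le_one_right (hI0 d v x) (Finset.prod_le_one
      (fun d' _ => sub_nonneg.2 (hI1 d' v x)) fun d' _ => by linarith [hI0 d' v x])).trans ?_
    refine mul_le_mul_of_nonneg_right ?_ (ind_nonneg _)
    exact (mul_le_of_le_one_left (ind_nonneg _) (ind_le_one _)).trans (ind_mono fun h => h.2)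
  · intro d x
    by_cases h : g d x ≤ 100 * β
    · rw [ind_of_true h, mul_one]; exact h
    · rw [ind_of_false h, mul_zero]; positivity
  · have e1 : ∀ d, ex (S.law θ phat) (fun x => (g d x * ind (g d x ≤ 100 * β)) ^ 2) ≤
        ∑ v ∈ N, a v * (θ * S.p v d * β) := by
      intro d
      refine (ex_mono hS.isLaw (G := fun x => ∑ v ∈ N, a v * (ind (gam x v d = true) * g d x))
        fun x => ?_).trans ?_
      · have : ∑ v ∈ N, a v * (ind (gam x v d = true) * g d x) = g d x * g d x := by
          conv_rhs => rw [hg]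
          simp only
          rw [Finset.sum_mul]
          exact Finset.sum_congr rfl fun v _ => by ring
        rw [this, sq]
        have h3 : g d x * ind (g d x ≤ 100 * β) ≤ g d x :=
          mul_le_of_le_one_right (hg0 d x) (ind_le_one _)
        exact mul_le_mul h3 h3 (mul_nonneg (hg0 d x) (ind_nonneg _)) (hg0 d x)
      · rw [ex_sum]
        refine Finset.sum_le_sum fun v _ => ?_
        rw [ex_mul_left]
        exact mul_le_mul_of_nonneg_left (hS.ex_gam_mul_sum_le N a ha0 ha hs v d) (ha0 v)
    refine (Finset.sum_le_sum fun d _ => e1 d).trans ?_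
    rw [Finset.sum_comm]
    have e2 : ∀ v ∈ N, ∑ d, a v * (θ * S.p v d * β) ≤ a v * (2 * θ * β) := by
      intro v hv
      rw [← Finset.mul_sum]
      refine mul_le_mul_of_nonneg_left ?_ (ha0 v)
      rw [← Finset.sum_mul, ← Finset.mul_sum]
      nlinarith [hw v hv, mul_pos hθ0 hβ0]
    refine (Finset.sum_le_sum e2).trans ?_
    rw [← Finset.sum_mul]
    nlinarith [mul_pos hθ0 hβ0]
  -- Candidacies in different colours depend on disjoint sets of bits, so the probability of having
  -- none is a product, bounded by the exponential of minus the expected number of counted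
  -- candidates.
  · have e1 : ∀ v ∈ N, ex (S.law θ phat) (fun x => ∏ d, (1 - I d v x)) ≤ 1 - 55 / 100 * θ := by
      intro v hv
      rw [ex_prod hS.isLaw Finset.univ (fun d x => 1 - I d v x) fun d => {i | col i = d}]
      rotate_left
      · intro d _ d' _ hdd
        rw [Function.onFun, Set.disjoint_left]
        intro i hi hi'
        exact hdd ((show col i = d from hi) ▸ hi')
      · intro d _ x y h
        simp only [hId d v h]
      have hr : ∀ d, θ * (ind (d ∈ D) * (S.p v d * S.q X θ v d * ind (d ∉ S.B v))) -
          θ * S.p v d / 100 ≤ ex (S.law θ phat) (I d v) := by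
        intro d
        have h3 : ex (S.law θ phat) (fun x => ind (d ∈ D) * ind (d ∈ S.candidates X (gam x) v) -
            (ind (gam x v d = true) * g d x) * (1 / (100 * β))) ≤ ex (S.law θ phat) (I d v) := by
          refine ex_mono hS.isLaw fun x => ?_
          have hgx := hg0 d x
          have h5 : 0 ≤ (ind (gam x v d = true) * g d x) * (1 / (100 * β)) :=
            mul_nonneg (mul_nonneg (ind_nonneg _) hgx) (by positivity)
          by_cases h4 : g d x ≤ 100 * β
          · simp only [hI, ind_of_true h4, mul_one]
            linarith
          · simp only [hI, ind_of_false h4, mul_zero]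
            by_cases h6 : d ∈ S.candidates X (gam x) v
            · rw [ind_of_true (show gam x v d = true from h6.2), one_mul]
              have h7 : 1 ≤ g d x * (1 / (100 * β)) := by
                rw [mul_one_div, one_le_div (by positivity)]
                exact (not_le.1 h4).le
              have h8 := ind_le_one (d ∈ D)
              rw [ind_of_true h6, mul_one]
              linarith
            · rw [ind_of_false h6, mul_zero]
              linarith
        refine le_trans ?_ h3
        rw [ex_sub, ex_mul_left, ex_mul_right]
        have h9 := hS.pr_cand v d
        rw [pr] at h9
        rw [h9]
        have h10 := hS.ex_gam_mul_sum_le N a ha0 ha hs v d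
        have h11 : ex (S.law θ phat) (fun x => ind (gam x v d = true) * g d x) * (1 / (100 * β)) ≤
            θ * S.p v d * β * (1 / (100 * β)) :=
          mul_le_mul_of_nonneg_right h10 (by positivity)
        have h12 : θ * S.p v d * β * (1 / (100 * β)) = θ * S.p v d / 100 := by
          field_simp
        linarith
      -- The truncation costs at most θp/100 per colour, hence 2θ/100 of the available 58θ/100,
      -- because the total weight at v is at most 2.
      have hsum : 56 / 100 * θ ≤ ∑ d, ex (S.law θ phat) (I d v) := by
        refine le_trans ?_ (Finset.sum_le_sum fun d _ => hr d)
        rw [Finset.sum_sub_distrib, ← Finset.mul_sum, ← Finset.sum_div, ← Finset.mul_sum]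
        nlinarith [hmass v hv, hw v hv]
      have hle : ∏ d, ex (S.law θ phat) (fun x => 1 - I d v x) ≤
          Real.exp (-∑ d, ex (S.law θ phat) (I d v)) := by
        rw [← Finset.sum_neg_distrib, Real.exp_sum]
        refine Finset.prod_le_prod (fun d _ => ex_nonneg hS.isLaw fun x =>
          sub_nonneg.2 (hI1 d v x)) fun d _ => ?_
        rw [ex_sub, ex_const hS.isLaw]
        linarith [Real.add_one_le_exp (-ex (S.law θ phat) (I d v))]
      -- For θ ≤ 1/100 the slack between 0.56 and 0.55 absorbs the quadratic error: 1 ≤ (1 -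
      -- 0.55θ)(1 + 0.56θ).
      refine hle.trans ((Real.exp_le_exp.2 (neg_le_neg hsum)).trans ?_)
      rw [Real.exp_neg, inv_le_comm₀ (Real.exp_pos _) (by linarith)]
      refine le_trans ?_ (Real.add_one_le_exp _)
      rw [inv_le_iff_one_le_mul₀ (by linarith)]
      nlinarith
    rw [hF, ex_sum, Finset.mul_sum]
    refine Finset.sum_le_sum fun v hv => ?_
    rw [ex_mul_left, mul_comm]
    exact mul_le_mul_of_nonneg_right (e1 v hv) (ha0 v)

end Basic

end State

end SemiRandom

/-! ### Concentration of masses, entropy and new edges at a vertex -/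

namespace SemiRandom

open FinProb

variable {V K : Type*} [Fintype V] [Fintype K]

namespace State

/-- The number of pairs of a triple that contains `u` and another vertex of it that chooses `c`. -/
def hits (S : State V K) (X : RankThree V) (u : V) (c : K) (x : Bits V K) : ℝ :=
  ∑ e ∈ S.triplesAt X u, ∑ w ∈ e.erase u, ind (gam x w c = true)

/-- The weight of the potential new edges at `u` in colour `c`. -/
def newMass (S : State V K) (X : RankThree V) (θ phat : ℝ) (u : V) (c : K) (x : Bits V K) : ℝ :=
  ∑ e ∈ S.triplesAt X u, ∑ v ∈ e.erase u, ∑ w ∈ (e.erase u).erase v,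
    ind (gam x w c = true) * (S.pn X θ phat u c x * S.pn X θ phat v c x)

variable {S : State V K} {X : RankThree V} {list : V → Finset K} {θ phat ω₀ : ℝ}

namespace Basic

variable (hS : S.Basic X list θ phat)
include hS

theorem pn_dependsOn_col (u : V) (c : K) : DependsOn (S.pn X θ phat u c) {i | col i = c} :=
  dependsOn_subset (hS.pn_dependsOn u c) fun _ hi => hi.1

theorem pr_mass_le (u : V) {t M : ℝ} (ht : 0 < t) (hM : 0 ≤ M) (hw : ∑ c, S.p u c ≤ 2)
    (h1 : 2 * M * phat ≤ t) (h2 : 4 * M * (phat * 2) ≤ t ^ 2) :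
    pr (S.law θ phat) (fun x => t ≤ |∑ c, S.pn X θ phat u c x - ∑ c, S.p u c|) ≤
      2 * Real.exp (-M) := by
  have hm : ∑ c, ex (S.law θ phat) (S.pn X θ phat u c) = ∑ c, S.p u c :=
    Finset.sum_congr rfl fun c _ => hS.ex_pn (hS.q_pos u c)
  have h := pr_sum_tail_le hS.isLaw col (fun c => S.pn X θ phat u c)
    (fun c => hS.pn_dependsOn_col u c) ht hM hS.phat_pos.le (fun c x => hS.pn_nonneg u c x)
    (fun c x => hS.pn_le u c x) hm.le h1
    ((mul_le_mul_of_nonneg_left (mul_le_mul_of_nonneg_left hw hS.phat_pos.le)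
      (by positivity)).trans h2)
  refine (pr_mono hS.isLaw fun x hx => ?_).trans ((pr_or hS.isLaw).trans
    ((add_le_add h.1 h.2).trans_eq (two_mul _).symm))
  rcases le_abs.1 (show t ≤ |_| from hx) with h' | h'
  · left; linarith
  · right; rw [hm]; linarith

theorem prod_pn_nonneg (A : Finset V) (c : K) (x : Bits V K) :
    0 ≤ ∏ u ∈ A, S.pn X θ phat u c x := Finset.prod_nonneg fun u _ => hS.pn_nonneg u c x

theorem prod_pn_dependsOn (A : Finset V) (c : K) :
    DependsOn (fun x => ∏ u ∈ A, S.pn X θ phat u c x) {i | col i = c} :=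
  dependsOn_prod fun u _ => hS.pn_dependsOn_col u c

theorem ex_prod_pn_le (A : Finset V) (c : K) {κ : ℝ}
    (hA : ∀ A' ⊆ A, (∀ u ∈ A', c ∉ S.B u) →
      S.probNotLost X θ (A' : Set V) c ≤ (∏ u ∈ A', S.q X θ u c) * κ) :
    ex (S.law θ phat) (fun x => ∏ u ∈ A, S.pn X θ phat u c x) ≤ (∏ u ∈ A, S.p u c) * κ := by
  have h := hS.ex_mul_prod_pn_le A c hA (fun _ => 1) (fun _ => zero_le_one) monotone_const
    (fun _ _ _ => rfl)
  rw [ex_const hS.isLaw, one_mul] at h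
  simpa using h

theorem pr_triple_le (hN : S.NearIndependent X θ ω₀) (hω : 0 < ω₀) {e : Finset V}
    (he : e ∈ S.triples X) {E t M : ℝ} (ht : 0 < t) (hM : 0 ≤ M)
    (hE : ∑ c, ∏ u ∈ e, S.p u c ≤ E) (h1 : 2 * M * phat ^ 3 ≤ t)
    (h2 : 4 * M * (phat ^ 3 * (E * (1 + 1 / ω₀))) ≤ t ^ 2) :
    pr (S.law θ phat) (fun x => E * (1 + 1 / ω₀) + t ≤ ∑ c, ∏ u ∈ e, S.pn X θ phat u c x) ≤
      Real.exp (-M) := by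
  have hκ : 0 ≤ 1 + 1 / ω₀ := by positivity
  refine (pr_sum_tail_le hS.isLaw col (fun c x => ∏ u ∈ e, S.pn X θ phat u c x)
    (fun c => hS.prod_pn_dependsOn e c) ht hM (pow_nonneg hS.phat_pos.le 3)
    (fun c x => hS.prod_pn_nonneg e c x) (fun c x => ?_) ?_ h1 h2).1
  · rw [← X.card_eq_three e he.1, ← Finset.prod_const]
    exact Finset.prod_le_prod (fun u _ => hS.pn_nonneg u c x) fun u _ => hS.pn_le u c x
  · refine (Finset.sum_le_sum fun c _ => hS.ex_prod_pn_le e c fun A hA hB =>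
      hS.nearIndep_triple hN hω he c hA hB).trans ?_
    rw [← Finset.sum_mul]
    exact mul_le_mul_of_nonneg_right hE hκ

/-- If survival decides, the expectation is q · (-(p/q) log(p/q)) = -p log p + p log q. If the coin
decides, it is -p log p̂, and then p̂ ≤ p/q, so it is at least as large. In both cases -log q ≤ 2ℓ
finishes. -/
theorem negMulLog_le_ex (u : V) (c : K) :
    Real.negMulLog (S.p u c) - 2 * (S.p u c * S.ell X θ u c) ≤
      ex (S.law θ phat) fun x => Real.negMulLog (S.pn X θ phat u c x) := by
  have hq := hS.q_pos u c
  have hlq := hS.neg_log_q_le u c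
  rcases (hS.p_nonneg u c).eq_or_lt with h0 | hp
  · rw [ex_congr (G := fun _ => 0) fun x => by rw [hS.pn_eq_zero h0.symm x, Real.negMulLog_zero],
      ex_const hS.isLaw, ← h0]
    simp
  have hpl := mul_le_mul_of_nonneg_left hlq hp.le
  by_cases hg : S.Gcase X θ phat u c
  · have e : ∀ x, Real.negMulLog (S.pn X θ phat u c x) =
        Real.negMulLog (S.p u c / S.q X θ u c) * ind (c ∉ S.lost X (gam x) u) := by
      intro x
      rw [pn_of_gcase hg]
      by_cases h : c ∉ S.lost X (gam x) u
      · rw [ind_of_true h, mul_one, mul_one]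
      · rw [ind_of_false h, mul_zero, mul_zero, Real.negMulLog_zero]
    rw [ex_congr e, ex_mul_left]
    change _ ≤ _ * pr _ _
    rw [← hS.q_eq, Real.negMulLog, Real.negMulLog, Real.log_div hp.ne' hq.ne']
    field_simp
    linarith
  · have hph := hS.phat_pos
    have e : ∀ x, Real.negMulLog (S.pn X θ phat u c x) =
        Real.negMulLog phat * ind (eta x u c = true) := by
      intro x
      rw [pn_of_not_gcase hg]
      by_cases h : eta x u c = true
      · rw [ind_of_true h, mul_one, mul_one]
      · rw [ind_of_false h, mul_zero, mul_zero, Real.negMulLog_zero]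
    rw [ex_congr e, ex_mul_left, hS.ex_eta_apply, Real.negMulLog, Real.negMulLog]
    have hle : phat ≤ S.p u c / S.q X θ u c := by
      by_contra! hlt
      have hB : c ∈ S.B u := by
        by_contra hB
        exact hg ⟨hlt, hB⟩
      rw [hS.mem_B] at hB
      rw [hB] at hlt
      exact absurd hlt (not_lt.2 (le_div_self hph.le hq (hS.q_le_one u c)))
    have h3 := Real.log_le_log hph hle
    rw [Real.log_div hp.ne' hq.ne'] at h3
    have h4 : -phat * Real.log phat * (S.p u c / phat) = -(S.p u c * Real.log phat) := by
      field_simp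
    rw [h4]
    nlinarith [mul_le_mul_of_nonneg_left h3 hp.le]

/-- Since p̂ ≤ 1/e, the function -y log y increases on [0, p̂], which bounds the contribution of one
colour. The tangent bound -y log y ≤ y log C + 1/C, summed over the list, bounds the mean. -/
theorem pr_entropy_le (u : V) {C : ℕ} (hC : (list u).card = C) (hC0 : 0 < C) {t M : ℝ}
    (ht : 0 < t) (hM : 0 ≤ M) (hw : ∑ c, S.p u c ≤ 2) (hph : phat ≤ Real.exp (-1))
    (h1 : 2 * M * Real.negMulLog phat ≤ t)
    (h2 : 4 * M * (Real.negMulLog phat * (2 * Real.log C + 1)) ≤ t ^ 2) :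
    pr (S.law θ phat) (fun x => ∑ c, Real.negMulLog (S.pn X θ phat u c x) ≤
      ∑ c, Real.negMulLog (S.p u c) - 2 * ∑ c, S.p u c * S.ell X θ u c - t) ≤
      Real.exp (-M) := by
  have hC' : (0 : ℝ) < C := by exact_mod_cast hC0
  have he1 : Real.exp (-1) ≤ 1 := Real.exp_le_one_iff.2 (by norm_num)
  have hmono : ∀ y, 0 ≤ y → y ≤ phat → Real.negMulLog y ≤ Real.negMulLog phat := by
    intro y hy hyp
    rcases hy.eq_or_lt with rfl | hy
    · rw [Real.negMulLog_zero]
      exact Real.negMulLog_nonneg hS.phat_pos.le (hph.trans he1)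
    · have := hS.phat_pos
      have hlog : Real.log phat ≤ -1 := by
        have := Real.log_le_log hS.phat_pos hph
        rwa [Real.log_exp] at this
      have h3 := Real.log_le_sub_one_of_pos (div_pos hS.phat_pos hy)
      rw [Real.log_div hS.phat_pos.ne' hy.ne'] at h3
      have h4 := mul_le_mul_of_nonneg_left h3 hy.le
      have h5 : y * (phat / y - 1) = phat - y := by field_simp
      rw [h5] at h4
      rw [Real.negMulLog, Real.negMulLog]
      nlinarith
  have hle : ∀ y, 0 ≤ y → Real.negMulLog y ≤ y * Real.log C + 1 / C := by
    intro y hy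
    rcases hy.eq_or_lt with rfl | hy
    · simp
    · have h3 := Real.log_le_sub_one_of_pos (inv_pos.2 (mul_pos hC' hy))
      rw [Real.log_inv, Real.log_mul hC'.ne' hy.ne'] at h3
      have h4 := mul_le_mul_of_nonneg_left h3 hy.le
      have h5 : y * ((C * y)⁻¹ - 1) = 1 / C - y := by field_simp
      rw [h5] at h4
      rw [Real.negMulLog]
      nlinarith
  have hlogC : 0 ≤ Real.log C := Real.log_natCast_nonneg C
  have h := pr_sum_tail_le hS.isLaw col (fun c x => Real.negMulLog (S.pn X θ phat u c x))
    (fun c x y hxy => congrArg Real.negMulLog (hS.pn_dependsOn_col u c hxy)) ht hM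
    (Real.negMulLog_nonneg hS.phat_pos.le (hph.trans he1))
    (fun c x => Real.negMulLog_nonneg (hS.pn_nonneg u c x)
      ((hS.pn_le u c x).trans (hph.trans he1)))
    (fun c x => hmono _ (hS.pn_nonneg u c x) (hS.pn_le u c x)) (μ := 2 * Real.log C + 1) ?_ h1 h2
  · refine (pr_mono hS.isLaw fun x (hx : _ ≤ _) => ?_).trans h.2
    refine hx.trans (sub_le_sub_right ?_ _)
    rw [Finset.mul_sum, ← Finset.sum_sub_distrib]
    exact Finset.sum_le_sum fun c _ => hS.negMulLog_le_ex u c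
  · have h3 : ∀ c, ex (S.law θ phat) (fun x => Real.negMulLog (S.pn X θ phat u c x)) ≤
        S.p u c * Real.log C + if c ∈ list u then 1 / (C : ℝ) else 0 := by
      intro c
      split_ifs with hc
      · refine (ex_mono hS.isLaw fun x => hle _ (hS.pn_nonneg u c x)).trans_eq ?_
        rw [ex_add, ex_mul_right, ex_const hS.isLaw, hS.ex_pn (hS.q_pos u c)]
      · have h0 := hS.p_supp u c hc
        rw [ex_congr (G := fun _ => 0) fun x => by rw [hS.pn_eq_zero h0 x, Real.negMulLog_zero],
          ex_const hS.isLaw, h0]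
        simp
    refine (Finset.sum_le_sum fun c _ => h3 c).trans ?_
    rw [Finset.sum_add_distrib, ← Finset.sum_mul, Finset.sum_ite_mem, Finset.univ_inter,
      Finset.sum_const, hC, nsmul_eq_mul]
    have : (C : ℝ) * (1 / C) = 1 := by field_simp
    nlinarith

theorem hits_eq (u : V) (c : K) (x : Bits V K) : S.hits X u c x =
    ∑ w, (((S.triplesAt X u).filter fun e => w ∈ e.erase u).card : ℝ) * ind (gam x w c = true) := by
  have h : ∀ e : Finset V, ∑ w ∈ e.erase u, ind (gam x w c = true) =
      ∑ w, if w ∈ e.erase u then ind (gam x w c = true) else 0 := by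
    intro e
    rw [Finset.sum_ite_mem, Finset.univ_inter]
  simp only [hits, h]
  rw [Finset.sum_comm]
  refine Finset.sum_congr rfl fun w _ => ?_
  rw [← Finset.sum_filter, Finset.sum_const, nsmul_eq_mul]

/-- Here the colour is fixed and the independent blocks are the vertices: the choice at w counts
with the number of triples containing u and w, which the codegree bounds. -/
theorem pr_hits_le (u : V) (c : K) {D δ t M : ℝ} (ht : 0 < t) (hM : 0 ≤ M) (hδ : 0 ≤ δ)
    (hD : ((S.triplesAt X u).card : ℝ) ≤ D)
    (hcod : ∀ w, w ≠ u → (((S.triplesAt X u).filter fun e => w ∈ e).card : ℝ) ≤ δ)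
    (h1 : 2 * M * δ ≤ t) (h2 : 4 * M * (δ * (2 * D * θ * phat)) ≤ t ^ 2) :
    pr (S.law θ phat) (fun x => 2 * D * θ * phat + t ≤ S.hits X u c x) ≤ Real.exp (-M) := by
  simp only [hS.hits_eq]
  refine (pr_sum_tail_le hS.isLaw vert (fun w x =>
    (((S.triplesAt X u).filter fun e => w ∈ e.erase u).card : ℝ) * ind (gam x w c = true))
    ?_ ht hM hδ ?_ ?_ ?_ h1 h2).1
  · intro w x y h
    simp only [gam, h (Sum.inl (w, c)) rfl]
  · exact fun w x => mul_nonneg (Nat.cast_nonneg _) (ind_nonneg _)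
  · intro w x
    refine (mul_le_of_le_one_right (Nat.cast_nonneg _) (ind_le_one _)).trans ?_
    by_cases hw : w = u
    · subst hw
      simpa using hδ
    · simpa [Finset.mem_erase, hw] using hcod w hw
  · have hθ := hS.θ_pos
    have hph := hS.phat_pos
    rw [← ex_sum, ← ex_congr fun x => hS.hits_eq u c x]
    unfold hits
    rw [ex_sum]
    have h3 : ∀ e ∈ S.triplesAt X u, ex (S.law θ phat)
        (fun x => ∑ w ∈ e.erase u, ind (gam x w c = true)) ≤ 2 * (θ * phat) := by
      intro e he
      rw [mem_triplesAt] at he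
      rw [ex_sum]
      refine (Finset.sum_le_card_nsmul _ _ (θ * phat) fun w _ => ?_).trans_eq ?_
      · rw [hS.ex_gam_apply]
        exact mul_le_mul_of_nonneg_left (hS.p_le w c) hθ.le
      · rw [Finset.card_erase_of_mem he.2, X.card_eq_three e he.1.1, nsmul_eq_mul]
        norm_num
    refine (Finset.sum_le_card_nsmul _ _ _ h3).trans ?_
    rw [nsmul_eq_mul]
    nlinarith [mul_pos hθ hph]

/-- Only two vertices remain in the triple besides u, so v determines w and each of them occurs once
as w. -/
theorem sum_erase_erase {e : Finset V} {u : V} (he : e ∈ S.triplesAt X u) (f : V → ℝ) :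
    ∑ v ∈ e.erase u, ∑ w ∈ (e.erase u).erase v, f w = ∑ w ∈ e.erase u, f w := by
  rw [mem_triplesAt] at he
  have h2 : (e.erase u).card = 2 := by
    rw [Finset.card_erase_of_mem he.2, X.card_eq_three e he.1.1]
  obtain ⟨a, b, hab, h⟩ := Finset.card_eq_two.1 h2
  rw [h, Finset.sum_pair hab, Finset.sum_pair hab]
  have e1 : ({a, b} : Finset V).erase a = {b} := by
    ext z; simp only [Finset.mem_erase, Finset.mem_insert, Finset.mem_singleton]; grind
  have e2 : ({a, b} : Finset V).erase b = {a} := by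
    ext z; simp only [Finset.mem_erase, Finset.mem_insert, Finset.mem_singleton]; grind
  rw [e1, e2, Finset.sum_singleton, Finset.sum_singleton, add_comm]

theorem newMass_nonneg (u : V) (c : K) (x : Bits V K) : 0 ≤ S.newMass X θ phat u c x :=
  Finset.sum_nonneg fun _ _ => Finset.sum_nonneg fun _ _ => Finset.sum_nonneg fun _ _ =>
    mul_nonneg (ind_nonneg _) (mul_nonneg (hS.pn_nonneg _ _ _) (hS.pn_nonneg _ _ _))

theorem newMass_le (u : V) (c : K) (x : Bits V K) :
    S.newMass X θ phat u c x ≤ phat ^ 2 * S.hits X u c x := by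
  rw [newMass, hits, Finset.mul_sum]
  refine Finset.sum_le_sum fun e he => ?_
  rw [← hS.sum_erase_erase he fun w => ind (gam x w c = true), Finset.mul_sum]
  refine Finset.sum_le_sum fun v _ => ?_
  rw [Finset.mul_sum]
  refine Finset.sum_le_sum fun w _ => ?_
  rw [mul_comm, sq]
  refine mul_le_mul_of_nonneg_right ?_ (ind_nonneg _)
  exact mul_le_mul (hS.pn_le _ _ _) (hS.pn_le _ _ _) (hS.pn_nonneg _ _ _) hS.phat_pos.le

theorem newMass_dependsOn (u : V) (c : K) :
    DependsOn (S.newMass X θ phat u c) {i | col i = c} := by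
  refine dependsOn_sum fun e _ => dependsOn_sum fun v _ => dependsOn_sum fun w _ x y h => ?_
  simp only [gam, h (Sum.inl (w, c)) rfl, hS.pn_dependsOn_col u c h, hS.pn_dependsOn_col v c h]

theorem hits_dependsOn (u : V) (c : K) : DependsOn (S.hits X u c) {i | col i = c} := by
  refine dependsOn_sum fun e _ => dependsOn_sum fun w _ x y h => ?_
  simp only [gam, h (Sum.inl (w, c)) rfl]

/-- The choice of c at the third vertex w is an increasing event of probability θp_w(c), so
`ex_mul_prod_pn_le` for the pair {u, v} yields θ times the full product over the triple. Each triple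
has two orderings of v and w. -/
theorem ex_newMass_le (hN : S.NearIndependent X θ ω₀) (hω : 0 < ω₀) (u : V) {D E : ℝ}
    (hD : ((S.triplesAt X u).card : ℝ) ≤ D) (hE0 : 0 ≤ E)
    (hE : ∀ e ∈ S.triplesAt X u, ∑ c, ∏ u ∈ e, S.p u c ≤ E) :
    ∑ c, ex (S.law θ phat) (S.newMass X θ phat u c) ≤ 2 * θ * D * (E * (1 + 1 / ω₀)) := by
  have hκ : 0 ≤ 1 + 1 / ω₀ := by positivity
  have hθ := hS.θ_pos
  have h1 : ∀ c, ex (S.law θ phat) (S.newMass X θ phat u c) ≤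
      ∑ e ∈ S.triplesAt X u, 2 * θ * ((∏ u ∈ e, S.p u c) * (1 + 1 / ω₀)) := by
    intro c
    unfold newMass
    rw [ex_sum]
    refine Finset.sum_le_sum fun e he => ?_
    have he' := mem_triplesAt.1 he
    have h2 : ∀ v ∈ e.erase u, ∀ w ∈ (e.erase u).erase v, ex (S.law θ phat) (fun x =>
        ind (gam x w c = true) * (S.pn X θ phat u c x * S.pn X θ phat v c x)) ≤
        θ * ((∏ u ∈ e, S.p u c) * (1 + 1 / ω₀)) := by
      intro v hv w hw
      have hvu := Finset.ne_of_mem_erase hv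
      have hwv := Finset.ne_of_mem_erase hw
      have hw' := Finset.mem_of_mem_erase hw
      have hwu := Finset.ne_of_mem_erase hw'
      have hsub : ({u, v} : Finset V) ⊆ e := by
        intro z hz
        simp only [Finset.mem_insert, Finset.mem_singleton] at hz
        rcases hz with rfl | rfl
        · exact he'.2
        · exact Finset.mem_of_mem_erase hv
      have h3 := hS.ex_mul_prod_pn_le {u, v} c (fun A hA hB =>
        hS.nearIndep_triple hN hω he'.1 c (hA.trans hsub) hB) (fun x => ind (gam x w c = true))
        (fun _ => ind_nonneg _) (fun x y hxy => ind_mono (gam_mono hxy w c))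
        (fun x y h => by simp only [gam, h (Sum.inl (w, c)) ⟨_, rfl⟩])
      simp only [Finset.prod_pair hvu.symm] at h3
      refine h3.trans_eq ?_
      have h4 : ∏ u ∈ e, S.p u c = S.p u c * (S.p v c * S.p w c) := by
        rw [← Finset.mul_prod_erase _ _ he'.2, ← Finset.mul_prod_erase _ _ hv,
          ← Finset.mul_prod_erase _ _ hw]
        have : ((e.erase u).erase v).erase w = ∅ := by
          rw [← Finset.card_eq_zero, Finset.card_erase_of_mem hw, Finset.card_erase_of_mem hv,
            Finset.card_erase_of_mem he'.2, X.card_eq_three e he'.1.1]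
        rw [this, Finset.prod_empty, mul_one]
      rw [h4, hS.ex_gam_apply]
      ring
    rw [ex_sum]
    simp only [ex_sum]
    refine (Finset.sum_le_sum fun v hv => Finset.sum_le_sum fun w hw => h2 v hv w hw).trans_eq ?_
    rw [hS.sum_erase_erase he fun _ => θ * ((∏ u ∈ e, S.p u c) * (1 + 1 / ω₀)), Finset.sum_const,
      Finset.card_erase_of_mem he'.2, X.card_eq_three e he'.1.1, nsmul_eq_mul]
    push_cast
    ring
  refine (Finset.sum_le_sum fun c _ => h1 c).trans ?_
  rw [Finset.sum_comm]
  refine (Finset.sum_le_card_nsmul _ _ (2 * θ * (E * (1 + 1 / ω₀))) fun e he => ?_).trans ?_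
  · rw [← Finset.mul_sum, ← Finset.sum_mul]
    have := hE e he
    gcongr
  · rw [nsmul_eq_mul]
    have : 0 ≤ 2 * θ * (E * (1 + 1 / ω₀)) := by positivity
    nlinarith

/-- The truncation at b hits caps the contribution of one colour at p̂²b. In a good round no colour
exceeds this number of hits, so the truncation disappears again. -/
theorem pr_newMass_le (hN : S.NearIndependent X θ ω₀) (hω : 0 < ω₀) (u : V) {D E b t M : ℝ}
    (ht : 0 < t) (hM : 0 ≤ M) (hb : 0 ≤ b)
    (hD : ((S.triplesAt X u).card : ℝ) ≤ D) (hE0 : 0 ≤ E)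
    (hE : ∀ e ∈ S.triplesAt X u, ∑ c, ∏ u ∈ e, S.p u c ≤ E)
    (h1 : 2 * M * (phat ^ 2 * b) ≤ t)
    (h2 : 4 * M * (phat ^ 2 * b * (2 * θ * D * (E * (1 + 1 / ω₀)))) ≤ t ^ 2) :
    pr (S.law θ phat) (fun x => 2 * θ * D * (E * (1 + 1 / ω₀)) + t ≤
      ∑ c, S.newMass X θ phat u c x * ind (S.hits X u c x ≤ b)) ≤ Real.exp (-M) := by
  have hph := hS.phat_pos
  refine (pr_sum_tail_le hS.isLaw col
    (fun c x => S.newMass X θ phat u c x * ind (S.hits X u c x ≤ b)) ?_ ht hM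
    (by positivity : 0 ≤ phat ^ 2 * b) ?_ ?_ ?_ h1 h2).1
  · intro c x y h
    simp only [hS.newMass_dependsOn u c h, hS.hits_dependsOn u c h]
  · exact fun c x => mul_nonneg (hS.newMass_nonneg u c x) (ind_nonneg _)
  · intro c x
    by_cases h : S.hits X u c x ≤ b
    · rw [ind_of_true h, mul_one]
      exact (hS.newMass_le u c x).trans (mul_le_mul_of_nonneg_left h (by positivity))
    · rw [ind_of_false h, mul_zero]
      positivity
  · refine (Finset.sum_le_sum fun c _ => ex_mono hS.isLaw fun x => ?_).trans
      (hS.ex_newMass_le hN hω u hD hE0 hE)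
    exact mul_le_of_le_one_right (hS.newMass_nonneg u c x) (ind_le_one _)

theorem pr_edgeMass_le (hN : S.NearIndependent X θ ω₀) (hω : 0 < ω₀) (u : V) {f b t M : ℝ}
    (ht : 0 < t) (hM : 0 ≤ M) (hb : 0 ≤ b) (hdeg : ∀ c ∈ list u, ((S.nbrs c u).card : ℝ) ≤ b)
    (hf : ∑ c, ∑ v ∈ S.nbrs c u, S.p u c * S.p v c ≤ f)
    (h1 : 2 * M * (phat ^ 2 * b) ≤ t)
    (h2 : 4 * M * (phat ^ 2 * b * (f * (1 + 1 / ω₀))) ≤ t ^ 2) :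
    pr (S.law θ phat) (fun x => f * (1 + 1 / ω₀) + t ≤
      ∑ c, ∑ v ∈ S.nbrs c u, S.pn X θ phat u c x * S.pn X θ phat v c x) ≤ Real.exp (-M) := by
  have hph := hS.phat_pos
  have hκ : 0 ≤ 1 + 1 / ω₀ := by positivity
  refine (pr_sum_tail_le hS.isLaw col
    (fun c x => ∑ v ∈ S.nbrs c u, S.pn X θ phat u c x * S.pn X θ phat v c x) ?_ ht hM
    (by positivity : 0 ≤ phat ^ 2 * b) ?_ ?_ ?_ h1 h2).1
  · intro c x y h
    refine Finset.sum_congr rfl fun v _ => ?_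
    simp only [hS.pn_dependsOn_col u c h, hS.pn_dependsOn_col v c h]
  · exact fun c x => Finset.sum_nonneg fun v _ => mul_nonneg (hS.pn_nonneg u c x)
      (hS.pn_nonneg v c x)
  · intro c x
    by_cases hc : c ∈ list u
    · refine (Finset.sum_le_card_nsmul _ _ (phat ^ 2) fun v _ => ?_).trans ?_
      · rw [sq]
        exact mul_le_mul (hS.pn_le _ _ _) (hS.pn_le _ _ _) (hS.pn_nonneg _ _ _) hS.phat_pos.le
      · rw [nsmul_eq_mul, mul_comm]
        exact mul_le_mul_of_nonneg_left (hdeg c hc) (by positivity)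
    · refine le_of_eq_of_le (Finset.sum_eq_zero fun v _ => ?_) (by positivity)
      rw [hS.pn_eq_zero (hS.p_supp u c hc), zero_mul]
  · refine (Finset.sum_le_sum fun c _ => ?_).trans
      ((Finset.sum_mul _ _ _).symm.le.trans (mul_le_mul_of_nonneg_right hf hκ))
    rw [ex_sum, Finset.sum_mul]
    refine Finset.sum_le_sum fun v hv => ?_
    have huv := mem_nbrs.1 hv
    have h3 := hS.ex_prod_pn_le {u, v} c fun A hA hB => hS.nearIndep_edge hN hω huv hA hB
    simp only [Finset.prod_pair huv.ne] at h3
    exact h3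

end Basic

end State

end SemiRandom

/-! ### Edges and triples that remain uncoloured -/

namespace SemiRandom

open FinProb

variable {V K : Type*} [Fintype V] [Fintype K]

namespace State

/-- No colour is a candidate at `v`. -/
def Idle (S : State V K) (X : RankThree V) (v : V) (x : Bits V K) : Prop :=
  ∀ d, d ∉ S.candidates X (gam x) v

/-- The weight of the edges at `u` whose other end remains uncoloured. -/
def keptMass (S : State V K) (X : RankThree V) (θ phat : ℝ) (u : V) (x : Bits V K) : ℝ :=
  ∑ c, ∑ v ∈ S.nbrs c u, S.pn X θ phat u c x * S.pn X θ phat v c x * ind (S.Idle X v x)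

/-- The vertices joined to `u` in some colour. -/
def allNbrs (S : State V K) (u : V) : Finset V :=
  Finset.univ.filter fun v => ∃ c, (S.graph c).Adj u v

/-- The part of the weight of the edges `uv` that comes from the colours with `κ c = j`. -/
def partMass (S : State V K) (X : RankThree V) (θ phat : ℝ) {J : ℕ} (κ : K → Fin J) (u : V)
    (j : Fin J) (v : V) (x : Bits V K) : ℝ :=
  ∑ c, ind (κ c = j) * (ind ((S.graph c).Adj u v) * (S.pn X θ phat u c x * S.pn X θ phat v c x))

/-- The number of triples at `u` that remain uncoloured. -/
def keptTriples (S : State V K) (X : RankThree V) (u : V) (x : Bits V K) : ℝ :=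
  ∑ e ∈ S.triplesAt X u, ind (∀ v ∈ e, S.Idle X v x)

/-- The bounds on the weights at a vertex that make it receive a colour often enough. -/
structure Lively (S : State V K) (X : RankThree V) (θ : ℝ) (v : V) : Prop where
  mass : ∑ d, S.p v d ≤ 3 / 2
  surviving : 63 / 100 ≤ ∑ d, S.p v d * S.q X θ v d * ind (d ∉ S.B v)

variable {S : State V K} {X : RankThree V} {list : V → Finset K} {θ phat ω₀ : ℝ}

namespace Basic

variable (hS : S.Basic X list θ phat)
include hS

theorem allNbrs_subset_U {u v : V} (h : v ∈ S.allNbrs u) : v ∈ S.U := by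
  simp only [allNbrs, Finset.mem_filter_univ] at h
  obtain ⟨c, h⟩ := h
  exact hS.adj_U c v u h.symm

theorem partMass_nonneg {J : ℕ} (κ : K → Fin J) (u : V) (j : Fin J) (v : V) (x : Bits V K) :
    0 ≤ S.partMass X θ phat κ u j v x :=
  Finset.sum_nonneg fun c _ => mul_nonneg (ind_nonneg _) (mul_nonneg (ind_nonneg _)
    (mul_nonneg (hS.pn_nonneg u c x) (hS.pn_nonneg v c x)))

theorem partMass_dependsOn {J : ℕ} (κ : K → Fin J) (u : V) (j : Fin J) (v : V) :
    DependsOn (S.partMass X θ phat κ u j v) {i | κ (col i) = j} := by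
  refine dependsOn_sum fun c _ x y h => ?_
  by_cases hc : κ c = j
  · have hi : ∀ i ∈ {i | col i = c}, x i = y i := fun i hi => h i (by
      change κ (col i) = j
      rw [show col i = c from hi, hc])
    simp only [hS.pn_dependsOn_col u c hi, hS.pn_dependsOn_col v c hi]
  · simp only [ind_of_false hc, zero_mul]

theorem partMass_le {J : ℕ} (κ : K → Fin J) (u : V) (j : Fin J) (v : V) (x : Bits V K)
    (h : ∑ c, S.pn X θ phat v c x ≤ 2) : S.partMass X θ phat κ u j v x ≤ 2 * phat := by
  have h1 : S.partMass X θ phat κ u j v x ≤ ∑ c, phat * S.pn X θ phat v c x := by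
    refine Finset.sum_le_sum fun c _ => ?_
    have h0 := mul_nonneg (hS.pn_nonneg u c x) (hS.pn_nonneg v c x)
    refine (mul_le_of_le_one_left (mul_nonneg (ind_nonneg _) h0) (ind_le_one _)).trans ?_
    refine (mul_le_of_le_one_left h0 (ind_le_one _)).trans ?_
    exact mul_le_mul_of_nonneg_right (hS.pn_le u c x) (hS.pn_nonneg v c x)
  refine h1.trans ?_
  rw [← Finset.mul_sum, mul_comm]
  exact mul_le_mul_of_nonneg_right h hS.phat_pos.le

theorem sum_partMass {J : ℕ} (κ : K → Fin J) (u : V) (x : Bits V K) (f : V → ℝ) :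
    ∑ j, ∑ v ∈ S.allNbrs u, S.partMass X θ phat κ u j v x * f v =
      ∑ c, ∑ v ∈ S.nbrs c u, S.pn X θ phat u c x * S.pn X θ phat v c x * f v := by
  have h1 : ∀ v, ∑ j, S.partMass X θ phat κ u j v x =
      ∑ c, ind ((S.graph c).Adj u v) * (S.pn X θ phat u c x * S.pn X θ phat v c x) := by
    intro v
    unfold partMass
    rw [Finset.sum_comm]
    refine Finset.sum_congr rfl fun c _ => ?_
    have h2 : ∑ j, ind (κ c = j) = 1 := by
      rw [Finset.sum_eq_single (κ c) (fun j _ hj => ind_of_false hj.symm) (by simp)]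
      exact ind_of_true rfl
    rw [← Finset.sum_mul, h2, one_mul]
  rw [Finset.sum_comm]
  simp only [← Finset.sum_mul, h1]
  simp only [Finset.sum_mul]
  rw [Finset.sum_comm]
  refine Finset.sum_congr rfl fun c _ => ?_
  have hsub : S.nbrs c u ⊆ S.allNbrs u := by
    intro v hv
    simp only [allNbrs, Finset.mem_filter_univ]
    exact ⟨c, mem_nbrs.1 hv⟩
  rw [← Finset.sum_subset hsub]
  · refine Finset.sum_congr rfl fun v hv => ?_
    rw [ind_of_true (mem_nbrs.1 hv), one_mul]
  · intro v _ hv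
    rw [ind_of_false fun h => hv (mem_nbrs.2 h), zero_mul, zero_mul]

/-- The new weights in the colours of part j are frozen first; they then act as fixed coefficients
a_v for the bits of the other colours. Ignoring the candidates in part j only enlarges the sum and
costs at most 5/100 of the surviving weight 63/100, which leaves the 58/100 that
`pr_weighted_uncolored_le` requires. -/
theorem pr_part_le {J : ℕ} (κ : K → Fin J) (u : V) (j : Fin J) {s t M : ℝ}
    (hlive : ∀ v ∈ S.allNbrs u, S.Lively X θ v)
    (hκ : ∀ v ∈ S.allNbrs u, ∑ c, S.p v c * ind (κ c = j) ≤ 5 / 100)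
    (hθ : θ ≤ 1 / 100) (ht : 0 < t) (hM : 0 ≤ M)
    (h1 : 2 * M * (100 * (2 * phat + θ * phat * s)) ≤ t)
    (h2 : 4 * M * (2 * θ * s * (2 * phat + θ * phat * s)) ≤ t ^ 2) :
    pr (S.law θ phat) (fun x => (∑ v ∈ S.allNbrs u, S.partMass X θ phat κ u j v x ≤ s ∧
        ∀ v, S.partMass X θ phat κ u j v x ≤ 2 * phat) ∧
      (1 - 55 / 100 * θ) * ∑ v ∈ S.allNbrs u, S.partMass X θ phat κ u j v x + t ≤
        ∑ v ∈ S.allNbrs u, S.partMass X θ phat κ u j v x * ind (S.Idle X v x)) ≤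
      Real.exp (-M) := by
  set a : V → Bits V K → ℝ := fun v x => S.partMass X θ phat κ u j v x with ha
  set D : Set K := {d | κ d ≠ j} with hD
  set Φ : Bits V K → Bits V K → ℝ := fun x y => ind ((∑ v ∈ S.allNbrs u, a v x ≤ s ∧
      ∀ v, a v x ≤ 2 * phat) ∧ (1 - 55 / 100 * θ) * ∑ v ∈ S.allNbrs u, a v x + t ≤
        ∑ v ∈ S.allNbrs u, a v x * ind (∀ d ∈ D, d ∉ S.candidates X (gam y) v)) with hΦ
  have hle : ∀ x, ind ((∑ v ∈ S.allNbrs u, a v x ≤ s ∧ ∀ v, a v x ≤ 2 * phat) ∧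
      (1 - 55 / 100 * θ) * ∑ v ∈ S.allNbrs u, a v x + t ≤
        ∑ v ∈ S.allNbrs u, a v x * ind (S.Idle X v x)) ≤ Φ x x := by
    intro x
    refine ind_mono fun h => ⟨h.1, h.2.trans ?_⟩
    refine Finset.sum_le_sum fun v _ => mul_le_mul_of_nonneg_left ?_
      (hS.partMass_nonneg κ u j v x)
    exact ind_mono fun h d _ => h d
  refine (ex_mono hS.isLaw hle).trans ?_
  -- The masses of part j use only the bits with colour in part j, and candidacy for a colour
  -- outside it uses only the remaining bits, so the two groups may be drawn separately.
  rw [ex_diag hS.isLaw (Finset.univ.filter fun i => κ (col i) = j)]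
  · refine (ex_mono hS.isLaw fun x => ?_).trans_eq (ex_const hS.isLaw _)
    by_cases h : ∑ v ∈ S.allNbrs u, a v x ≤ s ∧ ∀ v, a v x ≤ 2 * phat
    · have h3 := hS.pr_weighted_uncolored_le (S.allNbrs u) (fun v => a v x)
        (fun v => hS.partMass_nonneg κ u j v x) h.2 (mul_pos two_pos hS.phat_pos) h.1 D hθ
        (fun v hv => (hlive v hv).mass.trans (by norm_num)) (fun v hv => ?_) ht hM h1 h2
      · refine le_trans (pr_mono hS.isLaw fun y hy => ?_) h3
        exact hy.2
      · have h4 : ∀ d, S.p v d * S.q X θ v d * ind (d ∉ S.B v) - S.p v d * ind (κ d = j) ≤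
            ind (d ∈ D) * (S.p v d * S.q X θ v d * ind (d ∉ S.B v)) := by
          intro d
          have hp := hS.p_nonneg v d
          have hq := mul_nonneg (mul_nonneg hp (hS.q_nonneg v d)) (ind_nonneg (d ∉ S.B v))
          have hq1 : S.p v d * S.q X θ v d * ind (d ∉ S.B v) ≤ S.p v d :=
            (mul_le_of_le_one_right (mul_nonneg hp (hS.q_nonneg v d)) (ind_le_one _)).trans
              (mul_le_of_le_one_right hp (hS.q_le_one v d))
          by_cases hd : κ d = j
          · rw [ind_of_true hd, ind_of_false (fun h => h hd : ¬ d ∈ D)]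
            linarith
          · rw [ind_of_false hd, ind_of_true (show d ∈ D from hd)]
            linarith
        refine le_trans ?_ (Finset.sum_le_sum fun d _ => h4 d)
        rw [Finset.sum_sub_distrib]
        linarith [(hlive v hv).surviving, hκ v hv]
    · rw [ex_congr (G := fun _ => 0) fun y => ind_of_false fun h' => h h'.1, ex_const hS.isLaw]
      exact (Real.exp_pos _).le
  · intro y x x' h
    have e : ∀ v, a v x = a v x' := fun v => hS.partMass_dependsOn κ u j v fun i hi =>
      h i (by simpa using hi)
    simp only [hΦ, e]
  · intro x y y' h
    have e : ∀ v, (∀ d ∈ D, d ∉ S.candidates X (gam y) v) =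
        ∀ d ∈ D, d ∉ S.candidates X (gam y') v := by
      intro v
      refine propext (forall₂_congr fun d hd => not_congr (iff_of_eq ?_))
      refine hS.cand_dependsOn v d fun i hi => h i ?_
      simp only [Finset.coe_filter, Finset.mem_univ, true_and]
      change κ (col i) ≠ j
      rw [hi.1]
      exact hd
    simp only [hΦ, e]

/-- Three failures are excluded: a large total edge mass, a neighbour whose weight moves by t, and a
part that deviates by t/J. The second makes the mass at each neighbour within a part at most 2p̂, as
the part estimate needs; then the J parts add up. -/
theorem pr_keptMass_le (hN : S.NearIndependent X θ ω₀) (hω : 0 < ω₀) (u : V) {f b t M : ℝ}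
    {J : ℕ} (hJ : 0 < J) (κ : K → Fin J)
    (hlive : ∀ v ∈ S.allNbrs u, S.Lively X θ v)
    (hκ : ∀ v ∈ S.allNbrs u, ∀ j, ∑ c, S.p v c * ind (κ c = j) ≤ 5 / 100)
    (hθ : θ ≤ 1 / 100) (ht : 0 < t) (ht1 : t ≤ 1 / 2) (hM : 0 ≤ M) (hb : 0 ≤ b)
    (hdeg : ∀ c ∈ list u, ((S.nbrs c u).card : ℝ) ≤ b)
    (hf : ∑ c, ∑ v ∈ S.nbrs c u, S.p u c * S.p v c ≤ f)
    (h1 : 2 * M * (phat ^ 2 * b) ≤ t)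
    (h2 : 4 * M * (phat ^ 2 * b * (f * (1 + 1 / ω₀))) ≤ t ^ 2)
    (h3 : 2 * M * (100 * (2 * phat + θ * phat * (f * (1 + 1 / ω₀) + t))) ≤ t / J)
    (h4 : 4 * M * (2 * θ * (f * (1 + 1 / ω₀) + t) *
      (2 * phat + θ * phat * (f * (1 + 1 / ω₀) + t))) ≤ (t / J) ^ 2)
    (h5 : 2 * M * phat ≤ t) (h6 : 4 * M * (phat * 2) ≤ t ^ 2) :
    pr (S.law θ phat) (fun x =>
      (1 - 55 / 100 * θ) * (f * (1 + 1 / ω₀) + t) + t ≤ S.keptMass X θ phat u x) ≤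
      (1 + 2 * (S.allNbrs u).card + J) * Real.exp (-M) := by
  set s := f * (1 + 1 / ω₀) + t with hs
  have hJ' : (0 : ℝ) < J := by exact_mod_cast hJ
  have hA := hS.pr_edgeMass_le hN hω u ht hM hb hdeg hf h1 h2
  have hB : pr (S.law θ phat) (fun x => ∃ v ∈ S.allNbrs u,
      t ≤ |∑ c, S.pn X θ phat v c x - ∑ c, S.p v c|) ≤
      2 * (S.allNbrs u).card * Real.exp (-M) := by
    refine (pr_exists hS.isLaw _ _).trans ((Finset.sum_le_card_nsmul _ _ (2 * Real.exp (-M))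
      fun v hv => ?_).trans_eq ?_)
    · exact hS.pr_mass_le v ht hM ((hlive v hv).mass.trans (by norm_num)) h5 h6
    · rw [nsmul_eq_mul]; ring
  have hC := pr_exists hS.isLaw Finset.univ fun (j : Fin J) (x : Bits V K) =>
      (∑ v ∈ S.allNbrs u, S.partMass X θ phat κ u j v x ≤ s ∧
        ∀ v, S.partMass X θ phat κ u j v x ≤ 2 * phat) ∧
      (1 - 55 / 100 * θ) * ∑ v ∈ S.allNbrs u, S.partMass X θ phat κ u j v x + t / J ≤
        ∑ v ∈ S.allNbrs u, S.partMass X θ phat κ u j v x * ind (S.Idle X v x)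
  have hC' := hC.trans (Finset.sum_le_card_nsmul _ _ (Real.exp (-M)) fun j _ =>
    hS.pr_part_le κ u j hlive (fun v hv => hκ v hv j) hθ (div_pos ht hJ') hM h3 h4)
  rw [Finset.card_univ, Fintype.card_fin, nsmul_eq_mul] at hC'
  refine (pr_mono hS.isLaw fun x hx => ?_).trans ((pr_or hS.isLaw).trans
    ((add_le_add hA ((pr_or hS.isLaw).trans (add_le_add hB hC'))).trans_eq (by ring)))
  by_contra hcon
  rw [not_or, not_or] at hcon
  obtain ⟨c1, c2, c3⟩ := hcon
  have e1 := hS.sum_partMass κ u x (fun _ => 1)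
  simp only [mul_one] at e1
  have e2 := hS.sum_partMass κ u x (fun v => ind (S.Idle X v x))
  rw [not_le] at c1
  push Not at c2 c3
  have hpart : ∀ j, ∑ v ∈ S.allNbrs u, S.partMass X θ phat κ u j v x * ind (S.Idle X v x) <
      (1 - 55 / 100 * θ) * ∑ v ∈ S.allNbrs u, S.partMass X θ phat κ u j v x + t / J := by
    intro j
    refine c3 j (Finset.mem_univ j) ⟨?_, fun v => ?_⟩
    · refine le_trans ?_ c1.le
      rw [← e1]
      exact Finset.single_le_sum (f := fun j => ∑ v ∈ S.allNbrs u, S.partMass X θ phat κ u j v x)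
        (fun j _ => Finset.sum_nonneg fun v _ => hS.partMass_nonneg κ u j v x)
        (Finset.mem_univ j)
    · by_cases hv : v ∈ S.allNbrs u
      · refine hS.partMass_le κ u j v x ?_
        have h7 := (abs_lt.1 (c2 v hv)).2
        linarith [(hlive v hv).mass]
      · refine le_of_eq_of_le (Finset.sum_eq_zero fun c _ => ?_)
          (mul_nonneg zero_le_two hS.phat_pos.le)
        have hn : ¬ (S.graph c).Adj u v := fun h => hv (by
          simp only [allNbrs, Finset.mem_filter_univ]
          exact ⟨c, h⟩)
        rw [ind_of_false hn, zero_mul, mul_zero]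
  have : Nonempty (Fin J) := ⟨⟨0, hJ⟩⟩
  have hlt := Finset.sum_lt_sum_of_nonempty Finset.univ_nonempty fun j (_ : j ∈ Finset.univ) =>
    hpart j
  rw [e2, Finset.sum_add_distrib, ← Finset.mul_sum, e1, Finset.sum_const, Finset.card_univ,
    Fintype.card_fin, nsmul_eq_mul, mul_div_cancel₀ _ hJ'.ne'] at hlt
  have h8 : 0 ≤ 1 - 55 / 100 * θ := by linarith
  have h9 := mul_le_mul_of_nonneg_left c1.le h8
  have hx' : (1 - 55 / 100 * θ) * s + t ≤ ∑ c, ∑ v ∈ S.nbrs c u,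
    S.pn X θ phat u c x * S.pn X θ phat v c x * ind (S.Idle X v x) := hx
  linarith

/-- Every triple is charged to one chosen vertex r(e) other than u and survives only if r(e) stays
uncoloured. The weight of a vertex is the number of triples charged to it, at most the codegree;
these weights are deterministic, so no splitting of the colours is needed. -/
theorem pr_keptTriples_le (u : V) {D δ t M : ℝ}
    (hlive : ∀ v ∈ S.U, S.Lively X θ v) (hθ : θ ≤ 1 / 100) (hδ : 0 < δ)
    (hD : ((S.triplesAt X u).card : ℝ) ≤ D)
    (hcod : ∀ w, w ≠ u → (((S.triplesAt X u).filter fun e => w ∈ e).card : ℝ) ≤ δ)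
    (ht : 0 < t) (hM : 0 ≤ M) (h1 : 2 * M * (100 * (δ + θ * phat * D)) ≤ t)
    (h2 : 4 * M * (2 * θ * D * (δ + θ * phat * D)) ≤ t ^ 2) :
    pr (S.law θ phat) (fun x => (1 - 55 / 100 * θ) * (S.triplesAt X u).card + t ≤
      S.keptTriples X u x) ≤ Real.exp (-M) := by
  have hex : ∀ e : Finset V, ∃ v, e ∈ S.triplesAt X u → v ∈ e.erase u := by
    intro e
    by_cases he : e ∈ S.triplesAt X u
    · have : (e.erase u).Nonempty := by
        rw [mem_triplesAt] at he
        rw [← Finset.card_pos, Finset.card_erase_of_mem he.2, X.card_eq_three e he.1.1]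
        norm_num
      obtain ⟨v, hv⟩ := this
      exact ⟨v, fun _ => hv⟩
    · exact ⟨u, fun h => absurd h he⟩
  choose r hr using hex
  set a : V → ℝ := fun v => (((S.triplesAt X u).filter fun e => r e = v).card : ℝ) with ha
  have hsum : ∀ f : V → ℝ, ∑ e ∈ S.triplesAt X u, f (r e) =
      ∑ v ∈ (S.triplesAt X u).image r, a v * f v := by
    intro f
    rw [Finset.sum_comp f r]
    simp only [nsmul_eq_mul, ha]
  have hcard : ∑ v ∈ (S.triplesAt X u).image r, a v = (S.triplesAt X u).card := by
    have := hsum fun _ => 1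
    simpa using this.symm
  have hU : ∀ v ∈ (S.triplesAt X u).image r, v ∈ S.U := by
    intro v hv
    obtain ⟨e, he, rfl⟩ := Finset.mem_image.1 hv
    exact (mem_triplesAt.1 he).1.2 _ (Finset.mem_of_mem_erase (hr e he))
  have h := hS.pr_weighted_uncolored_le ((S.triplesAt X u).image r) a
    (fun v => Nat.cast_nonneg _) (α := δ) (s := D) (fun v => ?_) hδ (hcard.trans_le hD) Set.univ hθ
    (fun v hv => (hlive v (hU v hv)).mass.trans (by norm_num)) (fun v hv => ?_) ht hM h1 h2
  · refine (pr_mono hS.isLaw fun x (hx : _ ≤ _) => ?_).trans h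
    rw [hcard]
    refine hx.trans ?_
    rw [← hsum fun v => ind (∀ d ∈ Set.univ, d ∉ S.candidates X (gam x) v)]
    refine Finset.sum_le_sum fun e he => ind_mono fun h d _ => ?_
    exact h (r e) (Finset.mem_of_mem_erase (hr e he)) d
  · by_cases hv : v = u
    · have : (S.triplesAt X u).filter (fun e => r e = v) = ∅ := by
        rw [Finset.filter_eq_empty_iff]
        intro e he h
        have := Finset.ne_of_mem_erase (hr e he)
        exact this (h.trans hv)
      simp only [ha, this, Finset.card_empty, Nat.cast_zero]
      exact hδ.le
    · refine le_trans ?_ (hcod v hv)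
      refine Nat.cast_le.2 (Finset.card_le_card fun e he => ?_)
      rw [Finset.mem_filter] at he ⊢
      exact ⟨he.1, he.2 ▸ Finset.mem_of_mem_erase (hr e he.1)⟩
  · refine (le_trans (by norm_num) (hlive v (hU v hv)).surviving).trans_eq ?_
    refine Finset.sum_congr rfl fun d _ => ?_
    rw [ind_of_true (Set.mem_univ d), one_mul]

end Basic

end State

end SemiRandom

/-! ### Numerical facts, the invariant and its first consequences -/

namespace SemiRandom

open FinProb

namespace Params

/-- The logarithm of the maximum degree. -/
def L (P : Params) : ℝ := Real.log P.Δ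

/-- The bound for the growth of the degrees in the colour graphs in a round, up to a factor 2. -/
def grow (P : Params) : ℝ := P.ω₆ * P.θ * P.Δ * P.phat

/-- The admissible deviation of the weight of a triple. -/
def te (P : Params) : ℝ := P.ω / (2000 * P.T * P.Δ)

/-- The numerical facts about the parameters on which the analysis of the algorithm rests. -/
structure Num (P : Params) : Prop where
  L_ge : 10 ^ 6 ≤ P.L
  Δ_ge : 10 ^ 6 ≤ P.Δ
  θ_pos : 0 < P.θ
  θ_le : P.θ ≤ 1 / 1000
  ω_ge : 1000 ≤ P.ω
  ω_le : P.ω ≤ P.L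
  θ_mul_ω : P.θ * P.ω = P.ε
  ε_le : P.ε ≤ 1 / 40
  T_pos : 0 < P.T
  T_le : (P.T : ℝ) ≤ P.L ^ 2
  C_pos : 0 < P.C
  C_le : (P.C : ℝ) ≤ P.Δ
  Δ_le_C_sq : P.Δ ≤ P.ω * (P.C : ℝ) ^ 2
  phat_pos : 0 < P.phat
  phat_small : 10 ^ 9 * P.L ^ 7 * P.phat ≤ 1
  entropy_small : 10 ^ 3 * P.L ^ 8 * Real.negMulLog P.phat ≤ 1
  grow_small : 10 ^ 4 * P.L ^ 8 * (P.phat ^ 2 * (3 * P.T * P.grow)) ≤ 1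
  triple_one : 20 * P.L * P.phat ^ 3 ≤ P.te
  triple_two : 40 * P.L * (P.phat ^ 3 * (2 * (P.ω / P.Δ))) ≤ P.te ^ 2
  ω₀_pos : 0 < P.ω₀
  ω₀_ge : 2100 * (P.T : ℝ) ≤ P.ω₀
  ω₀_inv_le : 1 / P.ω₀ ≤ P.θ / 1000
  decay : 1 / P.ω ^ 2 ≤ P.ε * (1 - P.θ / 4) ^ P.T
  ω₅_pos : 0 < P.ω₅
  ω₅_le : P.ω₅ ≤ P.θ / 6 * (1 - P.θ / 3) ^ P.T * P.Δ
  δ_pos : 0 < P.δ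
  kept_one : 20 * P.L * (100 * (P.δ + P.θ * P.phat * P.Δ)) ≤ P.ω₅
  kept_two : 40 * P.L * (2 * P.θ * P.Δ * (P.δ + P.θ * P.phat * P.Δ)) ≤ P.ω₅ ^ 2
  hits_one : 20 * P.L * P.δ ≤ P.grow
  hits_two : 40 * P.L * (P.δ * (2 * P.Δ * P.θ * P.phat)) ≤ P.grow ^ 2
  ω₆_ge : 2 ≤ P.ω₆
  log_ge : 85 / P.θ ≤ Real.log (P.phat * P.C)
  Δ₂_le : P.Δ₂ ≤ P.Δ
  Δ₂_le_grow : P.Δ₂ ≤ P.grow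
  Δ₂_le_C : P.Δ₂ ≤ P.ω * P.C
  final_three : (1 - P.θ / 3) ^ P.T * P.ω ≤ 1 / 1000
  final_four : (1 - P.θ / 4) ^ P.T * P.ω ≤ 1 / 1000

namespace Num

variable {P : Params} (hP : P.Num)
include hP

theorem L_pos : 0 < P.L := lt_of_lt_of_le (by norm_num) hP.L_ge
theorem Δ_pos : 0 < P.Δ := lt_of_lt_of_le (by norm_num) hP.Δ_ge
theorem ω_pos : 0 < P.ω := lt_of_lt_of_le (by norm_num) hP.ω_ge
theorem ε_pos : 0 < P.ε := hP.θ_mul_ω ▸ mul_pos hP.θ_pos hP.ω_pos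
theorem T_cast_pos : (0 : ℝ) < P.T := by exact_mod_cast hP.T_pos
theorem C_cast_pos : (0 : ℝ) < P.C := by exact_mod_cast hP.C_pos
theorem grow_pos : 0 < P.grow := by
  have := hP.ω₆_ge
  have := hP.θ_pos
  have := hP.Δ_pos
  have := hP.phat_pos
  unfold grow
  positivity
theorem te_pos : 0 < P.te := by
  have := hP.ω_pos
  have := hP.T_cast_pos
  have := hP.Δ_pos
  unfold te
  positivity

theorem pow_pos (i : ℕ) : 0 < (1 - P.θ / 4) ^ i := _root_.pow_pos (by linarith [hP.θ_le]) i

theorem pow_le_one (i : ℕ) : (1 - P.θ / 4) ^ i ≤ 1 :=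
  pow_le_one₀ (by linarith [hP.θ_le]) (by linarith [hP.θ_pos])

theorem pow_three_pos (i : ℕ) : 0 < (1 - P.θ / 3) ^ i := _root_.pow_pos (by linarith [hP.θ_le]) i

theorem pow_three_le (i : ℕ) : (1 - P.θ / 3) ^ i ≤ (1 - P.θ / 4) ^ i :=
  pow_le_pow_left₀ (by linarith [hP.θ_le]) (by linarith [hP.θ_pos]) i

theorem tau_pos : 0 < 1 / P.L ^ 3 := by have := hP.L_pos; positivity

theorem tau_le : 1 / P.L ^ 3 ≤ 1 / 10 ^ 6 := by
  have hL := hP.L_ge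
  refine one_div_le_one_div_of_le (by norm_num) (hL.trans ?_)
  exact le_self_pow₀ (by linarith) (by norm_num)

/-- The deviations are small compared with the weight of the edges. -/
theorem tau_le_decay {i : ℕ} (hi : i ≤ P.T) :
    1 / P.L ^ 3 ≤ P.ε * (1 - P.θ / 4) ^ i / 10 ^ 6 := by
  have hL := hP.L_ge
  have hL0 := hP.L_pos
  have hω := hP.ω_le
  have hω0 := hP.ω_pos
  have h1 : 1 / P.L ^ 3 ≤ 1 / P.ω ^ 2 / 10 ^ 6 := by
    rw [div_div]
    refine one_div_le_one_div_of_le (by positivity) ?_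
    calc P.ω ^ 2 * 10 ^ 6 ≤ P.L ^ 2 * P.L := by gcongr
      _ = P.L ^ 3 := by ring
  refine h1.trans ?_
  have h2 : (1 - P.θ / 4) ^ P.T ≤ (1 - P.θ / 4) ^ i :=
    pow_le_pow_of_le_one (by linarith [hP.θ_le]) (by linarith [hP.θ_pos]) hi
  have h3 := mul_le_mul_of_nonneg_left h2 hP.ε_pos.le
  have := hP.decay
  gcongr
  linarith

theorem T_mul_tau_le {i : ℕ} (hi : i ≤ P.T) : (i : ℝ) * (1 / P.L ^ 3) ≤ 1 / P.L := by
  have hL := hP.L_pos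
  have h : (i : ℝ) ≤ P.L ^ 2 := (Nat.cast_le.2 hi).trans hP.T_le
  calc (i : ℝ) * (1 / P.L ^ 3) ≤ P.L ^ 2 * (1 / P.L ^ 3) := by gcongr
    _ = 1 / P.L := by field_simp

theorem one_div_L_le : 1 / P.L ≤ 1 / 10 ^ 6 := one_div_le_one_div_of_le (by norm_num) hP.L_ge

theorem log_C_le : Real.log P.C ≤ P.L := Real.log_le_log hP.C_cast_pos hP.C_le

end Num

end Params

variable {V K : Type*} [Fintype V] [Fintype K]

namespace State

variable {S : State V K} {X : RankThree V} {list : V → Finset K} {P : Params}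

/-- The state after `i` rounds is as expected. -/
structure Inv (S : State V K) (X : RankThree V) (list : V → Finset K) (P : Params) (i : ℕ) :
    Prop where
  basic : S.Basic X list P.θ P.phat
  mass : ∀ u ∈ S.U, |∑ c, S.p u c - 1| ≤ i * (1 / P.L ^ 3)
  triple : ∀ e ∈ S.triples X, ∑ c, ∏ u ∈ e, S.p u c ≤ P.ω / P.Δ * (1 + i / (1000 * P.T))
  edge : ∀ u ∈ S.U, ∑ c, ∑ v ∈ S.nbrs c u, S.p u c * S.p v c ≤ 8 * (1 - P.θ / 4) ^ i * P.ω
  entropy : ∀ u ∈ S.U, Real.log P.C - 19 * P.ε * ∑ j ∈ Finset.range i, (1 - P.θ / 4) ^ j ≤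
    ∑ c, Real.negMulLog (S.p u c)
  degree : ∀ u ∈ S.U, ((S.triplesAt X u).card : ℝ) ≤ (1 - P.θ / 3) ^ i * P.Δ
  colorDegree : ∀ u ∈ S.U, ∀ c ∈ list u, ((S.nbrs c u).card : ℝ) ≤ P.grow * (1 + 2 * i)

namespace Inv

variable {i : ℕ} (hI : S.Inv X list P i) (hP : P.Num) (hC : ∀ u, (list u).card = P.C)
  (hi : i ≤ P.T)
include hI hP hC hi

theorem mass_le {u : V} (hu : u ∈ S.U) : |∑ c, S.p u c - 1| ≤ 1 / P.L :=
  (hI.mass u hu).trans (hP.T_mul_tau_le hi)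

theorem triple_le {e : Finset V} (he : e ∈ S.triples X) :
    ∑ c, ∏ u ∈ e, S.p u c ≤ P.ω / P.Δ * (1 + 1 / 1000) := by
  refine (hI.triple e he).trans ?_
  have h1 := hP.T_cast_pos
  have h2 : (i : ℝ) ≤ P.T := Nat.cast_le.2 hi
  have h3 : (i : ℝ) / (1000 * P.T) ≤ 1 / 1000 := by
    rw [div_le_div_iff₀ (by positivity) (by norm_num)]
    linarith
  have := div_pos hP.ω_pos hP.Δ_pos
  gcongr

/-- Edges contribute θ · 8(1-θ/4)^i ω = 8ε(1-θ/4)^i. Triples carry an extra factor θ ≤ 1/1000 and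
contribute at most 2θε(1-θ/4)^i. -/
theorem sum_p_mul_ell_le {u : V} (hu : u ∈ S.U) :
    ∑ c, S.p u c * S.ell X P.θ u c ≤ 81 / 10 * P.ε * (1 - P.θ / 4) ^ i := by
  have h0 := div_pos hP.ω_pos hP.Δ_pos
  have hθ := hP.θ_pos
  have h1 : ∑ e ∈ S.triplesAt X u, ∑ c, ∏ v ∈ e, S.p v c ≤ 2 * P.ω * (1 - P.θ / 4) ^ i := by
    refine (Finset.sum_le_card_nsmul _ _ _ fun e he =>
      hI.triple_le hP hC hi (mem_triplesAt.1 he).1).trans ?_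
    rw [nsmul_eq_mul]
    have h1 : ((S.triplesAt X u).card : ℝ) ≤ (1 - P.θ / 4) ^ i * P.Δ :=
      (hI.degree u hu).trans (mul_le_mul_of_nonneg_right (hP.pow_three_le i) hP.Δ_pos.le)
    have h2 : (1 - P.θ / 4) ^ i * P.Δ * (P.ω / P.Δ * (1 + 1 / 1000)) =
        (1 - P.θ / 4) ^ i * P.ω * (1 + 1 / 1000) := by
      have := hP.Δ_pos.ne'
      field_simp
    calc _ ≤ (1 - P.θ / 4) ^ i * P.Δ * (P.ω / P.Δ * (1 + 1 / 1000)) := by gcongr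
      _ ≤ _ := by rw [h2]; linarith [mul_pos (hP.pow_pos i) hP.ω_pos]
  refine (hI.basic.sum_p_mul_ell_le u h1 (hI.edge u hu)).trans ?_
  have h3 : P.θ ^ 2 * (2 * P.ω * (1 - P.θ / 4) ^ i) + P.θ * (8 * (1 - P.θ / 4) ^ i * P.ω) =
      (2 * P.θ + 8) * (P.θ * P.ω) * (1 - P.θ / 4) ^ i := by ring
  rw [h3, hP.θ_mul_ω]
  have := hP.θ_le
  have := mul_pos hP.ε_pos (hP.pow_pos i)
  nlinarith

/-- The geometric sum is at most 4/θ, and ε/θ = ω. This bounds the entropy lost over all rounds. -/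
theorem sum_geom_le : 19 * P.ε * ∑ j ∈ Finset.range i, (1 - P.θ / 4) ^ j ≤ 76 * P.ω := by
  have hθ := hP.θ_pos
  have h1 : (∑ j ∈ Finset.range i, (1 - P.θ / 4) ^ j) * (P.θ / 4) = 1 - (1 - P.θ / 4) ^ i := by
    have := geom_sum_mul (1 - P.θ / 4) i
    linarith
  have h2 := hP.pow_pos i
  rw [← hP.θ_mul_ω]
  have h3 := hP.ω_pos
  nlinarith

/-- Little weight is carried by the colours in `B u`. -/
theorem sum_B_le {u : V} (hu : u ∈ S.U) : ∑ c, S.p u c * ind (c ∈ S.B u) ≤ P.ε := by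
  have hS := hI.basic
  have hC' := hP.C_cast_pos
  have hph := hP.phat_pos
  set lg := Real.log (P.phat * P.C) with hlg
  have h1 : ∀ c, Real.negMulLog (S.p u c) ≤ S.p u c * Real.log P.C -
      S.p u c * ind (c ∈ S.B u) * lg + if c ∈ list u then 1 / (P.C : ℝ) else 0 := by
    intro c
    have hite : (0 : ℝ) ≤ if c ∈ list u then 1 / (P.C : ℝ) else 0 := by
      split_ifs
      · positivity
      · exact le_rfl
    by_cases hB : c ∈ S.B u
    · rw [ind_of_true hB, (hS.mem_B u c).1 hB, hlg, Real.log_mul hph.ne' hC'.ne', Real.negMulLog]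
      linarith
    · rw [ind_of_false hB, mul_zero, zero_mul, sub_zero]
      rcases (hS.p_nonneg u c).eq_or_lt with h0 | hp
      · rw [← h0]; simpa using hite
      · have hc : c ∈ list u := by
          by_contra hc
          exact hp.ne' (hS.p_supp u c hc)
        rw [if_pos hc, Real.negMulLog]
        have h3 := Real.log_le_sub_one_of_pos (inv_pos.2 (mul_pos hC' hp))
        rw [Real.log_inv, Real.log_mul hC'.ne' hp.ne'] at h3
        have h4 := mul_le_mul_of_nonneg_left h3 hp.le
        have h5 : S.p u c * ((P.C * S.p u c)⁻¹ - 1) = 1 / P.C - S.p u c := by field_simp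
        rw [h5] at h4
        nlinarith
  -- The entropy is at least log C - 76ω, but at most (Σp) log C + 1 minus log(p̂C) times the weight
  -- of B(u). As (Σp - 1) log C ≤ 1, this weight times log(p̂C) is at most 76ω + 2 ≤ 85ω; relation
  -- R1, log(p̂C) ≥ 85/θ, turns that into θω = ε.
  have h2 := (hI.entropy u hu).trans (Finset.sum_le_sum fun c _ => h1 c)
  rw [Finset.sum_add_distrib, Finset.sum_sub_distrib, ← Finset.sum_mul, ← Finset.sum_mul,
    Finset.sum_ite_mem, Finset.univ_inter, Finset.sum_const, hC, nsmul_eq_mul,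
    mul_one_div_cancel hC'.ne'] at h2
  have h3 := hI.sum_geom_le hP hC hi
  have h4 := (abs_le.1 (hI.mass_le hP hC hi hu)).2
  have h5 : (∑ c, S.p u c - 1) * Real.log P.C ≤ 1 := by
    have h6 : 0 ≤ Real.log P.C := Real.log_natCast_nonneg _
    have h7 := hP.log_C_le
    have h8 := hP.L_pos
    calc _ ≤ 1 / P.L * Real.log P.C := by gcongr
      _ ≤ 1 / P.L * P.L := by gcongr
      _ = 1 := by field_simp
  have hω := hP.ω_ge
  have h6 : (∑ c, S.p u c * ind (c ∈ S.B u)) * lg ≤ 85 * P.ω := by nlinarith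
  have hw0 : 0 ≤ ∑ c, S.p u c * ind (c ∈ S.B u) :=
    Finset.sum_nonneg fun c _ => mul_nonneg (hS.p_nonneg u c) (ind_nonneg _)
  have h7 := mul_le_mul_of_nonneg_left hP.log_ge hw0
  have hθ := hP.θ_pos
  have h8 : (∑ c, S.p u c * ind (c ∈ S.B u)) * (85 / P.θ) ≤ 85 * P.ω := h7.trans h6
  rw [mul_div_assoc', div_le_iff₀ hθ] at h8
  rw [← hP.θ_mul_ω]
  linarith

/-- From a total weight near 1 at most 8.1ε is lost to threats, since 1 - q ≤ ℓ, and at most ε lies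
on B(u). With ε ≤ 1/40 more than 63/100 remains. -/
theorem lively {u : V} (hu : u ∈ S.U) : S.Lively X P.θ u := by
  have hS := hI.basic
  have h1 := abs_le.1 (hI.mass_le hP hC hi hu)
  have h2 := hP.one_div_L_le
  refine ⟨by linarith [h1.2], ?_⟩
  have h3 : ∀ c, S.p u c - S.p u c * S.ell X P.θ u c - S.p u c * ind (c ∈ S.B u) ≤
      S.p u c * S.q X P.θ u c * ind (c ∉ S.B u) := by
    intro c
    have h4 := mul_le_mul_of_nonneg_left (hS.one_sub_q_le u c) (hS.p_nonneg u c)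
    have h5 := mul_nonneg (hS.p_nonneg u c) (hS.ell_nonneg u c)
    by_cases hB : c ∈ S.B u
    · rw [ind_of_true hB, ind_of_false (not_not.2 hB)]
      linarith
    · rw [ind_of_false hB, ind_of_true hB]
      linarith
  refine le_trans ?_ (Finset.sum_le_sum fun c _ => h3 c)
  rw [Finset.sum_sub_distrib, Finset.sum_sub_distrib]
  have h6 := hI.sum_B_le hP hC hi hu
  have h7 := hI.sum_p_mul_ell_le hP hC hi hu
  have h8 := hP.ε_le
  have h9 : P.ε * (1 - P.θ / 4) ^ i ≤ P.ε := mul_le_of_le_one_right hP.ε_pos.le (hP.pow_le_one i)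
  linarith [h1.1]

end Inv

end State

end SemiRandom

/-! ### Good outcomes of a round and their locality -/

namespace SemiRandom

open FinProb

variable {V K : Type*} [Fintype V] [Fintype K]

namespace RankThree

variable {X : RankThree V} {Δ Δ₂ δ : ℝ}

/-- The vertices that are equal to `u` or lie in an edge together with `u`. -/
def nearSet (X : RankThree V) (u : V) : Finset V := Finset.univ.filter fun v => X.Near u v

theorem mem_nearSet {u v : V} : v ∈ X.nearSet u ↔ X.Near u v := by simp [nearSet]

theorem DegreesAtMost.card_nearSet_le (hX : X.DegreesAtMost Δ Δ₂ δ) (u : V) :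
    ((X.nearSet u).card : ℝ) ≤ 1 + Δ₂ + 3 * Δ := by
  have h3 := hX.degree_three u
  have h2 := hX.degree_two u
  rw [show {e | e ∈ X.H ∧ u ∈ e} = ((X.H.filter (u ∈ ·) : Finset (Finset V)) : Set (Finset V)) by
    ext; simp, Set.ncard_coe_finset] at h3
  rw [← Set.coe_toFinset (X.G.neighborSet u), Set.ncard_coe_finset] at h2
  have hsub : X.nearSet u ⊆ ({u} ∪ (X.G.neighborSet u).toFinset) ∪
      (X.H.filter (u ∈ ·)).biUnion id := by
    intro v hv
    rcases mem_nearSet.1 hv with rfl | h | ⟨e, he, hu, hv⟩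
    · simp
    · simp [h]
    · simp only [Finset.mem_union, Finset.mem_biUnion, Finset.mem_filter]
      exact Or.inr ⟨e, ⟨he, hu⟩, hv⟩
  have hb : ((X.H.filter (u ∈ ·)).biUnion id).card ≤ (X.H.filter (u ∈ ·)).card * 3 :=
    Finset.card_biUnion_le_card_mul _ _ _ fun e he =>
      (X.card_eq_three e (Finset.mem_filter.1 he).1).le
  have h : (X.nearSet u).card ≤ (1 + (X.G.neighborSet u).toFinset.card) +
      (X.H.filter (u ∈ ·)).card * 3 := by
    refine (Finset.card_le_card hsub).trans ((Finset.card_union_le _ _).trans ?_)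
    refine Nat.add_le_add ((Finset.card_union_le _ _).trans ?_) hb
    simp
  have h' : ((X.nearSet u).card : ℝ) ≤ (1 + ((X.G.neighborSet u).toFinset.card : ℝ)) +
      ((X.H.filter (u ∈ ·)).card : ℝ) * 3 := by exact_mod_cast h
  linarith

end RankThree

namespace State

variable {S : State V K} {X : RankThree V} {list : V → Finset K} {P : Params}

theorem card_triplesAt_filter_le {Δ Δ₂ δ : ℝ} (hX : X.DegreesAtMost Δ Δ₂ δ) (u w : V)
    (hw : w ≠ u) : (((S.triplesAt X u).filter fun e => w ∈ e).card : ℝ) ≤ δ := by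
  refine le_trans ?_ (hX.codegree u w hw.symm)
  rw [← Set.ncard_coe_finset]
  refine Nat.cast_le.2 (Set.ncard_le_ncard (fun e he => ?_) (Set.toFinite _))
  simp only [Finset.coe_filter, mem_triplesAt, Set.mem_ofPred_eq] at he
  exact ⟨he.1.1.1, he.1.2, he.2⟩

theorem card_triplesAt_le {Δ Δ₂ δ : ℝ} (hX : X.DegreesAtMost Δ Δ₂ δ) (u : V) :
    ((S.triplesAt X u).card : ℝ) ≤ Δ := by
  refine le_trans ?_ (hX.degree_three u)
  rw [← Set.ncard_coe_finset]
  refine Nat.cast_le.2 (Set.ncard_le_ncard (fun e he => ?_) (Set.toFinite _))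
  have he := mem_triplesAt.1 he
  exact ⟨he.1.1, he.2⟩

/-- The random bits of round `i + 1` behave at the vertex `u`. -/
structure Good (S : State V K) (X : RankThree V) (list : V → Finset K) (P : Params) (i : ℕ)
    (u : V) (x : Bits V K) : Prop where
  mass : |∑ c, S.pn X P.θ P.phat u c x - ∑ c, S.p u c| < 1 / P.L ^ 3
  triple : ∀ e ∈ S.triplesAt X u, ∑ c, ∏ v ∈ e, S.pn X P.θ P.phat v c x <
    P.ω / P.Δ * (1 + i / (1000 * P.T)) * (1 + 1 / P.ω₀) + P.te
  entropy : ∑ c, Real.negMulLog (S.p u c) - 2 * ∑ c, S.p u c * S.ell X P.θ u c - 1 / P.L ^ 3 <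
    ∑ c, Real.negMulLog (S.pn X P.θ P.phat u c x)
  hits : ∀ c ∈ list u, S.hits X u c x < 2 * P.Δ * P.θ * P.phat + P.grow
  newMass : ∑ c, S.newMass X P.θ P.phat u c x * ind (S.hits X u c x ≤ 2 * P.grow) <
    2 * P.θ * ((1 - P.θ / 3) ^ i * P.Δ) *
      (P.ω / P.Δ * (1 + i / (1000 * P.T)) * (1 + 1 / P.ω₀)) + 1 / P.L ^ 3
  keptMass : S.keptMass X P.θ P.phat u x < (1 - 55 / 100 * P.θ) *
    (8 * (1 - P.θ / 4) ^ i * P.ω * (1 + 1 / P.ω₀) + 1 / P.L ^ 3) + 1 / P.L ^ 3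
  keptTriples : S.keptTriples X u x <
    (1 - 55 / 100 * P.θ) * (S.triplesAt X u).card + P.ω₅

/-- The conditions involve the new weights and the idleness of vertices near u, and each of these
looks only at bits near the vertex concerned. So distance two suffices. -/
theorem Good.dependsOn (hS : S.Basic X list P.θ P.phat) (i : ℕ) (u : V) :
    DependsOn (S.Good X list P i u) {j | ∃ v, X.Near u v ∧ X.Near v (vert j)} := by
  suffices h : ∀ x y : Bits V K,
      (∀ j ∈ {j : (V × K) ⊕ (V × K) | ∃ v, X.Near u v ∧ X.Near v (vert j)}, x j = y j) →
      S.Good X list P i u x → S.Good X list P i u y by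
    intro x y hxy
    exact propext ⟨h x y hxy, h y x fun j hj => (hxy j hj).symm⟩
  intro x y hxy hg
  have hpn : ∀ v, X.Near u v → ∀ c, S.pn X P.θ P.phat v c x = S.pn X P.θ P.phat v c y :=
    fun v hv c => hS.pn_dependsOn v c fun j hj => hxy j ⟨v, hv, hj.2⟩
  have hid : ∀ v, X.Near u v → S.Idle X v x = S.Idle X v y := by
    intro v hv
    refine propext (forall_congr' fun d => ?_)
    rw [iff_iff_eq]
    exact congrArg Not (hS.cand_dependsOn v d fun j hj => hxy j ⟨v, hv, hj.2⟩)
  have huu : X.Near u u := Or.inl rfl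
  have htr : ∀ e ∈ S.triplesAt X u, ∀ v ∈ e, X.Near u v := fun e he v hv =>
    Or.inr (Or.inr ⟨e, (mem_triplesAt.1 he).1.1, (mem_triplesAt.1 he).2, hv⟩)
  have hgam : ∀ v, X.Near u v → ∀ c, gam x v c = gam y v c := fun v hv c =>
    hxy (Sum.inl (v, c)) ⟨v, hv, Or.inl rfl⟩
  have hhits : ∀ c, S.hits X u c x = S.hits X u c y := by
    intro c
    refine Finset.sum_congr rfl fun e he => Finset.sum_congr rfl fun w hw => ?_
    rw [hgam w (htr e he w (Finset.mem_of_mem_erase hw))]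
  have hnew : ∀ c, S.newMass X P.θ P.phat u c x = S.newMass X P.θ P.phat u c y := by
    intro c
    refine Finset.sum_congr rfl fun e he => Finset.sum_congr rfl fun v hv =>
      Finset.sum_congr rfl fun w hw => ?_
    rw [hgam w (htr e he w (Finset.mem_of_mem_erase (Finset.mem_of_mem_erase hw))),
      hpn u huu, hpn v (htr e he v (Finset.mem_of_mem_erase hv))]
  have hkm : S.keptMass X P.θ P.phat u x = S.keptMass X P.θ P.phat u y := by
    refine Finset.sum_congr rfl fun c _ => Finset.sum_congr rfl fun v hv => ?_
    have hv' := hS.adj_near _ _ _ (mem_nbrs.1 hv)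
    rw [hpn u huu, hpn v hv', hid v hv']
  have hkt : S.keptTriples X u x = S.keptTriples X u y := by
    refine Finset.sum_congr rfl fun e he => ?_
    congr 1
    exact propext (forall₂_congr fun v hv => iff_of_eq (hid v (htr e he v hv)))
  refine ⟨?_, ?_, ?_, ?_, ?_, ?_, ?_⟩
  · simpa only [hpn u huu] using hg.mass
  · intro e he
    have h := hg.triple e he
    rwa [Finset.sum_congr rfl fun c _ => Finset.prod_congr rfl fun v hv =>
      hpn v (htr e he v hv) c] at h
  · simpa only [hpn u huu] using hg.entropy
  · simpa only [hhits] using hg.hits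
  · simpa only [hhits, hnew] using hg.newMass
  · simpa only [hkm] using hg.keptMass
  · simpa only [hkt] using hg.keptTriples

end State

namespace Params.Num

variable {P : Params} (hP : P.Num)
include hP

theorem le_tau {a : ℝ} (h : a * P.L ^ 3 ≤ 1) : a ≤ 1 / P.L ^ 3 := by
  have := hP.L_pos
  rwa [le_div_iff₀ (by positivity)]

theorem le_tau_sq {a : ℝ} (h : a * P.L ^ 6 ≤ 1) : a ≤ (1 / P.L ^ 3) ^ 2 := by
  have := hP.L_pos
  rw [div_pow, one_pow, ← pow_mul, le_div_iff₀ (by positivity)]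
  exact h

theorem one_le_L : 1 ≤ P.L := le_trans (by norm_num) hP.L_ge

theorem phat_mul_le {a : ℝ} {k : ℕ} (ha : a ≤ 10 ^ 9) (hk : k ≤ 7) :
    a * P.L ^ k * P.phat ≤ 1 := by
  refine le_trans ?_ hP.phat_small
  have := hP.phat_pos.le
  have := hP.L_pos.le
  have := pow_le_pow_right₀ hP.one_le_L hk
  gcongr

theorem grow_mul_le {a : ℝ} {k : ℕ} (ha : a ≤ 10 ^ 4) (hk : k ≤ 8) :
    a * P.L ^ k * (P.phat ^ 2 * (3 * P.T * P.grow)) ≤ 1 := by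
  refine le_trans ?_ hP.grow_small
  have := hP.phat_pos.le
  have := hP.L_pos.le
  have := hP.grow_pos.le
  have := pow_le_pow_right₀ hP.one_le_L hk
  gcongr

theorem phat_le_one : P.phat ≤ 1 := by
  have := hP.phat_mul_le (a := 1) (k := 0) (by norm_num) (by norm_num)
  simpa using this

theorem phat_le : P.phat ≤ 1 / 10 ^ 9 := by
  have := hP.phat_mul_le (a := 10 ^ 9) (k := 0) (by norm_num) (by norm_num)
  rw [le_div_iff₀ (by norm_num)]
  linarith

theorem entropy_mul_le {a : ℝ} {k : ℕ} (ha : a ≤ 10 ^ 3) (hk : k ≤ 8) :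
    a * P.L ^ k * Real.negMulLog P.phat ≤ 1 := by
  refine le_trans ?_ hP.entropy_small
  have := Real.negMulLog_nonneg hP.phat_pos.le hP.phat_le_one
  have := hP.L_pos.le
  have := pow_le_pow_right₀ hP.one_le_L hk
  gcongr

theorem one_div_ω₀_le : 1 / P.ω₀ ≤ 1 / 10 ^ 6 :=
  hP.ω₀_inv_le.trans (by linarith [hP.θ_le])

theorem one_le_T : (1 : ℝ) ≤ P.T := by exact_mod_cast hP.T_pos

theorem two_mul_le_grow : 2 * P.Δ * P.θ * P.phat ≤ P.grow := by
  have := hP.Δ_pos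
  have := hP.θ_pos
  have := hP.phat_pos
  have := hP.ω₆_ge
  calc 2 * P.Δ * P.θ * P.phat ≤ P.ω₆ * P.Δ * P.θ * P.phat := by gcongr
    _ = P.grow := by unfold grow; ring

/-- All tail bounds are used with M = 10 log Δ; the resulting Δ^(-10) beats both the union bound at
a vertex and the dependency degree of order Δ⁴. -/
theorem exp_eq : Real.exp (-(10 * P.L)) = (P.Δ ^ 10)⁻¹ := by
  rw [Real.exp_neg, L, show 10 * Real.log P.Δ = Real.log (P.Δ ^ 10) by
    rw [Real.log_pow]; norm_num, Real.exp_log (by have := hP.Δ_pos; positivity)]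

theorem card_nearSet_le {V : Type*} [Fintype V] {X : RankThree V}
    (hX : X.DegreesAtMost P.Δ P.Δ₂ P.δ) (u : V) : ((X.nearSet u).card : ℝ) ≤ 5 * P.Δ := by
  have := hX.card_nearSet_le u
  have := hP.Δ₂_le
  have := hP.Δ_ge
  linarith

end Params.Num

end SemiRandom

/-! ### Failure probabilities and the local lemma for a round -/

namespace SemiRandom

open FinProb

variable {V K : Type*} [Fintype V] [Fintype K]

namespace State

variable {S : State V K} {X : RankThree V} {list : V → Finset K} {P : Params}

namespace Inv

variable {i : ℕ} (hI : S.Inv X list P i) (hP : P.Num) (hC : ∀ u, (list u).card = P.C)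
  (hi : i < P.T)
include hI hP hC hi

theorem sum_p_le_two {u : V} (hu : u ∈ S.U) : ∑ c, S.p u c ≤ 2 := by
  have := (abs_le.1 (hI.mass_le hP hC hi.le hu)).2
  have := hP.one_div_L_le
  linarith

theorem E_le : P.ω / P.Δ * (1 + i / (1000 * P.T)) * (1 + 1 / P.ω₀) ≤ 2 * (P.ω / P.Δ) := by
  have h0 := div_pos hP.ω_pos hP.Δ_pos
  have h1 := hP.T_cast_pos
  have h2 : (i : ℝ) ≤ P.T := Nat.cast_le.2 hi.le
  have h3 : (i : ℝ) / (1000 * P.T) ≤ 1 / 1000 := by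
    rw [div_le_div_iff₀ (by positivity) (by norm_num)]
    linarith
  have h4 := hP.one_div_ω₀_le
  have h5 := one_div_pos.2 hP.ω₀_pos
  have h6 : (0 : ℝ) ≤ i / (1000 * P.T) := by positivity
  have h7 : (1 + (i : ℝ) / (1000 * P.T)) * (1 + 1 / P.ω₀) ≤ 2 := by nlinarith
  rw [mul_assoc, mul_comm 2]
  gcongr

theorem pr_mass {u : V} (hu : u ∈ S.U) : pr (S.law P.θ P.phat) (fun x =>
    1 / P.L ^ 3 ≤ |∑ c, S.pn X P.θ P.phat u c x - ∑ c, S.p u c|) ≤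
      2 * Real.exp (-(10 * P.L)) := by
  have hL := hP.L_pos
  refine hI.basic.pr_mass_le u hP.tau_pos (by positivity) (hI.sum_p_le_two hP hC hi hu)
    (hP.le_tau ?_) (hP.le_tau_sq ?_)
  · have := hP.phat_mul_le (a := 20) (k := 4) (by norm_num) (by norm_num)
    linear_combination this
  · have := hP.phat_mul_le (a := 80) (k := 7) (by norm_num) (by norm_num)
    linear_combination this

theorem pr_triple (hN : S.NearIndependent X P.θ P.ω₀) {e : Finset V} (he : e ∈ S.triples X) :
    pr (S.law P.θ P.phat) (fun x => P.ω / P.Δ * (1 + i / (1000 * P.T)) * (1 + 1 / P.ω₀) + P.te ≤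
      ∑ c, ∏ v ∈ e, S.pn X P.θ P.phat v c x) ≤ Real.exp (-(10 * P.L)) := by
  have hL := hP.L_pos
  have hph := hP.phat_pos
  refine hI.basic.pr_triple_le hN hP.ω₀_pos he hP.te_pos (by positivity) (hI.triple e he) ?_ ?_
  · linear_combination hP.triple_one
  · refine le_trans ?_ hP.triple_two
    have := hI.E_le hP hC hi
    rw [show (4 : ℝ) * (10 * P.L) = 40 * P.L by ring]
    gcongr

theorem pr_entropy {u : V} (hu : u ∈ S.U) : pr (S.law P.θ P.phat) (fun x =>
    ∑ c, Real.negMulLog (S.pn X P.θ P.phat u c x) ≤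
      ∑ c, Real.negMulLog (S.p u c) - 2 * ∑ c, S.p u c * S.ell X P.θ u c - 1 / P.L ^ 3) ≤
      Real.exp (-(10 * P.L)) := by
  have hL := hP.L_pos
  have hn := Real.negMulLog_nonneg hP.phat_pos.le hP.phat_le_one
  refine hI.basic.pr_entropy_le u (hC u) hP.C_pos hP.tau_pos (by positivity)
    (hI.sum_p_le_two hP hC hi hu) ?_ (hP.le_tau ?_) (hP.le_tau_sq ?_)
  · have := hP.phat_le
    have := Real.exp_neg_one_gt_d9
    linarith
  · have := hP.entropy_mul_le (a := 20) (k := 4) (by norm_num) (by norm_num)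
    linear_combination this
  · have h1 := hP.entropy_mul_le (a := 120) (k := 8) (by norm_num) (by norm_num)
    have h2 := hP.log_C_le
    have h3 := hP.one_le_L
    have h4 : 2 * Real.log P.C + 1 ≤ 3 * P.L := by linarith
    refine le_trans ?_ h1
    calc 4 * (10 * P.L) * (Real.negMulLog P.phat * (2 * Real.log P.C + 1)) * P.L ^ 6 ≤
        4 * (10 * P.L) * (Real.negMulLog P.phat * (3 * P.L)) * P.L ^ 6 := by gcongr
      _ = _ := by ring

theorem pr_hits (hX : X.DegreesAtMost P.Δ P.Δ₂ P.δ) (u : V) (c : K) :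
    pr (S.law P.θ P.phat) (fun x => 2 * P.Δ * P.θ * P.phat + P.grow ≤ S.hits X u c x) ≤
      Real.exp (-(10 * P.L)) := by
  have hL := hP.L_pos
  refine hI.basic.pr_hits_le u c hP.grow_pos (by positivity) hP.δ_pos.le (card_triplesAt_le hX u)
    (card_triplesAt_filter_le hX u) ?_ ?_
  · linear_combination hP.hits_one
  · linear_combination hP.hits_two

theorem degree_le : (1 - P.θ / 3) ^ i * P.Δ ≤ P.Δ :=
  mul_le_of_le_one_left hP.Δ_pos.le ((hP.pow_three_le i).trans (hP.pow_le_one i))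

theorem pr_newMass (hN : S.NearIndependent X P.θ P.ω₀) {u : V} (hu : u ∈ S.U) :
    pr (S.law P.θ P.phat) (fun x => 2 * P.θ * ((1 - P.θ / 3) ^ i * P.Δ) *
      (P.ω / P.Δ * (1 + i / (1000 * P.T)) * (1 + 1 / P.ω₀)) + 1 / P.L ^ 3 ≤
      ∑ c, S.newMass X P.θ P.phat u c x * ind (S.hits X u c x ≤ 2 * P.grow)) ≤
      Real.exp (-(10 * P.L)) := by
  have hL := hP.L_pos
  have hg := hP.grow_pos
  have hT := hP.one_le_T
  have hE0 := div_pos hP.ω_pos hP.Δ_pos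
  have hθ := hP.θ_pos
  have hE1 : 0 ≤ P.ω / P.Δ * (1 + i / (1000 * P.T)) := by positivity
  have hb : 2 * P.grow ≤ 3 * P.T * P.grow := by nlinarith
  refine hI.basic.pr_newMass_le hN hP.ω₀_pos u hP.tau_pos (by positivity) (by positivity)
    (hI.degree u hu) hE1 (fun e he => hI.triple e (mem_triplesAt.1 he).1) (hP.le_tau ?_)
    (hP.le_tau_sq ?_)
  · refine le_trans ?_ (hP.grow_mul_le (a := 20) (k := 4) (by norm_num) (by norm_num))
    calc 2 * (10 * P.L) * (P.phat ^ 2 * (2 * P.grow)) * P.L ^ 3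
        ≤ 2 * (10 * P.L) * (P.phat ^ 2 * (3 * P.T * P.grow)) * P.L ^ 3 := by gcongr
      _ = _ := by ring
  · refine le_trans ?_ (hP.grow_mul_le (a := 40) (k := 7) (by norm_num) (by norm_num))
    have h4 := hP.pow_three_pos i
    have h5 := hP.Δ_pos
    have h6 := hP.ω₀_pos
    have h1 : 2 * P.θ * ((1 - P.θ / 3) ^ i * P.Δ) *
      (P.ω / P.Δ * (1 + i / (1000 * P.T)) * (1 + 1 / P.ω₀)) ≤ 1 := by
      have h2 := hI.degree_le hP hC hi
      have h3 := hI.E_le hP hC hi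
      calc _ ≤ 2 * P.θ * P.Δ * (2 * (P.ω / P.Δ)) := by gcongr
        _ = 4 * (P.θ * P.ω) := by field_simp; ring
        _ ≤ 1 := by rw [hP.θ_mul_ω]; linarith [hP.ε_le]
    calc 4 * (10 * P.L) * (P.phat ^ 2 * (2 * P.grow) * (2 * P.θ * ((1 - P.θ / 3) ^ i * P.Δ) *
          (P.ω / P.Δ * (1 + i / (1000 * P.T)) * (1 + 1 / P.ω₀)))) * P.L ^ 6
        ≤ 4 * (10 * P.L) * (P.phat ^ 2 * (3 * P.T * P.grow) * 1) * P.L ^ 6 := by gcongr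
      _ = _ := by ring

theorem pr_keptTriples (hX : X.DegreesAtMost P.Δ P.Δ₂ P.δ) (u : V) :
    pr (S.law P.θ P.phat) (fun x => (1 - 55 / 100 * P.θ) * (S.triplesAt X u).card + P.ω₅ ≤
      S.keptTriples X u x) ≤ Real.exp (-(10 * P.L)) := by
  have hL := hP.L_pos
  have hθ := hP.θ_le
  refine hI.basic.pr_keptTriples_le u (fun v hv => hI.lively hP hC hi.le hv) (by linarith)
    hP.δ_pos (card_triplesAt_le hX u) (card_triplesAt_filter_le hX u) hP.ω₅_pos (by positivity)
    ?_ ?_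
  · linear_combination hP.kept_one
  · linear_combination hP.kept_two

theorem allNbrs_subset (u : V) : S.allNbrs u ⊆ X.nearSet u := by
  intro v hv
  simp only [allNbrs, Finset.mem_filter_univ] at hv
  obtain ⟨c, hc⟩ := hv
  exact RankThree.mem_nearSet.2 (hI.basic.adj_near _ _ _ (by simpa [mem_nbrs] using hc))

theorem pr_keptMass (hN : S.NearIndependent X P.θ P.ω₀) (hX : X.DegreesAtMost P.Δ P.Δ₂ P.δ)
    {u : V} (hu : u ∈ S.U) :
    pr (S.law P.θ P.phat) (fun x => (1 - 55 / 100 * P.θ) *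
      (8 * (1 - P.θ / 4) ^ i * P.ω * (1 + 1 / P.ω₀) + 1 / P.L ^ 3) + 1 / P.L ^ 3 ≤
      S.keptMass X P.θ P.phat u x) ≤ (81 + 10 * P.Δ) * Real.exp (-(10 * P.L)) := by
  have hL := hP.L_pos
  have hL1 := hP.L_ge
  have hg := hP.grow_pos
  have hT := hP.one_le_T
  have hθ := hP.θ_pos
  have hθ1 := hP.θ_le
  have hph := hP.phat_pos
  have hΔ := hP.Δ_ge
  have hcard : ((S.allNbrs u).card : ℝ) ≤ 5 * P.Δ :=
    (Nat.cast_le.2 (Finset.card_le_card (hI.allNbrs_subset hP hC hi u))).trans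
      (hP.card_nearSet_le hX u)
  have hlive : ∀ v ∈ S.allNbrs u, S.Lively X P.θ v := fun v hv =>
    hI.lively hP hC hi.le (hI.basic.allNbrs_subset_U hv)
  -- With 80 parts the share of a part at each neighbour is at most 1.5/80 + 0.025 = 0.04375, below
  -- the allowed 5/100.
  obtain ⟨κ, hκ⟩ := exists_partition (S.allNbrs u) S.p (ph := P.phat) (s := 3 / 2)
    (t := 25 / 1000) (M := 10 * P.L) 80 (by norm_num) hI.basic.p_nonneg hI.basic.p_le hph.le
    (fun v hv => (hlive v hv).mass) (by norm_num) (by positivity)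
    (by have := hP.phat_mul_le (a := 10 ^ 9) (k := 1) (by norm_num) (by norm_num); linarith)
    (by have := hP.phat_mul_le (a := 10 ^ 9) (k := 1) (by norm_num) (by norm_num)
        norm_num
        linarith)
    (by
      rw [hP.exp_eq, ← div_eq_mul_inv, div_lt_one (by positivity)]
      have h1 : P.Δ * (10 ^ 6) ≤ P.Δ ^ 10 := by
        calc P.Δ * 10 ^ 6 ≤ P.Δ * P.Δ := by gcongr
          _ = P.Δ ^ 2 := by ring
          _ ≤ P.Δ ^ 10 := pow_le_pow_right₀ (by linarith) (by norm_num)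
      push_cast
      nlinarith)
  have hb : P.grow * (1 + 2 * i) ≤ 3 * P.T * P.grow := by
    have : (i : ℝ) + 1 ≤ P.T := by exact_mod_cast hi
    nlinarith
  have hω := hP.ω_pos
  have hω0 := hP.ω₀_pos
  have hpow := hP.pow_pos i
  have hf : 8 * (1 - P.θ / 4) ^ i * P.ω * (1 + 1 / P.ω₀) ≤ 9 * P.ω := by
    have h1 := hP.one_div_ω₀_le
    have h2 := hP.pow_le_one i
    calc _ ≤ 8 * 1 * P.ω * (1 + 1 / 10 ^ 6) := by gcongr
      _ ≤ 9 * P.ω := by linarith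
  have hω1 := hP.ω_ge
  have hτ := hP.tau_le
  have hτ0 := hP.tau_pos
  set s := 8 * (1 - P.θ / 4) ^ i * P.ω * (1 + 1 / P.ω₀) + 1 / P.L ^ 3 with hs
  have hs0 : 0 ≤ s := by positivity
  have hθs : P.θ * s ≤ 1 / 2 := by
    have h1 : s ≤ 10 * P.ω := by linarith
    calc P.θ * s ≤ P.θ * (10 * P.ω) := by gcongr
      _ = 10 * (P.θ * P.ω) := by ring
      _ ≤ 1 / 2 := by rw [hP.θ_mul_ω]; linarith [hP.ε_le]
  have hα : 2 * P.phat + P.θ * P.phat * s ≤ 3 * P.phat := by nlinarith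
  refine (hI.basic.pr_keptMass_le hN hP.ω₀_pos u (f := 8 * (1 - P.θ / 4) ^ i * P.ω)
    (b := P.grow * (1 + 2 * i)) (M := 10 * P.L) (by norm_num) κ hlive
    (fun v hv j => (hκ v hv j).trans (by norm_num)) (by linarith) hP.tau_pos
    (hP.tau_le.trans (by norm_num)) (by positivity) (by positivity) (hI.colorDegree u hu)
    (hI.edge u hu) (hP.le_tau ?_) (hP.le_tau_sq ?_) ?_ ?_ (hP.le_tau ?_) (hP.le_tau_sq ?_)).trans ?_
  · refine le_trans ?_ (hP.grow_mul_le (a := 20) (k := 4) (by norm_num) (by norm_num))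
    calc 2 * (10 * P.L) * (P.phat ^ 2 * (P.grow * (1 + 2 * i))) * P.L ^ 3
        ≤ 2 * (10 * P.L) * (P.phat ^ 2 * (3 * P.T * P.grow)) * P.L ^ 3 := by gcongr
      _ = _ := by ring
  · refine le_trans ?_ (hP.grow_mul_le (a := 360) (k := 8) (by norm_num) (by norm_num))
    have hf' := hf.trans (mul_le_mul_of_nonneg_left hP.ω_le (by norm_num : (0 : ℝ) ≤ 9))
    calc 4 * (10 * P.L) * (P.phat ^ 2 * (P.grow * (1 + 2 * i)) *
          (8 * (1 - P.θ / 4) ^ i * P.ω * (1 + 1 / P.ω₀))) * P.L ^ 6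
        ≤ 4 * (10 * P.L) * (P.phat ^ 2 * (3 * P.T * P.grow) * (9 * P.L)) * P.L ^ 6 := by
          gcongr
      _ = _ := by ring
  · rw [div_div, le_div_iff₀ (by positivity)]
    have := hP.phat_mul_le (a := 480000) (k := 4) (by norm_num) (by norm_num)
    calc 2 * (10 * P.L) * (100 * (2 * P.phat + P.θ * P.phat * s)) * (P.L ^ 3 * (80 : ℕ))
        ≤ 2 * (10 * P.L) * (100 * (3 * P.phat)) * (P.L ^ 3 * (80 : ℕ)) := by gcongr
      _ = 480000 * P.L ^ 4 * P.phat := by push_cast; ring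
      _ ≤ 1 := this
  · rw [div_div, div_pow, one_pow, le_div_iff₀ (by positivity)]
    have := hP.phat_mul_le (a := 768000) (k := 7) (by norm_num) (by norm_num)
    calc 4 * (10 * P.L) * (2 * P.θ * s * (2 * P.phat + P.θ * P.phat * s)) *
          (P.L ^ 3 * (80 : ℕ)) ^ 2
        = 80 * P.L * (P.θ * s) * (2 * P.phat + P.θ * P.phat * s) *
          (P.L ^ 3 * (80 : ℕ)) ^ 2 := by ring
      _ ≤ 80 * P.L * (1 / 2) * (3 * P.phat) * (P.L ^ 3 * (80 : ℕ)) ^ 2 := by gcongr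
      _ = 768000 * P.L ^ 7 * P.phat := by push_cast; ring
      _ ≤ 1 := this
  · have := hP.phat_mul_le (a := 20) (k := 4) (by norm_num) (by norm_num)
    linear_combination this
  · have := hP.phat_mul_le (a := 80) (k := 7) (by norm_num) (by norm_num)
    linear_combination this
  · refine mul_le_mul_of_nonneg_right ?_ (Real.exp_pos _).le
    push_cast
    linarith

/-- A union bound: triples and hits cost Δ each, the kept edge mass 81 + 10Δ, and the other four
conditions 5 together. The total 12Δ + 86 is at most 13Δ. -/
theorem pr_not_good (hN : S.NearIndependent X P.θ P.ω₀) (hX : X.DegreesAtMost P.Δ P.Δ₂ P.δ)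
    {u : V} (hu : u ∈ S.U) :
    pr (S.law P.θ P.phat) (fun x => ¬ S.Good X list P i u x) ≤
      13 * P.Δ * Real.exp (-(10 * P.L)) := by
  have hw := hI.basic.isLaw
  set e₀ := Real.exp (-(10 * P.L)) with he₀
  have he : 0 < e₀ := Real.exp_pos _
  let A1 : Bits V K → Prop := fun x =>
    1 / P.L ^ 3 ≤ |∑ c, S.pn X P.θ P.phat u c x - ∑ c, S.p u c|
  let A2 : Bits V K → Prop := fun x => ∃ e ∈ S.triplesAt X u,
    P.ω / P.Δ * (1 + i / (1000 * P.T)) * (1 + 1 / P.ω₀) + P.te ≤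
      ∑ c, ∏ v ∈ e, S.pn X P.θ P.phat v c x
  let A3 : Bits V K → Prop := fun x => ∑ c, Real.negMulLog (S.pn X P.θ P.phat u c x) ≤
    ∑ c, Real.negMulLog (S.p u c) - 2 * ∑ c, S.p u c * S.ell X P.θ u c - 1 / P.L ^ 3
  let A4 : Bits V K → Prop := fun x => ∃ c ∈ list u,
    2 * P.Δ * P.θ * P.phat + P.grow ≤ S.hits X u c x
  let A5 : Bits V K → Prop := fun x => 2 * P.θ * ((1 - P.θ / 3) ^ i * P.Δ) *
      (P.ω / P.Δ * (1 + i / (1000 * P.T)) * (1 + 1 / P.ω₀)) + 1 / P.L ^ 3 ≤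
      ∑ c, S.newMass X P.θ P.phat u c x * ind (S.hits X u c x ≤ 2 * P.grow)
  let A6 : Bits V K → Prop := fun x => (1 - 55 / 100 * P.θ) *
      (8 * (1 - P.θ / 4) ^ i * P.ω * (1 + 1 / P.ω₀) + 1 / P.L ^ 3) + 1 / P.L ^ 3 ≤
      S.keptMass X P.θ P.phat u x
  let A7 : Bits V K → Prop := fun x => (1 - 55 / 100 * P.θ) * (S.triplesAt X u).card + P.ω₅ ≤
      S.keptTriples X u x
  have h1 : pr (S.law P.θ P.phat) A1 ≤ 2 * e₀ := hI.pr_mass hP hC hi hu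
  have h2 : pr (S.law P.θ P.phat) A2 ≤ P.Δ * e₀ := by
    refine (pr_exists hw _ _).trans ((Finset.sum_le_card_nsmul _ _ _ fun e he =>
      hI.pr_triple hP hC hi hN (mem_triplesAt.1 he).1).trans ?_)
    rw [nsmul_eq_mul]
    exact mul_le_mul_of_nonneg_right (card_triplesAt_le hX u) he.le
  have h3 : pr (S.law P.θ P.phat) A3 ≤ e₀ := hI.pr_entropy hP hC hi hu
  have h4 : pr (S.law P.θ P.phat) A4 ≤ P.Δ * e₀ := by
    refine (pr_exists hw _ _).trans ((Finset.sum_le_card_nsmul _ _ _ fun c _ =>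
      hI.pr_hits hP hC hi hX u c).trans ?_)
    rw [nsmul_eq_mul, hC]
    exact mul_le_mul_of_nonneg_right hP.C_le he.le
  have h5 : pr (S.law P.θ P.phat) A5 ≤ e₀ := hI.pr_newMass hP hC hi hN hu
  have h6 : pr (S.law P.θ P.phat) A6 ≤ (81 + 10 * P.Δ) * e₀ :=
    hI.pr_keptMass hP hC hi hN hX hu
  have h7 : pr (S.law P.θ P.phat) A7 ≤ e₀ := hI.pr_keptTriples hP hC hi hX u
  have hall : pr (S.law P.θ P.phat) (fun x => ¬ S.Good X list P i u x) ≤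
      pr (S.law P.θ P.phat) fun x => A1 x ∨ A2 x ∨ A3 x ∨ A4 x ∨ A5 x ∨ A6 x ∨ A7 x := by
    refine pr_mono hw fun x hx => ?_
    by_contra hcon
    push Not at hcon
    obtain ⟨g1, g2, g3, g4, g5, g6, g7⟩ := hcon
    refine hx ⟨not_le.1 g1, fun e he => not_le.1 fun h => g2 ⟨e, he, h⟩, not_le.1 g3,
      fun c hc => not_le.1 fun h => g4 ⟨c, hc, h⟩, not_le.1 g5, not_le.1 g6, not_le.1 g7⟩
  have hor := hall.trans ((pr_or hw).trans (add_le_add h1 ((pr_or hw).trans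
    (add_le_add h2 ((pr_or hw).trans (add_le_add h3 ((pr_or hw).trans
    (add_le_add h4 ((pr_or hw).trans (add_le_add h5 ((pr_or hw).trans
    (add_le_add h6 h7))))))))))))
  refine hor.trans ?_
  have hΔ := hP.Δ_ge
  have : 86 * e₀ ≤ P.Δ * e₀ := mul_le_mul_of_nonneg_right (by linarith) he.le
  linarith

theorem card_nearSet_biUnion_le (hX : X.DegreesAtMost P.Δ P.Δ₂ P.δ) (A : Finset V) :
    ((A.biUnion X.nearSet).card : ℝ) ≤ A.card * (5 * P.Δ) := by
  have h : ((A.biUnion X.nearSet).card : ℝ) ≤ ∑ v ∈ A, ((X.nearSet v).card : ℝ) := by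
    exact_mod_cast Finset.card_biUnion_le
  refine h.trans ((Finset.sum_le_card_nsmul _ _ _ fun v _ => hP.card_nearSet_le hX v).trans ?_)
  rw [nsmul_eq_mul]

/-- With positive probability the round is good everywhere. -/
theorem exists_good (hN : S.NearIndependent X P.θ P.ω₀) (hX : X.DegreesAtMost P.Δ P.Δ₂ P.δ) :
    ∃ x, 0 < weight (S.law P.θ P.phat) x ∧ ∀ u ∈ S.U, S.Good X list P i u x := by
  have hw := hI.basic.isLaw
  have hΔ := hP.Δ_ge
  have hΔ0 := hP.Δ_pos
  have hbad : ∀ u, pr (S.law P.θ P.phat) (fun x => u ∈ S.U ∧ ¬ S.Good X list P i u x) ≤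
      13 * P.Δ * Real.exp (-(10 * P.L)) := by
    intro u
    by_cases hu : u ∈ S.U
    · exact (pr_mono hw fun x hx => hx.2).trans (hI.pr_not_good hP hC hi hN hX hu)
    · have : pr (S.law P.θ P.phat) (fun x => u ∈ S.U ∧ ¬ S.Good X list P i u x) = 0 := by
        simp [pr, hu, ind, ex]
      rw [this]
      positivity
  -- The left side equals 8125/Δ⁵.
  have hsmall : (5 * P.Δ) ^ 4 * (13 * P.Δ * Real.exp (-(10 * P.L))) ≤ 1 / 4 := by
    rw [hP.exp_eq]
    have h1 : (5 * P.Δ) ^ 4 * (13 * P.Δ * (P.Δ ^ 10)⁻¹) = 8125 / P.Δ ^ 5 := by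
      field_simp
      norm_num
    rw [h1, div_le_iff₀ (by positivity)]
    have : P.Δ ≤ P.Δ ^ 5 := le_self_pow₀ (by linarith) (by norm_num)
    linarith
  suffices h : ∃ x, 0 < weight (S.law P.θ P.phat) x ∧
      ∀ u, ¬ (u ∈ S.U ∧ ¬ S.Good X list P i u x) by
    obtain ⟨x, hx, hg⟩ := h
    exact ⟨x, hx, fun u hu => not_not.1 fun h => hg u ⟨hu, h⟩⟩
  refine local_lemma hw (fun u x => u ∈ S.U ∧ ¬ S.Good X list P i u x)
    (fun u => {j | ∃ v, X.Near u v ∧ X.Near v (vert j)}) ?_ ?_ ?_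
  · intro u x y hxy
    exact congrArg (fun p => u ∈ S.U ∧ ¬ p) (Good.dependsOn hI.basic i u hxy)
  · intro u
    refine (hbad u).trans (le_trans ?_ hsmall)
    refine le_mul_of_one_le_left (by positivity) (one_le_pow₀ (by linarith))
  · intro u
    refine (Finset.sum_le_card_nsmul _ _ _ fun v _ => hbad v).trans (le_trans ?_ hsmall)
    rw [nsmul_eq_mul]
    refine mul_le_mul_of_nonneg_right ?_ (by positivity)
    -- Each bad event reaches two steps from its vertex, so two events share a bit only if their
    -- vertices are at most four steps apart; a vertex has at most 5Δ vertices within one step.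
    have hsub : (Finset.univ.filter fun l => ¬ Disjoint
        {j : (V × K) ⊕ (V × K) | ∃ v, X.Near u v ∧ X.Near v (vert j)}
        {j : (V × K) ⊕ (V × K) | ∃ v, X.Near l v ∧ X.Near v (vert j)}) ⊆
        (((X.nearSet u).biUnion X.nearSet).biUnion X.nearSet).biUnion X.nearSet := by
      intro l hl
      rw [Finset.mem_filter_univ, Set.not_disjoint_iff] at hl
      obtain ⟨j, ⟨v, h1, h2⟩, v', h3, h4⟩ := hl
      simp only [Finset.mem_biUnion, RankThree.mem_nearSet]
      exact ⟨v', ⟨vert j, ⟨v, h1, h2⟩, h4.symm⟩, h3.symm⟩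
    refine (Nat.cast_le.2 (Finset.card_le_card hsub)).trans ?_
    have h5 := hI.card_nearSet_biUnion_le hP hC hi hX
    have h6 : (0 : ℝ) ≤ 5 * P.Δ := by positivity
    calc _ ≤ _ := h5 _
      _ ≤ _ := mul_le_mul_of_nonneg_right (h5 _) h6
      _ ≤ _ := mul_le_mul_of_nonneg_right (mul_le_mul_of_nonneg_right (h5 _) h6) h6
      _ ≤ 5 * P.Δ * (5 * P.Δ) * (5 * P.Δ) * (5 * P.Δ) := by
        gcongr
        exact hP.card_nearSet_le hX u
      _ = (5 * P.Δ) ^ 4 := by ring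

end Inv

end State

end SemiRandom

/-! ### A good round preserves the invariant -/

namespace SemiRandom

open FinProb

variable {V K : Type*} [Fintype V] [Fintype K]

namespace State

variable {S : State V K} {X : RankThree V} {list : V → Finset K} {θ phat : ℝ} {P : Params}
  {pick : Rule V K} {i : ℕ}

/-- The state after a round, as a function of the random bits. -/
def next (S : State V K) (X : RankThree V) (θ phat : ℝ) (pick : Rule V K) (i : ℕ)
    (x : Bits V K) : State V K :=
  nextState X θ phat pick i S (gam x) (eta x)

theorem next_color_eq_none {u : V} {x : Bits V K} :
    (S.next X θ phat pick i x).color u = none ↔ S.color u = none ∧ S.Idle X u x := by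
  simp only [next, nextState, nextColor, Idle]
  cases h : S.color u with
  | some c => simp
  | none =>
    by_cases hc : (S.candidates X (gam x) u).Nonempty
    · obtain ⟨d, hd⟩ := hc
      have hn : (S.candidates X (gam x) u).Nonempty := ⟨d, hd⟩
      simp only [hn, if_true, true_and]
      exact iff_of_false (by simp) fun h => h d hd
    · simp only [hc, if_false, true_and, true_iff]
      exact fun d hd => hc ⟨d, hd⟩

theorem mem_next_U {u : V} {x : Bits V K} :
    u ∈ (S.next X θ phat pick i x).U ↔ u ∈ S.U ∧ S.Idle X u x :=
  next_color_eq_none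

/-- A vertex that receives a colour in a round receives one of its candidates. -/
theorem mem_candidates_of_next_color (hpick : pick.IsValid X) {u : V} {c : K} {x : Bits V K}
    (hu : u ∈ S.U) (h : (S.next X θ phat pick i x).color u = some c) :
    c ∈ S.candidates X (gam x) u := by
  have hu' : S.color u = none := hu
  simp only [next, nextState, nextColor, hu'] at h
  split_ifs at h with hc
  rw [← Option.some.inj h]
  exact hpick i S (gam x) u hc

theorem next_color_of_color {u : V} {c : K} {x : Bits V K} (h : S.color u = some c) :
    (S.next X θ phat pick i x).color u = some c := by
  simp only [next, nextState, nextColor, h]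

theorem next_p (u : V) (c : K) (x : Bits V K) :
    (S.next X θ phat pick i x).p u c = S.pn X θ phat u c x := rfl

theorem next_adj {u v : V} {c : K} {x : Bits V K} :
    ((S.next X θ phat pick i x).graph c).Adj u v ↔ u ≠ v ∧
      (S.next X θ phat pick i x).color u = none ∧ (S.next X θ phat pick i x).color v = none ∧
      ((S.graph c).Adj u v ∨ ∃ e ∈ S.triples X, u ∈ e ∧ v ∈ e ∧
        ∃ w ∈ e, (S.next X θ phat pick i x).color w = some c) := Iff.rfl

theorem mem_next_triples {e : Finset V} {x : Bits V K}
    (he : e ∈ (S.next X θ phat pick i x).triples X) :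
    e ∈ S.triples X ∧ ∀ v ∈ e, S.Idle X v x :=
  ⟨⟨he.1, fun v hv => (mem_next_U.1 (he.2 v hv)).1⟩, fun v hv => (mem_next_U.1 (he.2 v hv)).2⟩

theorem Basic.next (hS : S.Basic X list θ phat) (x : Bits V K) :
    (S.next X θ phat pick i x).Basic X list θ phat where
  θ_pos := hS.θ_pos
  phat_pos := hS.phat_pos
  θ_phat := hS.θ_phat
  p_nonneg u c := hS.pn_nonneg u c x
  p_le u c := hS.pn_le u c x
  p_supp u c h := hS.pn_eq_zero (hS.p_supp u c h) x
  mem_B _ _ := Iff.rfl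
  adj_U _ _ _ h := (next_adj.1 h).2.1
  adj_near c u v h := by
    obtain ⟨-, -, -, h | ⟨e, he, hu, hv, -⟩⟩ := next_adj.1 h
    · exact hS.adj_near _ _ _ h
    · exact Or.inr (Or.inr ⟨e, he.1, hu, hv⟩)

/-- A neighbour after the round is either an old one that stayed uncoloured or comes from a triple
uvw whose vertex w received c, and w can receive c only if it chose c. With a = 1 this bounds
degrees, with products of weights it bounds the edge mass. -/
theorem sum_next_nbrs_le (hpick : pick.IsValid X) (u : V) (c : K) (x : Bits V K) (a : V → ℝ)
    (ha : ∀ v, 0 ≤ a v) :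
    ∑ v ∈ (S.next X θ phat pick i x).nbrs c u, a v ≤
      ∑ v ∈ S.nbrs c u, a v * ind (S.Idle X v x) +
      ∑ e ∈ S.triplesAt X u, ∑ v ∈ e.erase u, ∑ w ∈ (e.erase u).erase v,
        ind (gam x w c = true) * a v := by
  have hr : ∀ e v, 0 ≤ ∑ w ∈ (Finset.erase e u).erase v, ind (gam x w c = true) * a v :=
    fun e v => Finset.sum_nonneg fun w _ => mul_nonneg (ind_nonneg _) (ha v)
  set r : Finset V → V → ℝ := fun e v => if v ∈ e.erase u then
    ∑ w ∈ (Finset.erase e u).erase v, ind (gam x w c = true) * a v else 0 with hrdef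
  have hr0 : ∀ e v, 0 ≤ r e v := fun e v => by
    simp only [hrdef]
    split_ifs
    · exact hr e v
    · exact le_rfl
  have hl0 : ∀ v, 0 ≤ if v ∈ S.nbrs c u then a v * ind (S.Idle X v x) else 0 := fun v => by
    split_ifs
    · exact mul_nonneg (ha v) (ind_nonneg _)
    · exact le_rfl
  have key : ∀ v ∈ (S.next X θ phat pick i x).nbrs c u, a v ≤
      (if v ∈ S.nbrs c u then a v * ind (S.Idle X v x) else 0) +
        ∑ e ∈ S.triplesAt X u, r e v := by
    intro v hv
    obtain ⟨huv, hu, hv', h | ⟨e, he, hue, hve, w, hwe, hw⟩⟩ := next_adj.1 (mem_nbrs.1 hv)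
    · rw [if_pos (mem_nbrs.2 h), ind_of_true (next_color_eq_none.1 hv').2, mul_one]
      exact le_add_of_nonneg_right (Finset.sum_nonneg fun e _ => hr0 e v)
    · refine le_add_of_nonneg_of_le (hl0 v) ?_
      refine le_trans ?_ (Finset.single_le_sum (f := fun e => r e v) (fun e _ => hr0 e v)
        (mem_triplesAt.2 ⟨he, hue⟩))
      have hwu : w ≠ u := by rintro rfl; simp [hu] at hw
      have hwv : w ≠ v := by rintro rfl; simp [hv'] at hw
      simp only [hrdef]
      rw [if_pos (Finset.mem_erase.2 ⟨huv.symm, hve⟩)]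
      refine le_trans ?_ (Finset.single_le_sum
        (f := fun w => ind (gam x w c = true) * a v)
        (fun w _ => mul_nonneg (ind_nonneg _) (ha v))
        (Finset.mem_erase.2 ⟨hwv, Finset.mem_erase.2 ⟨hwu, hwe⟩⟩))
      have := (mem_candidates_of_next_color hpick (he.2 w hwe) hw).2
      rw [ind_of_true this, one_mul]
  refine (Finset.sum_le_sum key).trans ((Finset.sum_le_univ_sum_of_nonneg fun v =>
    add_nonneg (hl0 v) (Finset.sum_nonneg fun e _ => hr0 e v)).trans_eq ?_)
  rw [Finset.sum_add_distrib, Finset.sum_ite_mem, Finset.univ_inter, Finset.sum_comm]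
  congr 1
  refine Finset.sum_congr rfl fun e _ => ?_
  simp only [hrdef]
  rw [Finset.sum_ite_mem, Finset.univ_inter]

/-- A round that is good everywhere preserves the invariant. -/
theorem Inv.next (hI : S.Inv X list P i) (hP : P.Num) (hC : ∀ u, (list u).card = P.C)
    (hi : i < P.T) (hpick : pick.IsValid X) {x : Bits V K}
    (hx : ∀ u ∈ S.U, S.Good X list P i u x) :
    (S.next X P.θ P.phat pick i x).Inv X list P (i + 1) := by
  have hS := hI.basic
  have hθ := hP.θ_pos
  have hθ1 := hP.θ_le
  have hτ := hP.tau_le_decay hi.le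
  have hω := hP.ω_pos
  have hω0 := hP.ω₀_pos
  have hΔ := hP.Δ_pos
  have hT := hP.T_cast_pos
  have hW : ∀ u ∈ (S.next X P.θ P.phat pick i x).U, u ∈ S.U := fun u hu => (mem_next_U.1 hu).1
  refine ⟨hS.next x, ?_, ?_, ?_, ?_, ?_, ?_⟩
  · intro u hu
    have h1 := hI.mass u (hW u hu)
    have h2 := (hx u (hW u hu)).mass
    simp only [next_p]
    push_cast
    have h3 := abs_sub_le (∑ c, S.pn X P.θ P.phat u c x) (∑ c, S.p u c) 1
    linarith
  · intro e he
    have he' := (mem_next_triples he).1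
    obtain ⟨u, hu⟩ : e.Nonempty := Finset.card_pos.1 (by rw [X.card_eq_three e he.1]; norm_num)
    have h1 := (hx u (he'.2 u hu)).triple e (mem_triplesAt.2 ⟨he', hu⟩)
    simp only [next_p]
    refine h1.le.trans ?_
    have h2 : (i : ℝ) / (1000 * P.T) ≤ 1 / 1000 := by
      have : (i : ℝ) ≤ P.T := Nat.cast_le.2 hi.le
      rw [div_le_div_iff₀ (by positivity) (by norm_num)]
      linarith
    have h3 : 1 / P.ω₀ ≤ 1 / (2100 * P.T) :=
      one_div_le_one_div_of_le (by positivity) hP.ω₀_ge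
    have h4 : P.te = P.ω / P.Δ * (1 / (2000 * P.T)) := by unfold Params.te; field_simp
    rw [h4, mul_assoc, ← mul_add]
    have h0 := div_pos hω hΔ
    refine mul_le_mul_of_nonneg_left ?_ h0.le
    have h5 : (1 + (i : ℝ) / (1000 * P.T)) * (1 / P.ω₀) ≤ (1 + 1 / 1000) * (1 / (2100 * P.T)) := by
      gcongr
    -- The factor 1 + 1/ω₀ and the deviation `te` each use about half of the relative growth
    -- 1/(1000T) allowed per round.
    have h6 : (1 + 1 / 1000 : ℝ) * (1 / (2100 * P.T)) + 1 / (2000 * P.T) ≤ 1 / (1000 * P.T) := by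
      have h7 : (0 : ℝ) < 1 / P.T := by positivity
      have e1 : 1 / (2100 * (P.T : ℝ)) = 1 / 2100 * (1 / P.T) := by field_simp
      have e2 : 1 / (2000 * (P.T : ℝ)) = 1 / 2000 * (1 / P.T) := by field_simp
      have e3 : 1 / (1000 * (P.T : ℝ)) = 1 / 1000 * (1 / P.T) := by field_simp
      rw [e1, e2, e3]
      linarith
    push_cast
    rw [add_div]
    linarith
  · intro u hu
    have hg := hx u (hW u hu)
    have hle : ∑ c, ∑ v ∈ (S.next X P.θ P.phat pick i x).nbrs c u,
        S.pn X P.θ P.phat u c x * S.pn X P.θ P.phat v c x ≤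
        S.keptMass X P.θ P.phat u x + ∑ c, S.newMass X P.θ P.phat u c x := by
      rw [keptMass, ← Finset.sum_add_distrib]
      exact Finset.sum_le_sum fun c _ => sum_next_nbrs_le hpick u c x _ fun v =>
        mul_nonneg (hS.pn_nonneg u c x) (hS.pn_nonneg v c x)
    -- The bound on the hits makes the truncation void for colours of the list; other colours have
    -- weight 0 at u.
    have hnew : ∑ c, S.newMass X P.θ P.phat u c x =
        ∑ c, S.newMass X P.θ P.phat u c x * ind (S.hits X u c x ≤ 2 * P.grow) := by
      refine Finset.sum_congr rfl fun c _ => ?_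
      by_cases hc : c ∈ list u
      · rw [ind_of_true, mul_one]
        have := hg.hits c hc
        have := hP.two_mul_le_grow
        linarith
      · have : S.newMass X P.θ P.phat u c x = 0 := by
          simp [newMass, hS.pn_eq_zero (hS.p_supp u c hc)]
        rw [this, zero_mul]
    have h1 := hg.keptMass
    have h2 := hg.newMass
    rw [← hnew] at h2
    simp only [next_p]
    refine hle.trans ((add_lt_add h1 h2).le.trans ?_)
    have hx0 := hP.pow_pos i
    have hyx := hP.pow_three_le i
    have hE := hI.E_le hP hC hi
    have hE' : (P.ω / P.Δ * (1 + i / (1000 * P.T)) * (1 + 1 / P.ω₀)) ≤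
        P.ω / P.Δ * (1002 / 1000) := by
      have h0 := div_pos hω hΔ
      have h2 : (i : ℝ) / (1000 * P.T) ≤ 1 / 1000 := by
        have : (i : ℝ) ≤ P.T := Nat.cast_le.2 hi.le
        rw [div_le_div_iff₀ (by positivity) (by norm_num)]
        linarith
      have h3 := hP.one_div_ω₀_le
      rw [mul_assoc]
      refine mul_le_mul_of_nonneg_left ?_ h0.le
      calc _ ≤ (1 + 1 / 1000 : ℝ) * (1 + 1 / 10 ^ 6) := by gcongr
        _ ≤ _ := by norm_num
    have h3 : 2 * P.θ * ((1 - P.θ / 3) ^ i * P.Δ) *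
        (P.ω / P.Δ * (1 + i / (1000 * P.T)) * (1 + 1 / P.ω₀)) ≤
        2004 / 1000 * (P.θ * ((1 - P.θ / 4) ^ i * P.ω)) := by
      calc _ ≤ 2 * P.θ * ((1 - P.θ / 4) ^ i * P.Δ) * (P.ω / P.Δ * (1002 / 1000)) := by gcongr
        _ = _ := by field_simp; ring
    -- In units of ε(1-θ/4)^i the old mass falls by 8 · 0.549 = 4.392, as 1/ω₀ ≤ θ/1000, and the new
    -- edges add 2.004. The target only asks for a fall by 8/4 = 2, and the surplus 0.388 absorbs
    -- the two deviations 1/L³.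
    have h4 : (1 - 55 / 100 * P.θ) * (8 * (1 - P.θ / 4) ^ i * P.ω * (1 + 1 / P.ω₀) +
        1 / P.L ^ 3) ≤ 8 * ((1 - P.θ / 4) ^ i * P.ω) -
          4392 / 1000 * (P.θ * ((1 - P.θ / 4) ^ i * P.ω)) + 1 / P.L ^ 3 := by
      set y := (1 - P.θ / 4) ^ i * P.ω with hy
      have hy0 : 0 < y := mul_pos hx0 hω
      have h5 : (1 - 55 / 100 * P.θ) * (1 + 1 / P.ω₀) ≤ 1 - 549 / 1000 * P.θ := by
        calc _ ≤ (1 - 55 / 100 * P.θ) * (1 + P.θ / 1000) := by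
              have := hP.ω₀_inv_le
              have : 0 ≤ 1 - 55 / 100 * P.θ := by linarith
              gcongr
          _ ≤ _ := by nlinarith
      have h6 := mul_le_mul_of_nonneg_right h5 (by positivity : 0 ≤ 8 * y)
      have h7 := mul_le_mul_of_nonneg_right (by linarith : 1 - 55 / 100 * P.θ ≤ 1) hP.tau_pos.le
      have h8 : (1 - 55 / 100 * P.θ) * (8 * (1 - P.θ / 4) ^ i * P.ω * (1 + 1 / P.ω₀) +
        1 / P.L ^ 3) = (1 - 55 / 100 * P.θ) * (1 + 1 / P.ω₀) * (8 * y) +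
          (1 - 55 / 100 * P.θ) * (1 / P.L ^ 3) := by rw [hy]; ring
      rw [h8]
      linarith
    have h5 : P.θ * ((1 - P.θ / 4) ^ i * P.ω) = P.ε * (1 - P.θ / 4) ^ i := by
      rw [← hP.θ_mul_ω]; ring
    have h6 : 8 * (1 - P.θ / 4) ^ (i + 1) * P.ω = 8 * ((1 - P.θ / 4) ^ i * P.ω) -
        2 * (P.θ * ((1 - P.θ / 4) ^ i * P.ω)) := by ring
    rw [h6]
    rw [h5] at h3 h4 ⊢
    have h7 := mul_pos hP.ε_pos hx0
    linarith
  · intro u hu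
    have hg := hx u (hW u hu)
    have h1 := hI.entropy u (hW u hu)
    have h2 := hg.entropy
    have h3 := hI.sum_p_mul_ell_le hP hC hi.le (hW u hu)
    have h4 := mul_pos hP.ε_pos (hP.pow_pos i)
    simp only [next_p]
    -- The loss of one round is 2 · 8.1 ε(1-θ/4)^i plus the deviation 1/L³, which stays below 19
    -- ε(1-θ/4)^i.
    rw [Finset.sum_range_succ, mul_add]
    linarith
  · intro u hu
    have hg := hx u (hW u hu)
    have h1 : (((S.next X P.θ P.phat pick i x).triplesAt X u).card : ℝ) ≤ S.keptTriples X u x := by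
      rw [keptTriples]
      have hsub : (S.next X P.θ P.phat pick i x).triplesAt X u ⊆
          (S.triplesAt X u).filter fun e => ∀ v ∈ e, S.Idle X v x := by
        intro e he
        have he' := mem_triplesAt.1 he
        have h := mem_next_triples he'.1
        exact Finset.mem_filter.2 ⟨mem_triplesAt.2 ⟨h.1, he'.2⟩, h.2⟩
      refine (Nat.cast_le.2 (Finset.card_le_card hsub)).trans_eq ?_
      rw [Finset.card_filter]
      push_cast
      refine Finset.sum_congr rfl fun e _ => ?_
      by_cases h : ∀ v ∈ e, S.Idle X v x
      · rw [if_pos h, ind_of_true h]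
      · rw [if_neg h, ind_of_false h]
    refine h1.trans (hg.keptTriples.le.trans ?_)
    have h2 := hI.degree u (hW u hu)
    have h3 := mul_le_mul_of_nonneg_left h2 (by linarith : 0 ≤ 1 - 55 / 100 * P.θ)
    -- The degree shrinks by 0.55θ and the deviation ω₅ gives back at most θ/6, so a decrease by θ/3
    -- remains.
    have h4 : P.ω₅ ≤ P.θ / 6 * (1 - P.θ / 3) ^ i * P.Δ := by
      refine hP.ω₅_le.trans ?_
      have := pow_le_pow_of_le_one (by linarith : 0 ≤ 1 - P.θ / 3) (by linarith) hi.le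
      gcongr
    have h5 := mul_pos (mul_pos hθ (hP.pow_three_pos i)) hΔ
    rw [pow_succ]
    linarith
  · intro u hu c hc
    have hg := hx u (hW u hu)
    have h1 := sum_next_nbrs_le (S := S) (θ := P.θ) (phat := P.phat) (i := i) hpick u c x
      (fun _ => 1) fun _ => zero_le_one
    rw [Finset.sum_const, nsmul_eq_mul, mul_one] at h1
    have h2 : ∑ v ∈ S.nbrs c u, 1 * ind (S.Idle X v x) ≤ ((S.nbrs c u).card : ℝ) := by
      refine (Finset.sum_le_card_nsmul _ _ 1 fun v _ => ?_).trans_eq (by simp)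
      rw [one_mul]
      exact ind_le_one _
    have h3 : ∑ e ∈ S.triplesAt X u, ∑ v ∈ e.erase u, ∑ w ∈ (e.erase u).erase v,
        ind (gam x w c = true) * 1 = S.hits X u c x := by
      rw [hits]
      refine Finset.sum_congr rfl fun e he => ?_
      simp only [mul_one]
      exact hS.sum_erase_erase he _
    rw [h3] at h1
    have h4 := hg.hits c hc
    have h5 := hI.colorDegree u (hW u hu) c hc
    have h6 := hP.two_mul_le_grow
    push_cast
    linarith

end State

end SemiRandom

/-! ### The initial state and properness of the partial colouring -/

namespace SemiRandom

open FinProb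

variable {V K : Type*} [Fintype V] [Fintype K]
variable {X : RankThree V} {list : V → Finset K} {P : Params}

theorem initial_p (u : V) (c : K) :
    (initial X list P.C).p u c = if c ∈ list u then 1 / (P.C : ℝ) else 0 := by
  simp only [initial]

/-- By R1 the logarithm of p̂C is positive. Hence the initial weights lie strictly below p̂,
consistently with the empty sets B. -/
theorem Params.Num.one_div_C_lt (hP : P.Num) : 1 / (P.C : ℝ) < P.phat := by
  have hC := hP.C_cast_pos
  have h1 : 0 < Real.log (P.phat * P.C) := lt_of_lt_of_le (by have := hP.θ_pos; positivity) hP.log_ge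
  have h2 := (Real.log_pos_iff (mul_nonneg hP.phat_pos.le hC.le)).1 h1
  rwa [div_lt_iff₀ hC]

/-- With uniform weights 1/C a triple has mass at most 1/C² ≤ ω/Δ, the edges at a vertex at most
Δ₂/C ≤ ω, and the entropy is exactly log C. -/
theorem initial_inv (hP : P.Num) (hC : ∀ u, (list u).card = P.C)
    (hX : X.DegreesAtMost P.Δ P.Δ₂ P.δ) : (initial X list P.C).Inv X list P 0 := by
  have hC0 := hP.C_cast_pos
  have hlt := hP.one_div_C_lt
  have hω := hP.ω_pos
  have hΔ := hP.Δ_pos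
  have hinv : (0 : ℝ) < 1 / P.C := by positivity
  have hp0 : ∀ u c, 0 ≤ (initial X list P.C).p u c := by
    intro u c
    rw [initial_p]
    split_ifs <;> positivity
  have hp1 : ∀ u c, (initial X list P.C).p u c ≤ 1 / P.C := by
    intro u c
    rw [initial_p]
    split_ifs
    · exact le_rfl
    · exact hinv.le
  have hoff : ∀ u c, c ∉ list u → (initial X list P.C).p u c = 0 := by
    intro u c h
    rw [initial_p, if_neg h]
  have hU : ∀ u, u ∈ (initial X list P.C).U := fun _ => rfl
  have hsum : ∀ (u : V) (f : K → ℝ) (a : ℝ), (∀ c ∈ list u, f c ≤ a) → (∀ c ∉ list u, f c = 0) →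
      ∑ c, f c ≤ P.C * a := by
    intro u f a h1 h2
    rw [← Finset.sum_subset (Finset.subset_univ (list u)) fun c _ h => h2 c h]
    refine (Finset.sum_le_card_nsmul _ _ a h1).trans_eq ?_
    rw [nsmul_eq_mul, hC]
  have hnbrs : ∀ u c, (((initial X list P.C).nbrs c u).card : ℝ) ≤ P.Δ₂ := by
    intro u c
    refine le_trans ?_ (hX.degree_two u)
    rw [← Set.ncard_coe_finset]
    refine Nat.cast_le.2 (Set.ncard_le_ncard (fun v hv => ?_) (Set.toFinite _))
    exact State.mem_nbrs.1 (Finset.mem_coe.1 hv)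
  refine ⟨⟨hP.θ_pos, hP.phat_pos, ?_, hp0, fun u c => (hp1 u c).trans hlt.le, hoff, ?_, ?_, ?_⟩,
    ?_, ?_, ?_, ?_, ?_, ?_⟩
  · have := hP.θ_le
    have := hP.phat_le_one
    have := hP.phat_pos
    nlinarith
  · intro u c
    refine iff_of_false (fun h => h) fun h => ?_
    have := hp1 u c
    linarith
  · exact fun _ _ _ _ => rfl
  · exact fun _ _ _ h => Or.inr (Or.inl h)
  · intro u _
    have : ∑ c, (initial X list P.C).p u c = 1 := by
      simp_rw [initial_p]
      rw [Finset.sum_ite_mem, Finset.univ_inter, Finset.sum_const, hC, nsmul_eq_mul,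
        mul_one_div_cancel hC0.ne']
    simp [this]
  · intro e he
    have h3 := X.card_eq_three e he.1
    obtain ⟨u, hu⟩ : e.Nonempty := Finset.card_pos.1 (by rw [h3]; norm_num)
    refine (hsum u _ ((1 / P.C) ^ 3) (fun c _ => ?_) fun c hc =>
      Finset.prod_eq_zero hu (hoff u c hc)).trans ?_
    · refine (Finset.prod_le_prod (fun v _ => hp0 v c) fun v _ => hp1 v c).trans_eq ?_
      rw [Finset.prod_const, h3]
    · have h4 := hP.Δ_le_C_sq
      have h5 : (P.C : ℝ) * (1 / P.C) ^ 3 = 1 / (P.C : ℝ) ^ 2 := by field_simp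
      have h6 : P.ω / P.Δ * (1 + (0 : ℕ) / (1000 * P.T)) = P.ω / P.Δ := by simp
      rw [h5, h6, div_le_div_iff₀ (by positivity) hΔ]
      linarith
  · intro u _
    have h1 := hP.Δ₂_le_C
    refine (hsum u _ (1 / P.C * (1 / P.C) * P.Δ₂) (fun c _ => ?_) fun c hc => ?_).trans ?_
    · refine (Finset.sum_le_card_nsmul _ _ (1 / P.C * (1 / P.C) : ℝ) fun v _ =>
        mul_le_mul (hp1 u c) (hp1 v c) (hp0 v c) hinv.le).trans ?_
      rw [nsmul_eq_mul, mul_comm]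
      exact mul_le_mul_of_nonneg_left (hnbrs u c) (by positivity)
    · simp [hoff u c hc]
    · have h2 : (P.C : ℝ) * (1 / P.C * (1 / P.C) * P.Δ₂) = P.Δ₂ / P.C := by field_simp
      rw [h2, div_le_iff₀ hC0, pow_zero]
      nlinarith
  · intro u _
    have h1 : ∀ c, Real.negMulLog ((initial X list P.C).p u c) =
        if c ∈ list u then 1 / (P.C : ℝ) * Real.log P.C else 0 := by
      intro c
      rw [initial_p]
      split_ifs
      · rw [Real.negMulLog, one_div, Real.log_inv]
        ring
      · simp
    simp_rw [h1]
    rw [Finset.sum_ite_mem, Finset.univ_inter, Finset.sum_const, hC, nsmul_eq_mul, ← mul_assoc,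
      mul_one_div_cancel hC0.ne']
    simp
  · intro u _
    simpa using State.card_triplesAt_le hX u
  · intro u _ c _
    simpa using (hnbrs u c).trans hP.Δ₂_le_grow

namespace State

variable {S : State V K} {pick : Rule V K}

/-- The partial colouring is proper, and the colours that would violate an edge at an uncoloured
vertex are never used there. -/
structure Proper (S : State V K) (X : RankThree V) (list : V → Finset K) (phat : ℝ) : Prop where
  mem_list : ∀ u c, S.color u = some c → c ∈ list u
  three : ∀ e ∈ X.H, ∀ c, ∃ u ∈ e, S.color u ≠ some c
  two : ∀ u v c, X.G.Adj u v → S.color u = some c → S.color v ≠ some c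
  dead_two : ∀ u v c, X.G.Adj u v → S.color u = none → S.color v = some c →
    S.p u c = 0 ∨ S.p u c = phat
  dead_three : ∀ e ∈ X.H, ∀ u ∈ e, ∀ c, S.color u = none →
    (∀ v ∈ e, v ≠ u → S.color v = some c) → S.p u c = 0 ∨ S.p u c = phat
  adj_two : ∀ u v c, X.G.Adj u v → S.color u = none → S.color v = none → (S.graph c).Adj u v
  adj_three : ∀ e ∈ X.H, ∀ u ∈ e, ∀ v ∈ e, ∀ w ∈ e, ∀ c, u ≠ v → S.color u = none →
    S.color v = none → S.color w = some c → (S.graph c).Adj u v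

theorem initial_proper (C : ℕ) (phat : ℝ) : (initial X list C).Proper X list phat := by
  have hne : ∀ e ∈ X.H, e.Nonempty := fun e he =>
    Finset.card_pos.1 (by rw [X.card_eq_three e he]; norm_num)
  refine ⟨by simp [initial], fun e he c => ?_, by simp [initial], by simp [initial], ?_,
    fun _ _ _ h _ _ => h, by simp [initial]⟩
  · obtain ⟨u, hu⟩ := hne e he
    exact ⟨u, hu, by simp [initial]⟩
  · intro e he u hu c _ h
    obtain ⟨v, hv, hvu⟩ := Finset.exists_mem_ne (by rw [X.card_eq_three e he]; norm_num) u
    simpa [initial] using h v hv hvu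

/-- Suppose that every vertex `v` of a triple has colour `c` or belongs to a set `A` of uncoloured
vertices, with `u` in `A`. Then `c` is dead at `u`, or `A` contains a neighbour of `u` in the graph
of the colour `c`, or the whole triple is uncoloured and contained in `A`. -/
theorem Proper.dead_or_adj {phat : ℝ} (hR : S.Proper X list phat) {e : Finset V} (he : e ∈ X.H)
    {u : V} (hu : u ∈ e) {c : K} (hu' : S.color u = none) (A : V → Prop)
    (h : ∀ v ∈ e, v ≠ u → S.color v = some c ∨ S.color v = none ∧ A v) :
    (S.p u c = 0 ∨ S.p u c = phat) ∨ (∃ v, (S.graph c).Adj u v ∧ A v) ∨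
      (e ∈ S.triples X ∧ ∀ v ∈ e, v ≠ u → A v) := by
  by_cases hold : ∀ v ∈ e, v ≠ u → S.color v = some c
  · exact Or.inl (hR.dead_three e he u hu c hu' hold)
  push Not at hold
  obtain ⟨v, hv, hvu, hvc⟩ := hold
  obtain ⟨hvn, hvA⟩ := (h v hv hvu).resolve_left hvc
  by_cases hw : ∃ w ∈ e, S.color w = some c
  · obtain ⟨w, hw, hwc⟩ := hw
    exact Or.inr (Or.inl ⟨v, hR.adj_three e he u hu v hv w hw c hvu.symm hu' hvn hwc, hvA⟩)
  · push Not at hw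
    have h' : ∀ v ∈ e, v ≠ u → S.color v = none ∧ A v := fun v hv hvu =>
      (h v hv hvu).resolve_left (hw v hv)
    refine Or.inr (Or.inr ⟨⟨he, fun v hv => ?_⟩, fun v hv hvu => (h' v hv hvu).2⟩)
    by_cases hvu : v = u
    · exact hvu ▸ hu'
    · exact (h' v hv hvu).1

/-- A colour of weight 0 is chosen with probability 0, so it is not chosen in an outcome of positive
weight. -/
theorem p_ne_zero_of_gam {θ phat : ℝ} {x : Bits V K}
    (hx : 0 < weight (S.law θ phat) x) {u : V} {c : K} (h : gam x u c = true) : S.p u c ≠ 0 := by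
  intro h0
  refine hx.ne' (Finset.prod_eq_zero (Finset.mem_univ (Sum.inl (u, c))) ?_)
  have h' : x (Sum.inl (u, c)) = true := h
  simp [law, bern, h', h0]

/-- A colour received in this round is neither lost nor of weight 0 or p̂ at its vertex. If all
other vertices of an edge have colour c after the round, then c was already dead at the remaining
vertex or is lost there now, since the colour graphs remember the triples that became edges. So the
remaining vertex cannot receive c, and if it stays uncoloured, c is dead there afterwards. -/
theorem Proper.next {θ phat : ℝ} {i : ℕ} (hR : S.Proper X list phat)
    (hS : S.Basic X list θ phat) (hpick : pick.IsValid X) {x : Bits V K}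
    (hx : 0 < weight (S.law θ phat) x) : (S.next X θ phat pick i x).Proper X list phat := by
  set S' := S.next X θ phat pick i x with hS'
  have hnew : ∀ u c, S'.color u = some c → S.color u = none →
      gam x u c = true ∧ c ∉ S.lost X (gam x) u ∧ S.p u c ≠ 0 ∧ S.p u c ≠ phat := by
    intro u c h hu
    have h1 := mem_candidates_of_next_color hpick hu h
    exact ⟨h1.2, h1.1.2, p_ne_zero_of_gam hx h1.2, fun h2 => h1.1.1 ((hS.mem_B u c).2 h2)⟩
  have hsplit : ∀ u c, S'.color u = some c →
      S.color u = some c ∨ S.color u = none ∧ gam x u c = true := by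
    intro u c h
    cases hu : S.color u with
    | some d =>
      rw [hS', next_color_of_color hu] at h
      exact Or.inl h
    | none => exact Or.inr ⟨rfl, (hnew u c h hu).1⟩
  have hnone : ∀ u, S'.color u = none → S.color u = none := fun u h =>
    (next_color_eq_none.1 h).1
  have hdead : ∀ u c, (S.p u c = 0 ∨ S.p u c = phat) → S'.p u c = 0 ∨ S'.p u c = phat := by
    rintro u c (h | h)
    · exact Or.inl (hS.pn_eq_zero h x)
    · exact hS.pn_eq_of_eq_phat h x
  have htriple : ∀ e ∈ X.H, ∀ u ∈ e, ∀ c, S.color u = none →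
      (∀ v ∈ e, v ≠ u → S'.color v = some c) →
      (S.p u c = 0 ∨ S.p u c = phat) ∨ c ∈ S.lost X (gam x) u := by
    intro e he u hu c hun h
    rcases hR.dead_or_adj he hu hun (fun v => gam x v c = true)
      fun v hv hvu => hsplit v c (h v hv hvu) with h | ⟨v, hv, hg⟩ | ⟨h1, h2⟩
    · exact Or.inl h
    · exact Or.inr (Or.inr ⟨v, hv, hg⟩)
    · exact Or.inr (Or.inl ⟨e, h1, hu, h2⟩)
  have hpair : ∀ u v c, X.G.Adj u v → S.color u = none → S'.color v = some c →
      (S.p u c = 0 ∨ S.p u c = phat) ∨ c ∈ S.lost X (gam x) u := by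
    intro u v c huv hu hv
    rcases hsplit v c hv with h | ⟨h, hg⟩
    · exact Or.inl (hR.dead_two u v c huv hu h)
    · exact Or.inr (Or.inr ⟨v, hR.adj_two u v c huv hu h, hg⟩)
  have hcontra : ∀ u c, S'.color u = some c → S.color u = none →
      ¬ ((S.p u c = 0 ∨ S.p u c = phat) ∨ c ∈ S.lost X (gam x) u) := by
    intro u c h hu
    obtain ⟨-, h1, h2, h3⟩ := hnew u c h hu
    tauto
  refine ⟨?_, ?_, ?_, ?_, ?_, ?_, ?_⟩
  · intro u c h
    cases hu : S.color u with
    | some d =>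
      rw [hS', next_color_of_color hu] at h
      exact hR.mem_list u c (hu.trans h)
    | none =>
      by_contra hc
      exact (hnew u c h hu).2.2.1 (hS.p_supp u c hc)
  · intro e he c
    by_contra hcon
    push Not at hcon
    obtain ⟨u, hu, hne⟩ := hR.three e he c
    have hun := (hsplit u c (hcon u hu)).resolve_left hne
    exact hcontra u c (hcon u hu) hun.1 (htriple e he u hu c hun.1 fun v hv _ => hcon v hv)
  · intro u v c huv hu hv
    rcases hsplit u c hu with h | ⟨h, -⟩
    · rcases hsplit v c hv with h' | ⟨h', -⟩
      · exact hR.two u v c huv h h'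
      · exact hcontra v c hv h' (hpair v u c huv.symm h' hu)
    · exact hcontra u c hu h (hpair u v c huv h hv)
  · intro u v c huv hu hv
    rcases hpair u v c huv (hnone u hu) hv with h | h
    · exact hdead u c h
    · exact hS.pn_eq_zero_of_lost h
  · intro e he u hu c hun h
    rcases htriple e he u hu c (hnone u hun) h with h | h
    · exact hdead u c h
    · exact hS.pn_eq_zero_of_lost h
  · intro u v c huv hu hv
    exact next_adj.2 ⟨huv.ne, hu, hv, Or.inl (hR.adj_two u v c huv (hnone u hu) (hnone v hv))⟩
  · intro e he u hu v hv w hw c huv hun hvn hwc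
    refine next_adj.2 ⟨huv, hun, hvn, ?_⟩
    rcases hsplit w c hwc with h | ⟨h, -⟩
    · exact Or.inl (hR.adj_three e he u hu v hv w hw c huv (hnone u hun) (hnone v hvn) h)
    · refine Or.inr ⟨e, ⟨he, ?_⟩, hu, hv, w, hw, hwc⟩
      have hwu : w ≠ u := by rintro rfl; simp [hun] at hwc
      have hwv : w ≠ v := by rintro rfl; simp [hvn] at hwc
      have hsub : ({u, v, w} : Finset V) ⊆ e := by
        intro z hz
        simp only [Finset.mem_insert, Finset.mem_singleton] at hz
        rcases hz with rfl | rfl | rfl <;> assumption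
      -- The triple is exactly {u, v, w}, so all of it was uncoloured before the round and
      -- `nextGraph` joins u and v in colour c.
      have heq := Finset.eq_of_subset_of_card_le hsub (by
        rw [X.card_eq_three e he, Finset.card_eq_three.2 ⟨u, v, w, huv, hwu.symm, hwv.symm, rfl⟩])
      intro z hz
      rw [← heq] at hz
      simp only [Finset.mem_insert, Finset.mem_singleton] at hz
      rcases hz with rfl | rfl | rfl
      · exact hnone _ hun
      · exact hnone _ hvn
      · exact h

end State

/-- After every round some state that is as expected has positive probability. -/
theorem exists_state (hP : P.Num) (hC : ∀ u, (list u).card = P.C)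
    (hX : X.DegreesAtMost P.Δ P.Δ₂ P.δ) {pick : Rule V K} (hpick : pick.IsValid X)
    (hN : ∀ i < P.T, ∀ S ∈ (run X list P.C P.θ P.phat pick i).support,
      S.NearIndependent X P.θ P.ω₀) {i : ℕ} (hi : i ≤ P.T) :
    ∃ S ∈ (run X list P.C P.θ P.phat pick i).support,
      S.Inv X list P i ∧ S.Proper X list P.phat := by
  induction i with
  | zero =>
    exact ⟨_, by simp [run], initial_inv hP hC hX, State.initial_proper _ _⟩
  | succ i ih =>
    obtain ⟨S, hS, hI, hR⟩ := ih (by omega)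
    -- Near-independence is available because S itself is reached with positive probability.
    obtain ⟨x, hx, hg⟩ := hI.exists_good hP hC hi (hN i hi S hS) hX
    obtain ⟨h1, h2⟩ := hI.basic.mem_support hx
    refine ⟨S.next X P.θ P.phat pick i x, ?_, hI.next hP hC hi hpick hg, hR.next hI.basic hpick hx⟩
    rw [run, PMF.mem_support_bind_iff]
    refine ⟨S, hS, ?_⟩
    rw [PMF.mem_support_bind_iff]
    refine ⟨gam x, h1, ?_⟩
    rw [PMF.mem_support_map_iff]
    exact ⟨eta x, h2, rfl⟩

end SemiRandom

/-! ### The final step -/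

namespace SemiRandom

open FinProb

variable {V K : Type*} [Fintype V] [Fintype K]

namespace State

variable {S : State V K} {X : RankThree V} {list : V → Finset K} {P : Params}

/-- The law of the final choices. -/
def finalLaw (S : State V K) (list : V → Finset K) (u : V) (o : Option K) : ℝ :=
  (finalChoice list S u o).toReal

theorem finalLaw_isLaw : IsLaw (S.finalLaw list) where
  nonneg _ _ := ENNReal.toReal_nonneg
  sum_eq_one u := by
    have h := (finalChoice list S u).tsum_coe
    rw [tsum_fintype] at h
    simp only [finalLaw]
    rw [← ENNReal.toReal_sum fun o _ => PMF.apply_ne_top _ o, h, ENNReal.toReal_one]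

theorem Basic.toReal_finalMass {θ phat : ℝ} (hS : S.Basic X list θ phat) (u : V) (c : K) :
    (finalMass list S u (some c)).toReal = S.p u c * ind (c ∉ S.B u) := by
  simp only [finalMass]
  by_cases hB : c ∈ S.B u
  · simp [hB, ind]
  · by_cases hc : c ∈ list u
    · simp [hB, hc, ind, ENNReal.toReal_ofReal (hS.p_nonneg u c)]
    · simp [hc, hS.p_supp u c hc]

theorem Basic.toReal_sum_finalMass {θ phat : ℝ} (hS : S.Basic X list θ phat) (u : V) :
    (∑' o, finalMass list S u o).toReal = ∑ c, S.p u c * ind (c ∉ S.B u) := by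
  rw [tsum_fintype, ENNReal.toReal_sum fun o _ =>
    ne_top_of_le_ne_top (finalMass_tsum_ne_top list S u) (ENNReal.le_tsum o),
    Fintype.sum_option]
  simp only [hS.toReal_finalMass]
  simp [finalMass]

variable {i : ℕ} (hI : S.Inv X list P i) (hP : P.Num) (hC : ∀ u, (list u).card = P.C)
include hI hP hC

theorem Inv.mass_outside_B (hi : i ≤ P.T) {u : V} (hu : u ∈ S.U) :
    9 / 10 ≤ ∑ c, S.p u c * ind (c ∉ S.B u) := by
  have h1 := hI.sum_B_le hP hC hi hu
  have h2 := (abs_le.1 (hI.mass_le hP hC hi hu)).1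
  have h3 := hP.one_div_L_le
  have h4 := hP.ε_le
  have h5 : ∑ c, S.p u c * ind (c ∉ S.B u) = ∑ c, S.p u c - ∑ c, S.p u c * ind (c ∈ S.B u) := by
    rw [← Finset.sum_sub_distrib]
    refine Finset.sum_congr rfl fun c _ => ?_
    rw [ind_not]
    ring
  linarith

theorem Inv.finalLaw_some (hi : i ≤ P.T) {u : V} (hu : u ∈ S.U) (c : K) :
    S.finalLaw list u (some c) =
      S.p u c * ind (c ∉ S.B u) / ∑ c, S.p u c * ind (c ∉ S.B u) := by
  have h1 := hI.mass_outside_B hP hC hi hu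
  have hu' : S.color u = none := hu
  have h2 := hI.basic.toReal_sum_finalMass u
  have h3 : ∑' o, finalMass list S u o ≠ 0 := by
    intro h
    rw [h, ENNReal.toReal_zero] at h2
    linarith
  simp only [finalLaw, finalChoice, hu', dif_pos h3, PMF.normalize_apply]
  rw [ENNReal.toReal_mul, ENNReal.toReal_inv, h2, hI.basic.toReal_finalMass, div_eq_mul_inv]

theorem Inv.finalLaw_none (hi : i ≤ P.T) {u : V} (hu : u ∈ S.U) : S.finalLaw list u none = 0 := by
  have h1 := hI.mass_outside_B hP hC hi hu
  have hu' : S.color u = none := hu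
  have h2 := hI.basic.toReal_sum_finalMass u
  have h3 : ∑' o, finalMass list S u o ≠ 0 := by
    intro h
    rw [h, ENNReal.toReal_zero] at h2
    linarith
  simp only [finalLaw, finalChoice, hu', dif_pos h3, PMF.normalize_apply]
  simp [finalMass]

/-- The normalising weight outside B(u) is at least 9/10, so the final law exceeds the weights by a
factor of at most 10/9. -/
theorem Inv.finalLaw_some_le (hi : i ≤ P.T) {u : V} (hu : u ∈ S.U) (c : K) :
    S.finalLaw list u (some c) ≤ 10 / 9 * S.p u c := by
  have h1 := hI.mass_outside_B hP hC hi hu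
  have h2 := hI.basic.p_nonneg u c
  rw [hI.finalLaw_some hP hC hi hu, div_le_iff₀ (by linarith)]
  have h3 : S.p u c * ind (c ∉ S.B u) ≤ S.p u c := mul_le_of_le_one_right h2 (ind_le_one _)
  nlinarith

omit hC hP hI in
theorem pr_forall_some (e : Finset V) (c : K) :
    pr (S.finalLaw list) (fun x => ∀ u ∈ e, x u = some c) =
      ∏ u ∈ e, S.finalLaw list u (some c) := by
  simp only [pr, ind_ball]
  rw [ex_prod finalLaw_isLaw e (fun u x => ind (x u = some c)) fun u => {u}]
  · refine Finset.prod_congr rfl fun u _ => ?_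
    rw [ex_coord finalLaw_isLaw u fun o => ind (o = some c)]
    simp [ind]
  · intro v _ v' _ h
    simpa using h
  · intro v _ x y h
    simp only [h v rfl]

/-- The conflicts that the final step has to avoid: monochromatic triples, and edges of a colour
graph whose ends both receive this colour. -/
def conflict (S : State V K) (X : RankThree V) :
    Finset V ⊕ (V × V × K) → (V → Option K) → Prop
  | Sum.inl e, x => e ∈ S.triples X ∧ ∃ c ∈ (Finset.univ : Finset K), ∀ u ∈ e, x u = some c
  | Sum.inr t, x => (S.graph t.2.2).Adj t.1 t.2.1 ∧
      ∀ u ∈ ({t.1, t.2.1} : Finset V), x u = some t.2.2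

/-- The vertices on which a conflict depends. -/
def conflictSet (S : State V K) (X : RankThree V) : Finset V ⊕ (V × V × K) → Finset V
  | Sum.inl e => if e ∈ S.triples X then e else ∅
  | Sum.inr t => if (S.graph t.2.2).Adj t.1 t.2.1 then {t.1, t.2.1} else ∅

omit hC hP hI in
theorem conflict_dependsOn (k : Finset V ⊕ (V × V × K)) :
    DependsOn (S.conflict X k) (S.conflictSet X k : Set V) := by
  intro x y h
  cases k with
  | inl e =>
    simp only [conflict, conflictSet] at h ⊢
    by_cases he : e ∈ S.triples X
    · rw [if_pos he] at h
      refine congrArg _ (propext (exists_congr fun c => and_congr_right fun _ =>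
        forall₂_congr fun u hu => ?_))
      rw [h u hu]
    · simp [he]
  | inr t =>
    simp only [conflict, conflictSet] at h ⊢
    by_cases he : (S.graph t.2.2).Adj t.1 t.2.1
    · rw [if_pos he] at h
      refine congrArg _ (propext (forall₂_congr fun u hu => ?_))
      rw [h u hu]
    · simp [he]

omit hC hP hI in
theorem card_conflictSet_le (k : Finset V ⊕ (V × V × K)) : (S.conflictSet X k).card ≤ 3 := by
  cases k with
  | inl e =>
    simp only [conflictSet]
    split_ifs with h
    · exact (X.card_eq_three e h.1).le
    · simp
  | inr t =>
    simp only [conflictSet]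
    split_ifs with h
    · exact Finset.card_le_two.trans (by norm_num)
    · simp

omit hC hP hI in
theorem pr_conflict_of_empty {k : Finset V ⊕ (V × V × K)} (h : S.conflictSet X k = ∅) :
    pr (S.finalLaw list) (S.conflict X k) = 0 := by
  have h0 : ∀ x, ¬ S.conflict X k x := by
    intro x hx
    cases k with
    | inl e =>
      simp only [conflictSet, if_pos hx.1] at h
      have := X.card_eq_three e hx.1.1
      simp [h] at this
    | inr t =>
      simp only [conflictSet, if_pos hx.1] at h
      simp at h
  simp [pr, ind, h0, ex]

/-- Triples at u contribute at most (1-θ/3)^i Δ · 1.4 ω/Δ, where 1.4 bounds (10/9)³ times 1.001.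
Edges contribute (10/9)² times twice the edge mass, as each edge is indexed in both orders. Both are
tiny once (1-θ/3)^i ω and (1-θ/4)^i ω are at most 1/1000. -/
theorem Inv.sum_conflict_le (hi : i ≤ P.T)
    (h3 : (1 - P.θ / 3) ^ i * P.ω ≤ 1 / 1000) (h4 : (1 - P.θ / 4) ^ i * P.ω ≤ 1 / 1000) (u : V) :
    ∑ k ∈ Finset.univ.filter (fun k => u ∈ S.conflictSet X k),
      pr (S.finalLaw list) (S.conflict X k) ≤ 1 / 12 := by
  have hw := S.finalLaw_isLaw (list := list)
  have hS := hI.basic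
  have hω := hP.ω_pos
  have hΔ := hP.Δ_pos
  have hnn : ∀ k, 0 ≤ pr (S.finalLaw list) (S.conflict X k) := fun k => pr_nonneg hw _
  by_cases hu : u ∈ S.U
  swap
  · rw [Finset.sum_eq_zero]
    · norm_num
    · intro k hk
      rw [Finset.mem_filter_univ] at hk
      exfalso
      cases k with
      | inl e =>
        simp only [conflictSet] at hk
        split_ifs at hk with h
        · exact hu (h.2 u hk)
        · simp at hk
      | inr t =>
        simp only [conflictSet] at hk
        split_ifs at hk with h
        · simp only [Finset.mem_insert, Finset.mem_singleton] at hk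
          rcases hk with rfl | rfl
          · exact hu (hS.adj_U _ _ _ h)
          · exact hu (hS.adj_U _ _ _ h.symm)
        · simp at hk
  rw [Finset.sum_filter, Fintype.sum_sum_type]
  have ht : ∑ e : Finset V, (if u ∈ S.conflictSet X (Sum.inl e) then
      pr (S.finalLaw list) (S.conflict X (Sum.inl e)) else 0) ≤ 2 / 1000 := by
    have h1 : ∀ e : Finset V, (if u ∈ S.conflictSet X (Sum.inl e) then
      pr (S.finalLaw list) (S.conflict X (Sum.inl e)) else 0) ≤
        if e ∈ S.triplesAt X u then 14 / 10 * (P.ω / P.Δ) else 0 := by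
      intro e
      by_cases he : e ∈ S.triplesAt X u
      · rw [if_pos he]
        have he' := mem_triplesAt.1 he
        have h2 : pr (S.finalLaw list) (S.conflict X (Sum.inl e)) ≤ 14 / 10 * (P.ω / P.Δ) := by
          have h5 : pr (S.finalLaw list) (S.conflict X (Sum.inl e)) ≤
              pr (S.finalLaw list) fun x =>
                ∃ c ∈ (Finset.univ : Finset K), ∀ u ∈ e, x u = some c :=
            pr_mono hw fun x hx => hx.2
          refine h5.trans ((pr_exists hw _ _).trans ?_)
          have h6 : ∀ c ∈ (Finset.univ : Finset K),
              pr (S.finalLaw list) (fun x => ∀ u ∈ e, x u = some c) ≤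
                (10 / 9) ^ 3 * ∏ v ∈ e, S.p v c := by
            intro c _
            rw [pr_forall_some, ← X.card_eq_three e he'.1.1, ← Finset.prod_const,
              ← Finset.prod_mul_distrib]
            exact Finset.prod_le_prod (fun v _ => hw.nonneg v _) fun v hv =>
              hI.finalLaw_some_le hP hC hi (he'.1.2 v hv) c
          refine (Finset.sum_le_sum h6).trans ?_
          rw [← Finset.mul_sum]
          have h7 := hI.triple_le hP hC hi he'.1
          have h8 := div_pos hω hΔ
          linarith
        split_ifs
        · exact h2
        · exact (hnn _).trans h2
      · rw [if_neg he, if_neg]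
        simp only [conflictSet]
        split_ifs with h
        · exact fun hu => he (mem_triplesAt.2 ⟨h, hu⟩)
        · simp
    refine (Finset.sum_le_sum fun e _ => h1 e).trans ?_
    rw [Finset.sum_ite_mem, Finset.univ_inter, Finset.sum_const, nsmul_eq_mul]
    have h5 := hI.degree u hu
    calc _ ≤ (1 - P.θ / 3) ^ i * P.Δ * (14 / 10 * (P.ω / P.Δ)) := by gcongr
      _ = 14 / 10 * ((1 - P.θ / 3) ^ i * P.ω) := by field_simp
      _ ≤ _ := by linarith
  have hedge : ∑ t : V × V × K, (if u ∈ S.conflictSet X (Sum.inr t) then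
      pr (S.finalLaw list) (S.conflict X (Sum.inr t)) else 0) ≤ 20 / 1000 := by
    let g : V → V → K → ℝ := fun a b c =>
      if (S.graph c).Adj a b then S.p a c * S.p b c else 0
    have hg0 : ∀ a b c, 0 ≤ g a b c := fun a b c => by
      simp only [g]
      split_ifs
      · exact mul_nonneg (hS.p_nonneg _ _) (hS.p_nonneg _ _)
      · exact le_rfl
    have h1 : ∀ t : V × V × K, (if u ∈ S.conflictSet X (Sum.inr t) then
      pr (S.finalLaw list) (S.conflict X (Sum.inr t)) else 0) ≤
        (10 / 9) ^ 2 * ((if t.1 = u then g u t.2.1 t.2.2 else 0) +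
          if t.2.1 = u then g u t.1 t.2.2 else 0) := by
      rintro ⟨a, b, c⟩
      have hr1 : 0 ≤ if a = u then g u b c else 0 := by
        split_ifs
        · exact hg0 _ _ _
        · exact le_rfl
      have hr2 : 0 ≤ if b = u then g u a c else 0 := by
        split_ifs
        · exact hg0 _ _ _
        · exact le_rfl
      by_cases hmem : u ∈ S.conflictSet X (Sum.inr (a, b, c))
      swap
      · rw [if_neg hmem]
        positivity
      rw [if_pos hmem]
      simp only [conflictSet] at hmem
      split_ifs at hmem with hab
      swap
      · simp at hmem
      have h2 : pr (S.finalLaw list) (S.conflict X (Sum.inr (a, b, c))) ≤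
          (10 / 9) ^ 2 * (S.p a c * S.p b c) := by
        have h5 : pr (S.finalLaw list) (S.conflict X (Sum.inr (a, b, c))) ≤
            pr (S.finalLaw list) fun x => ∀ u ∈ ({a, b} : Finset V), x u = some c :=
          pr_mono hw fun x hx => hx.2
        rw [pr_forall_some, Finset.prod_pair hab.ne] at h5
        refine h5.trans ((mul_le_mul (hI.finalLaw_some_le hP hC hi (hS.adj_U _ _ _ hab) c)
          (hI.finalLaw_some_le hP hC hi (hS.adj_U _ _ _ hab.symm) c) (hw.nonneg _ _)
          (mul_nonneg (by norm_num) (hS.p_nonneg a c))).trans_eq ?_)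
        ring
      refine h2.trans (mul_le_mul_of_nonneg_left ?_ (by norm_num))
      simp only [Finset.mem_insert, Finset.mem_singleton] at hmem
      rcases hmem with rfl | rfl
      · refine le_add_of_le_of_nonneg ?_ hr2
        simp [g, hab]
      · refine le_add_of_nonneg_of_le hr1 ?_
        simp [g, hab.symm, mul_comm]
    refine (Finset.sum_le_sum fun t _ => h1 t).trans ?_
    rw [← Finset.mul_sum, Finset.sum_add_distrib]
    have h5 : ∑ b, ∑ c, g u b c ≤ 8 * (1 - P.θ / 4) ^ i * P.ω := by
      refine le_trans (le_of_eq ?_) (hI.edge u hu)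
      rw [Finset.sum_comm]
      refine Finset.sum_congr rfl fun c _ => ?_
      simp only [g]
      rw [← Finset.sum_filter]
      rfl
    have h6 : ∑ t : V × V × K, (if t.1 = u then g u t.2.1 t.2.2 else 0) = ∑ b, ∑ c, g u b c := by
      simp only [Fintype.sum_prod_type]
      rw [Finset.sum_eq_single u]
      · simp
      · intro a _ ha
        simp [ha]
      · simp
    have h7 : ∑ t : V × V × K, (if t.2.1 = u then g u t.1 t.2.2 else 0) = ∑ b, ∑ c, g u b c := by
      simp only [Fintype.sum_prod_type]
      refine Finset.sum_congr rfl fun a _ => ?_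
      rw [Finset.sum_eq_single u]
      · simp
      · intro b _ hb
        simp [hb]
      · simp
    rw [h6, h7]
    linarith
  linarith

/-- The final step succeeds with positive probability. -/
theorem Inv.exists_final (hi : i ≤ P.T) (h3 : (1 - P.θ / 3) ^ i * P.ω ≤ 1 / 1000)
    (h4 : (1 - P.θ / 4) ^ i * P.ω ≤ 1 / 1000) :
    ∃ x, 0 < weight (S.finalLaw list) x ∧ ∀ k, ¬ S.conflict X k x := by
  have hw := S.finalLaw_isLaw (list := list)
  have hnn : ∀ k, 0 ≤ pr (S.finalLaw list) (S.conflict X k) := fun k => pr_nonneg hw _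
  have hv := hI.sum_conflict_le hP hC hi h3 h4
  refine local_lemma hw (S.conflict X) (fun k => S.conflictSet X k) S.conflict_dependsOn
    (fun k => ?_) fun k => ?_
  · rcases (S.conflictSet X k).eq_empty_or_nonempty with h | ⟨u, hu⟩
    · rw [pr_conflict_of_empty h]
      norm_num
    · have h5 := Finset.single_le_sum (f := fun k => pr (S.finalLaw list) (S.conflict X k))
        (s := Finset.univ.filter fun k => u ∈ S.conflictSet X k) (fun k _ => hnn k)
        ((Finset.mem_filter_univ k).2 hu)
      exact h5.trans ((hv u).trans (by norm_num))
  · have hsub : (Finset.univ.filter fun l => ¬ Disjoint (S.conflictSet X k : Set V)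
        (S.conflictSet X l : Set V)) ⊆ (S.conflictSet X k).biUnion fun u =>
          Finset.univ.filter fun l => u ∈ S.conflictSet X l := by
      intro l hl
      rw [Finset.mem_filter_univ, Set.not_disjoint_iff] at hl
      obtain ⟨u, h1, h2⟩ := hl
      exact Finset.mem_biUnion.2 ⟨u, h1, (Finset.mem_filter_univ _).2 h2⟩
    refine (Finset.sum_le_sum_of_subset_of_nonneg hsub fun l _ _ => hnn l).trans ?_
    -- A conflict involves at most three vertices, and the conflicts at each have total probability
    -- at most 1/12. This is why 1/12 is the target: three times it is the 1/4 of the local lemma.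
    have hbi : ∀ A : Finset V, ∑ l ∈ A.biUnion (fun u =>
        Finset.univ.filter fun l => u ∈ S.conflictSet X l),
        pr (S.finalLaw list) (S.conflict X l) ≤ A.card * (1 / 12) := by
      intro A
      induction A using Finset.induction_on with
      | empty => simp
      | insert u A hu ih =>
        rw [Finset.biUnion_insert, Finset.card_insert_of_notMem hu]
        have h5 := Finset.sum_union_inter (s₁ := Finset.univ.filter fun l =>
          u ∈ S.conflictSet X l) (s₂ := A.biUnion fun u =>
            Finset.univ.filter fun l => u ∈ S.conflictSet X l)
          (f := fun l => pr (S.finalLaw list) (S.conflict X l))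
        have h6 := Finset.sum_nonneg (s := (Finset.univ.filter fun l =>
          u ∈ S.conflictSet X l) ∩ (A.biUnion fun u =>
            Finset.univ.filter fun l => u ∈ S.conflictSet X l)) fun l _ => hnn l
        have h7 := hv u
        push_cast
        linarith
    refine (hbi _).trans ?_
    have : ((S.conflictSet X k).card : ℝ) ≤ 3 := by exact_mod_cast card_conflictSet_le k
    linarith

/-- From a state that is as expected and properly coloured, the final step produces a proper
colouring with positive probability. -/
theorem Inv.exists_coloring (hR : S.Proper X list P.phat)
    (hi : i ≤ P.T) (h3 : (1 - P.θ / 3) ^ i * P.ω ≤ 1 / 1000)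
    (h4 : (1 - P.θ / 4) ^ i * P.ω ≤ 1 / 1000) :
    ∃ χ : V → K, X.IsProperListColoring list χ ∧
      (fun u => some (χ u)) ∈ (indepProduct fun u => finalChoice list S u).support := by
  obtain ⟨x, hx, hE⟩ := hI.exists_final hP hC hi h3 h4
  have hS := hI.basic
  have hx0 : ∀ u, S.finalLaw list u (x u) ≠ 0 := fun u h =>
    hx.ne' (Finset.prod_eq_zero (Finset.mem_univ u) h)
  have hold : ∀ u c, S.color u = some c → x u = some c := by
    intro u c h
    by_contra hne
    refine hx0 u ?_
    simp [finalLaw, finalChoice, h, hne]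
  have hsome : ∀ u, ∃ c, x u = some c := by
    intro u
    cases hu : S.color u with
    | some c => exact ⟨c, hold u c hu⟩
    | none =>
      rw [← Option.ne_none_iff_exists']
      intro h
      exact hx0 u (h ▸ hI.finalLaw_none hP hC hi hu)
  choose χ hχ using hsome
  have hnew : ∀ u c, S.color u = none → x u = some c → ¬ (S.p u c = 0 ∨ S.p u c = P.phat) := by
    intro u c hu hc h
    refine hx0 u ?_
    rw [hc, hI.finalLaw_some hP hC hi hu]
    rcases h with h | h
    · simp [h]
    · rw [ind_of_false (not_not.2 ((hS.mem_B u c).2 h))]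
      simp
  have hsplit : ∀ u c, x u = some c →
      S.color u = some c ∨ S.color u = none ∧ x u = some c := by
    intro u c h
    cases hu : S.color u with
    | some d => exact Or.inl ((hold u d hu).symm.trans h)
    | none => exact Or.inr ⟨rfl, h⟩
  have hedge : ∀ u v c, (S.graph c).Adj u v → x u = some c → x v ≠ some c := by
    intro u v c huv hu hv
    refine hE (Sum.inr (u, v, c)) ⟨huv, fun w hw => ?_⟩
    simp only [Finset.mem_insert, Finset.mem_singleton] at hw
    rcases hw with rfl | rfl <;> assumption
  refine ⟨χ, ⟨fun u => ?_, fun e he => ?_, fun u v huv huv' => ?_⟩, ?_⟩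
  · cases hu : S.color u with
    | some c =>
      have : χ u = c := Option.some.inj ((hχ u).symm.trans (hold u c hu))
      exact this ▸ hR.mem_list u c hu
    | none =>
      by_contra hc
      exact hnew u (χ u) hu (hχ u) (Or.inl (hS.p_supp u _ hc))
  · by_contra hcon
    push Not at hcon
    obtain ⟨u₀, hu₀⟩ : e.Nonempty := Finset.card_pos.1 (by rw [X.card_eq_three e he]; norm_num)
    have hc : ∀ v ∈ e, x v = some (χ u₀) := fun v hv => (hχ v).trans
      (congrArg some (hcon v hv u₀ hu₀))
    obtain ⟨u, hu, hne⟩ := hR.three e he (χ u₀)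
    have hun := ((hsplit u _ (hc u hu)).resolve_left hne).1
    rcases hR.dead_or_adj he hu hun (fun v => x v = some (χ u₀))
      fun v hv _ => hsplit v _ (hc v hv) with h | ⟨v, hv, hg⟩ | ⟨h1, -⟩
    · exact hnew u _ hun (hc u hu) h
    · exact hedge u v _ hv (hc u hu) hg
    · exact hE (Sum.inl e) ⟨h1, χ u₀, Finset.mem_univ _, hc⟩
  · have hu := hχ u
    have hv : x v = some (χ u) := (hχ v).trans (congrArg some huv'.symm)
    rcases hsplit u _ hu with h | ⟨h, -⟩
    · rcases hsplit v _ hv with h' | ⟨h', -⟩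
      · exact hR.two u v _ huv h h'
      · exact hnew v _ h' hv (hR.dead_two v u _ huv.symm h' h)
    · rcases hsplit v _ hv with h' | ⟨h', -⟩
      · exact hnew u _ h hu (hR.dead_two u v _ huv h h')
      · exact hedge u v _ (hR.adj_two u v _ huv h h') hu hv
  · rw [PMF.mem_support_iff, indepProduct_apply]
    refine Finset.prod_ne_zero_iff.2 fun u _ h => hx0 u ?_
    rw [finalLaw, hχ u, h, ENNReal.toReal_zero]

end State

/-- The theorem for one set of parameters that satisfy the numerical facts. -/
theorem exists_output {X : RankThree V} {list : V → Finset K} {P : Params} (hP : P.Num)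
    (hC : ∀ u, (list u).card = P.C) (hX : X.DegreesAtMost P.Δ P.Δ₂ P.δ) {pick : Rule V K}
    (hpick : pick.IsValid X)
    (hN : ∀ i < P.T, ∀ S ∈ (run X list P.C P.θ P.phat pick i).support,
      S.NearIndependent X P.θ P.ω₀) :
    ∃ χ : V → K, X.IsProperListColoring list χ ∧
      (fun u => some (χ u)) ∈ (output X list P.C P.θ P.phat pick P.T).support := by
  obtain ⟨S, hS, hI, hR⟩ := exists_state hP hC hX hpick hN le_rfl
  obtain ⟨χ, h1, h2⟩ := hI.exists_coloring hP hC hR le_rfl hP.final_three hP.final_four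
  refine ⟨χ, h1, ?_⟩
  rw [output, PMF.mem_support_bind_iff]
  exact ⟨S, hS, h2⟩

end SemiRandom

/-! ### Deriving the numerical facts from the parameter relations -/

namespace SemiRandom

namespace Params

variable {P : Params}

theorem le_one_of_one_div_ge {a b : ℝ} (hb : 1 ≤ b) (h : 1 / a ≥ b) : 0 < a ∧ a ≤ 1 := by
  have h1 : 0 < 1 / a := lt_of_lt_of_le (by linarith) h
  have ha : 0 < a := one_div_pos.1 h1
  refine ⟨ha, ?_⟩
  have := (le_div_iff₀ ha).1 h
  nlinarith

/-- The weights are bounded by a power of the maximum degree less than `-9/20`. -/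
theorem Relations.phat_mul_le (hR : P.Relations) (hω : 1 ≤ P.ω)
    (hL : 1 ≤ P.L) (hph : 0 < P.phat) (hT : 1 ≤ P.T * P.θ) {Z : ℝ} (hZ : 0 < Z)
    (hΔ : P.Δ = Z ^ 100) (hω₆ : P.ω₆ = Z ^ 25) : P.phat * Z ^ 45 ≤ 1 := by
  have hΔ0 : 0 < P.Δ := by rw [hΔ]; positivity
  have h := (le_one_of_one_div_ge (b := 7 * Real.log P.Δ)
    (by rw [← L]; linarith) hR.r10).2
  have hm : (0 : ℝ) ≤ m := by norm_num [m]
  have ht : (0 : ℝ) ≤ P.T := Nat.cast_nonneg _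
  have h1 : 0 ≤ 4 * m * P.phat ^ 5 * P.Δ ^ (2 + 1 / (2 * m)) :=
    mul_nonneg (by positivity) (Real.rpow_nonneg hΔ0.le _)
  have h2 : 0 ≤ P.C * m ^ 2 * P.phat ^ 6 * P.Δ ^ (2 + 1 / m) :=
    mul_nonneg (by positivity) (Real.rpow_nonneg hΔ0.le _)
  set a := 6 * P.ω₆ * P.T * P.θ * P.phat ^ 5 * P.Δ ^ 2 with ha
  have ha1 : (P.phat * Z ^ 45) ^ 5 ≤ a := by
    -- Only the first summand of R10 is needed: ω₆Δ² = Z^225 = (Z^45)^5 matches the fifth power of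
    -- p̂.
    have e : a = 6 * (P.T * P.θ) * (P.phat * Z ^ 45) ^ 5 := by
      rw [ha, hΔ, hω₆]
      ring
    rw [e]
    exact le_mul_of_one_le_left (by positivity) (by linarith)
  have ha0 : 0 ≤ a := le_trans (by positivity) ha1
  have hω3 : 1 ≤ 4 * P.ω₃ ^ 2 := by
    have : 1 ≤ (P.ω ^ 2) ^ 2 := one_le_pow₀ (one_le_pow₀ hω)
    simp only [ω₃]
    linarith
  have h3 : a ≤ 1 := by
    refine le_trans ?_ h
    calc a ≤ 4 * P.ω₃ ^ 2 * a := le_mul_of_one_le_left ha0 hω3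
      _ ≤ _ := by
        refine mul_le_mul_of_nonneg_left ?_ (by linarith)
        linarith
  by_contra hcon
  have := one_lt_pow₀ (not_le.1 hcon) (by norm_num : 5 ≠ 0)
  linarith

set_option maxHeartbeats 1000000 in
/-- The relations imply the numerical facts when the maximum degree is large. -/
theorem Relations.num (hR : P.Relations) (hε : 0 < P.ε) (hω : 10 ^ 12 ≤ P.ω)
    (h2 : |1 / P.ω₀| ≤ 1 / 1000 * |P.θ|) (hL : 10 ^ 6 ≤ P.L) (hΔ6 : 10 ^ 6 ≤ P.Δ)
    (hLZ : 10 ^ 9 * P.L ^ 10 ≤ P.Δ ^ (1 / 100 : ℝ)) : P.Num := by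
  have hΔ0 : 0 < P.Δ := by linarith
  have hω0 : 0 < P.ω := by linarith
  have hL0 : 0 < P.L := by linarith
  have hε1 : P.ε ≤ 1 / 40 := by linarith [hR.r18]
  have hθ : 0 < P.θ := div_pos hε hω0
  have hθω : P.θ * P.ω = P.ε := div_mul_cancel₀ _ hω0.ne'
  have hθ1 : P.θ ≤ 1 / 1000 := by
    rw [θ, div_le_iff₀ hω0]
    linarith
  -- All relevant powers of Δ become natural powers of Z, and Z dominates every polynomial in log Δ
  -- that occurs.
  set Z := P.Δ ^ (1 / 100 : ℝ) with hZdef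
  have hZpow : ∀ k : ℕ, P.Δ ^ ((k : ℝ) / 100) = Z ^ k := by
    intro k
    rw [hZdef, ← Real.rpow_natCast, ← Real.rpow_mul hΔ0.le]
    congr 1
    ring
  have hΔZ : P.Δ = Z ^ 100 := by
    rw [← hZpow]
    norm_num
  have hω₅ : P.ω₅ = Z ^ 95 := by
    rw [← hZpow, ω₅]
    norm_num
  have hω₆ : P.ω₆ = Z ^ 25 := by
    rw [← hZpow, ω₆]
    norm_num
  have hsqrt : √P.Δ = Z ^ 50 := by
    rw [← hZpow, Real.sqrt_eq_rpow]
    norm_num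
  have hpoly : ∀ (a : ℝ) (k : ℕ), a ≤ 10 ^ 9 → k ≤ 10 → a * P.L ^ k ≤ Z := by
    intro a k ha hk
    refine le_trans ?_ hLZ
    have := pow_le_pow_right₀ (by linarith : 1 ≤ P.L) hk
    have h0 : 0 < P.L ^ k := by positivity
    calc a * P.L ^ k ≤ 10 ^ 9 * P.L ^ k := by gcongr
      _ ≤ _ := by gcongr
  have hZ9 : 10 ^ 9 ≤ Z := by simpa using hpoly (10 ^ 9) 0 le_rfl (by norm_num)
  have hZ1 : 1 ≤ Z := by linarith
  have hZ0 : 0 < Z := by linarith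
  have hph : 0 < P.phat := lt_of_lt_of_le (Real.rpow_pos_of_pos hΔ0 _) hR.r21
  have hlogω : 4 * Real.log 1000 ≤ Real.log P.ω := by
    have h := Real.log_le_log (by norm_num : (0 : ℝ) < 10 ^ 12) hω
    have e : (10 : ℝ) ^ 12 = 1000 ^ 4 := by norm_num
    rw [e, Real.log_pow] at h
    exact_mod_cast h
  have hlog1000 : 1 ≤ Real.log 1000 := by
    rw [Real.le_log_iff_exp_le (by norm_num)]
    have := Real.exp_one_lt_d9
    linarith
  -- the number of rounds
  have hTge : 5 * Real.log P.ω ≤ P.T * P.θ := by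
    have h := Nat.le_ceil (5 * P.ω / P.ε * Real.log P.ω)
    have h' := mul_le_mul_of_nonneg_right h hθ.le
    refine le_trans (le_of_eq ?_) h'
    rw [θ]
    field_simp
  have hTθ : 1 ≤ P.T * P.θ := by linarith
  have hT0 : (0 : ℝ) < P.T := (mul_pos_iff_of_pos_right hθ).1 (by linarith)
  -- the weights
  have hphZ : P.phat * Z ^ 45 ≤ 1 :=
    hR.phat_mul_le (by linarith) (by linarith) hph hTθ hZ0 hΔZ hω₆
  have hph1 : P.phat ≤ 1 := by
    refine le_trans (le_mul_of_one_le_right hph.le (one_le_pow₀ hZ1)) hphZ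
  have hZph : Z * P.phat ≤ 1 := by
    refine le_trans ?_ hphZ
    rw [mul_comm]
    exact mul_le_mul_of_nonneg_left (le_self_pow₀ hZ1 (by norm_num)) hph.le
  have hph3 : Z ^ 135 * P.phat ^ 3 ≤ 1 := by
    calc Z ^ 135 * P.phat ^ 3 = (P.phat * Z ^ 45) ^ 3 := by ring
      _ ≤ 1 := pow_le_one₀ (by positivity) hphZ
  -- the number of colours
  have hsω : 1 ≤ √P.ω := by rw [Real.one_le_sqrt]; linarith
  have hsω0 : 0 < √P.ω := by linarith
  have hsωsq : √P.ω * √P.ω = P.ω := Real.mul_self_sqrt hω0.le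
  have hsΔ0 : 0 < √P.Δ := Real.sqrt_pos.2 hΔ0
  have hsΔsq : √P.Δ * √P.Δ = P.Δ := Real.mul_self_sqrt hΔ0.le
  have hCge : √P.Δ / √P.ω ≤ P.C := Nat.le_ceil _
  have hC0 : (0 : ℝ) < P.C := lt_of_lt_of_le (by positivity) hCge
  have hCle : (P.C : ℝ) ≤ P.Δ := by
    have h := (Nat.ceil_lt_add_one (by positivity : 0 ≤ √P.Δ / √P.ω)).le
    have h1 : √P.Δ / √P.ω ≤ √P.Δ := div_le_self hsΔ0.le hsω
    have h3 : 2 ≤ √P.Δ := by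
      rw [hsqrt]
      exact (by linarith : 2 ≤ Z).trans (le_self_pow₀ hZ1 (by norm_num))
    have h4 : (P.C : ℝ) ≤ √P.Δ / √P.ω + 1 := h
    have h5 := mul_le_mul_of_nonneg_right h3 hsΔ0.le
    linarith
  have hCω : √P.Δ ≤ √P.ω * P.C := by
    rw [div_le_iff₀ hsω0] at hCge
    linarith
  -- the consequences of the first relation
  have hlog : 85 / P.θ ≤ Real.log (P.phat * P.C) := by
    rw [div_le_iff₀ hθ]
    linarith [hR.r1]
  have hlogL : 85 / P.θ ≤ P.L := by
    refine hlog.trans (Real.log_le_log (mul_pos hph hC0) ?_)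
    calc P.phat * P.C ≤ 1 * P.Δ := by gcongr
      _ = P.Δ := one_mul _
  have hθL : 85 ≤ P.L * P.θ := (div_le_iff₀ hθ).1 hlogL
  -- R1 and p̂C ≤ Δ give 85 ≤ Lθ; multiplied by ω this reads 85ω ≤ Lε ≤ L/40.
  have hωL : P.ω ≤ P.L := by
    have h := mul_le_mul_of_nonneg_right hθL hω0.le
    rw [mul_assoc, hθω] at h
    have := mul_le_mul_of_nonneg_left hε1 hL0.le
    linarith
  have hTle : (P.T : ℝ) ≤ P.L ^ 2 := by
    have h := (Nat.ceil_lt_add_one (a := 5 * P.ω / P.ε * Real.log P.ω) (by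
      have := Real.log_nonneg (by linarith : 1 ≤ P.ω)
      positivity)).le
    have h1 : 5 * P.ω / P.ε * Real.log P.ω ≤ 5 * (P.L / 85) * P.L := by
      have h3 : Real.log P.ω ≤ P.L := (Real.log_le_self hω0.le).trans hωL
      have h4 : P.ω / P.ε ≤ P.L / 85 := by
        rw [div_le_div_iff₀ hε (by norm_num), ← hθω]
        have := mul_le_mul_of_nonneg_right hθL hω0.le
        linarith
      rw [mul_div_assoc]
      have : 0 ≤ Real.log P.ω := by linarith
      gcongr
    have h5 : (P.T : ℝ) ≤ 5 * P.ω / P.ε * Real.log P.ω + 1 := h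
    have h6 : 10 ^ 6 * 10 ^ 6 ≤ P.L * P.L := mul_le_mul hL hL (by norm_num) hL0.le
    linarith
  -- the decay of the edge weights
  have hy0 : 0 < (1 - P.θ / 4) ^ P.T := _root_.pow_pos (by linarith) _
  -- As Tθ ≥ 5 log ω, the product is at most ω^(-5/4) · ω = ω^(-1/4); the threshold 10^12 = 1000^4
  -- for ω is chosen for this.
  have hy : (1 - P.θ / 4) ^ P.T * P.ω ≤ 1 / 1000 := by
    have h1 : (1 - P.θ / 4) ^ P.T ≤ Real.exp (-(P.θ / 4)) ^ P.T :=
      pow_le_pow_left₀ (by linarith) (Real.one_sub_le_exp_neg _) _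
    rw [← Real.exp_nat_mul] at h1
    calc (1 - P.θ / 4) ^ P.T * P.ω ≤ Real.exp (P.T * -(P.θ / 4)) * Real.exp (Real.log P.ω) := by
          rw [Real.exp_log hω0]
          gcongr
      _ = Real.exp (P.T * -(P.θ / 4) + Real.log P.ω) := (Real.exp_add _ _).symm
      _ ≤ Real.exp (-Real.log 1000) := Real.exp_le_exp.2 (by linarith)
      _ = 1 / 1000 := by rw [Real.exp_neg, Real.exp_log (by norm_num)]; norm_num
  have hy3 : (1 - P.θ / 3) ^ P.T ≤ (1 - P.θ / 4) ^ P.T :=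
    pow_le_pow_left₀ (by linarith) (by linarith) _
  -- the error term of near-independence
  have hω₀ : 0 < P.ω₀ := by
    -- With ωω₂ = ω₀/16, relation R8 says ω₀/16 + T < ω₀/2, which forces ω₀ > 0.
    have h := hR.r8
    have e : P.ω * P.ω₂ = P.ω₀ / 16 := by rw [ω₂]; field_simp
    rw [e] at h
    linarith
  have hω₀T : 2100 * (P.T : ℝ) ≤ P.ω₀ := by
    have h := hR.r17
    have e : P.θ * P.T / P.ω₂ = P.θ * P.ω * (16 * P.T / P.ω₀) := by rw [ω₂]; field_simp
    have h3 : 0 ≤ 1 / P.ω₃ := by rw [ω₃]; positivity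
    -- R17 gives 16T/ω₀ ≤ (1-θ/4)^T ≤ 1/1000, more than is needed.
    have h4 : P.θ * P.ω * (16 * P.T / P.ω₀) ≤ P.θ * P.ω * (1 - P.θ / 4) ^ P.T := by
      rw [← e]; linarith
    have h5 := le_of_mul_le_mul_left h4 (mul_pos hθ hω0)
    rw [div_le_iff₀ hω₀] at h5
    have h6 : (1 - P.θ / 4) ^ P.T ≤ 1 / 1000 := by
      refine le_trans (le_mul_of_one_le_right hy0.le (by linarith)) hy
    have h7 := mul_le_mul_of_nonneg_right h6 hω₀.le
    linarith
  -- the codegree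
  have hgrow : P.grow = Z ^ 25 * (P.θ * P.Δ * P.phat) := by rw [grow, hω₆]; ring
  have hg0 : 0 < P.θ * P.Δ * P.phat := by positivity
  have hg : 0 < P.grow := by rw [hgrow]; positivity
  -- The left side of R16 must be positive, so δ > 0; division by δ = 0 would give 0.
  have hδg : 0 < P.δ ∧ 30 * P.L * P.δ ≤ P.grow := by
    have h := hR.r16
    have e : P.ω₆ * P.Δ * P.θ * P.phat = P.grow := by rw [grow]; ring
    rw [e] at h
    have h1 : 0 < P.grow / (5 * P.δ) := lt_of_lt_of_le (by rw [← L]; positivity) h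
    have h3 : 0 < 5 * P.δ := (div_pos_iff_of_pos_left hg).1 h1
    refine ⟨by linarith, ?_⟩
    rw [ge_iff_le, le_div_iff₀ h3, ← L] at h
    linarith
  obtain ⟨hδ, hδg⟩ := hδg
  have hgle : P.θ * P.Δ * P.phat ≤ Z ^ 55 := by
    have h1 : P.Δ * P.phat ≤ Z ^ 55 := by
      calc P.Δ * P.phat = Z ^ 55 * (P.phat * Z ^ 45) := by rw [hΔZ]; ring
        _ ≤ Z ^ 55 * 1 := by gcongr
        _ = _ := mul_one _
    calc P.θ * P.Δ * P.phat = P.θ * (P.Δ * P.phat) := by ring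
      _ ≤ 1 * Z ^ 55 := by gcongr; linarith
      _ = _ := one_mul _
  have hgrow_le : P.grow ≤ Z ^ 80 := by
    calc P.grow ≤ Z ^ 25 * Z ^ 55 := by rw [hgrow]; gcongr
      _ = _ := by ring
  have hδle : P.δ ≤ Z ^ 80 := by
    refine le_trans ?_ (hδg.trans hgrow_le)
    exact le_mul_of_one_le_left hδ.le (by linarith)
  -- Compared with ω₅ = Z^95 this leaves a factor Z^15 for the logarithms in `kept_one`, and Z^10 in
  -- `kept_two`.
  have hsum : P.δ + P.θ * P.phat * P.Δ ≤ 2 * Z ^ 80 := by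
    have h1 : P.θ * P.phat * P.Δ ≤ Z ^ 80 := by
      refine le_trans (le_of_eq (by ring)) (hgle.trans (pow_le_pow_right₀ hZ1 (by norm_num)))
    linarith
  have hZ_le : ∀ k : ℕ, k ≠ 0 → Z ≤ Z ^ k := fun k hk => le_self_pow₀ hZ1 hk
  have hsω_le : √P.Δ * √P.ω ≤ P.ω * P.C := by
    calc √P.Δ * √P.ω ≤ √P.ω * P.C * √P.ω := by gcongr
      _ = √P.ω * √P.ω * P.C := by ring
      _ = _ := by rw [hsωsq]
  refine
    { L_ge := hL, Δ_ge := hΔ6, θ_pos := hθ, θ_le := hθ1, ω_ge := by linarith, ω_le := hωL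
      θ_mul_ω := hθω, ε_le := hε1, T_pos := by exact_mod_cast hT0, T_le := hTle
      C_pos := by exact_mod_cast hC0, C_le := hCle, Δ_le_C_sq := ?_, phat_pos := hph
      phat_small := ?_, entropy_small := ?_, grow_small := ?_, triple_one := ?_, triple_two := ?_
      ω₀_pos := hω₀, ω₀_ge := hω₀T, ω₀_inv_le := ?_, decay := hR.r13
      ω₅_pos := by rw [hω₅]; positivity
      ω₅_le := hR.r15.le, δ_pos := hδ, kept_one := ?_, kept_two := ?_
      hits_one := le_trans (by gcongr; norm_num) hδg, hits_two := ?_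
      ω₆_ge := by rw [hω₆]; linarith [hZ_le 25 (by norm_num)]
      log_ge := hlog, Δ₂_le := ?_, Δ₂_le_grow := hR.r19, Δ₂_le_C := hR.r20.trans hsω_le
      final_three := ?_, final_four := hy }
  · calc P.Δ = √P.Δ * √P.Δ := hsΔsq.symm
      _ ≤ (√P.ω * P.C) * (√P.ω * P.C) := by gcongr
      _ = √P.ω * √P.ω * (P.C : ℝ) ^ 2 := by ring
      _ = _ := by rw [hsωsq]
  · exact (mul_le_mul_of_nonneg_right (hpoly _ _ le_rfl (by norm_num)) hph.le).trans hZph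
  · have h1 : Real.negMulLog P.phat ≤ P.phat * P.L := by
      have h3 := Real.log_le_log (Real.rpow_pos_of_pos hΔ0 _) hR.r21
      rw [Real.log_rpow hΔ0, ← L] at h3
      have h4 := mul_le_mul_of_nonneg_left (by linarith : -Real.log P.phat ≤ P.L) hph.le
      rw [Real.negMulLog]
      linarith
    calc 10 ^ 3 * P.L ^ 8 * Real.negMulLog P.phat ≤ 10 ^ 3 * P.L ^ 8 * (P.phat * P.L) := by gcongr
      _ = 10 ^ 3 * P.L ^ 9 * P.phat := by ring
      _ ≤ Z * P.phat := by
        gcongr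
        exact hpoly _ _ (by norm_num) (by norm_num)
      _ ≤ 1 := hZph
  -- So p̂² · `grow` is at most Z^125 p̂³ ≤ Z^(-10), which absorbs the powers of log Δ.
  · have h1 : P.grow ≤ Z ^ 125 * P.phat := by
      calc P.grow = P.θ * (Z ^ 125 * P.phat) := by rw [hgrow, hΔZ]; ring
        _ ≤ 1 * (Z ^ 125 * P.phat) := by gcongr; linarith
        _ = _ := one_mul _
    calc 10 ^ 4 * P.L ^ 8 * (P.phat ^ 2 * (3 * P.T * P.grow)) ≤
        10 ^ 4 * P.L ^ 8 * (P.phat ^ 2 * (3 * P.L ^ 2 * (Z ^ 125 * P.phat))) := by gcongr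
      _ = 30000 * P.L ^ 10 * (Z ^ 125 * P.phat ^ 3) := by ring
      _ ≤ Z ^ 10 * (Z ^ 125 * P.phat ^ 3) := by
        gcongr
        exact (hpoly _ _ (by norm_num) le_rfl).trans (hZ_le 10 (by norm_num))
      _ = Z ^ 135 * P.phat ^ 3 := by ring
      _ ≤ 1 := hph3
  -- Here p̂³ ≤ Z^(-135) against Δ = Z^100 leaves Z^35 for the logarithmic factors.
  · rw [te, le_div_iff₀ (by positivity)]
    calc 20 * P.L * P.phat ^ 3 * (2000 * P.T * P.Δ) ≤
        20 * P.L * P.phat ^ 3 * (2000 * P.L ^ 2 * P.Δ) := by gcongr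
      _ = 40000 * P.L ^ 3 * Z ^ 100 * P.phat ^ 3 := by rw [hΔZ]; ring
      _ ≤ Z ^ 35 * Z ^ 100 * P.phat ^ 3 := by
        gcongr
        exact (hpoly _ _ (by norm_num) (by norm_num)).trans (hZ_le 35 (by norm_num))
      _ = Z ^ 135 * P.phat ^ 3 := by ring
      _ ≤ 1 := hph3
      _ ≤ P.ω := by linarith
  · have h1 : 320000000 * P.L * P.phat ^ 3 * (P.T ^ 2 * P.Δ) ≤ P.ω := by
      calc 320000000 * P.L * P.phat ^ 3 * (P.T ^ 2 * P.Δ) ≤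
          320000000 * P.L * P.phat ^ 3 * ((P.L ^ 2) ^ 2 * P.Δ) := by gcongr
        _ = 320000000 * P.L ^ 5 * Z ^ 100 * P.phat ^ 3 := by rw [hΔZ]; ring
        _ ≤ Z ^ 35 * Z ^ 100 * P.phat ^ 3 := by
          gcongr
          exact (hpoly _ _ (by norm_num) (by norm_num)).trans (hZ_le 35 (by norm_num))
        _ = Z ^ 135 * P.phat ^ 3 := by ring
        _ ≤ 1 := hph3
        _ ≤ P.ω := by linarith
    have e : 40 * P.L * (P.phat ^ 3 * (2 * (P.ω / P.Δ))) =
        320000000 * P.L * P.phat ^ 3 * (P.T ^ 2 * P.Δ) * (P.ω / (2000 * P.T * P.Δ) ^ 2) := by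
      field_simp
      norm_num
    rw [te, e, div_pow]
    calc _ ≤ P.ω * (P.ω / (2000 * P.T * P.Δ) ^ 2) := by gcongr
      _ = _ := by ring
  · rw [abs_of_pos (one_div_pos.2 hω₀), abs_of_pos hθ] at h2
    linarith
  · calc 20 * P.L * (100 * (P.δ + P.θ * P.phat * P.Δ)) ≤ 20 * P.L * (100 * (2 * Z ^ 80)) := by
          gcongr
      _ = 4000 * P.L ^ 1 * Z ^ 80 := by ring
      _ ≤ Z ^ 15 * Z ^ 80 := by
        gcongr
        exact (hpoly _ _ (by norm_num) (by norm_num)).trans (hZ_le 15 (by norm_num))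
      _ = P.ω₅ := by rw [hω₅]; ring
  · calc 40 * P.L * (2 * P.θ * P.Δ * (P.δ + P.θ * P.phat * P.Δ)) ≤
        40 * P.L * (2 * 1 * P.Δ * (2 * Z ^ 80)) := by gcongr; linarith
      _ = 160 * P.L ^ 1 * Z ^ 180 := by rw [hΔZ]; ring
      _ ≤ Z ^ 10 * Z ^ 180 := by
        gcongr
        exact (hpoly _ _ (by norm_num) (by norm_num)).trans (hZ_le 10 (by norm_num))
      _ = P.ω₅ ^ 2 := by rw [hω₅]; ring
  · have hg0' : 0 < P.L * P.δ := mul_pos hL0 hδ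
    have h1 : 40 * P.L * P.δ ≤ 2 * P.grow := by linarith
    calc 40 * P.L * (P.δ * (2 * P.Δ * P.θ * P.phat)) =
        40 * P.L * P.δ * (2 * (P.θ * P.Δ * P.phat)) := by ring
      _ ≤ 2 * P.grow * (2 * (P.θ * P.Δ * P.phat)) := by gcongr
      _ = P.grow * (4 * (P.θ * P.Δ * P.phat)) := by ring
      _ ≤ P.grow * (Z ^ 25 * (P.θ * P.Δ * P.phat)) := by
        gcongr
        linarith [hZ_le 25 (by norm_num)]
      _ = P.grow ^ 2 := by rw [← hgrow]; ring
  · refine hR.r20.trans ?_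
    have h1 : √P.ω ≤ √P.Δ := by
      refine Real.sqrt_le_sqrt (hωL.trans ?_)
      exact Real.log_le_self hΔ0.le
    calc √P.Δ * √P.ω ≤ √P.Δ * √P.Δ := by gcongr
      _ = P.Δ := hsΔsq
  · exact (mul_le_mul_of_nonneg_right hy3 hω0.le).trans hy

end Params

/-- All limits are consumed here: the rest of the argument concerns one fixed set of parameters with
explicit constants, so the threshold for Δ does not depend on the hypergraph, the lists or the rule.
-/
theorem ParamsAssumptions.eventually_num {ι : Type*} {l : Filter ι} {P : ι → Params}
    (hP : ParamsAssumptions l P) : ∀ᶠ n in l, (P n).Num := by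
  have hL : Tendsto (fun n => (P n).L) l atTop := Real.tendsto_log_atTop.comp hP.tendsto_Δ
  have hpoly : ∀ᶠ n in l, 10 ^ 9 * (P n).L ^ 10 ≤ (P n).Δ ^ (1 / 100 : ℝ) := by
    have h := (isLittleO_log_rpow_rpow_atTop 10 (by norm_num : (0 : ℝ) < 1 / 100)).def
      (by norm_num : (0 : ℝ) < 1 / 10 ^ 9)
    filter_upwards [hP.tendsto_Δ.eventually h, hP.tendsto_Δ.eventually_ge_atTop 1] with n hn hΔ
    rw [Real.norm_of_nonneg (Real.rpow_nonneg (Real.log_nonneg hΔ) _),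
      Real.norm_of_nonneg (Real.rpow_nonneg (by linarith) _)] at hn
    have e : Real.log (P n).Δ ^ (10 : ℝ) = (P n).L ^ 10 := by
      rw [Params.L, ← Real.rpow_natCast]
      norm_num
    rw [e] at hn
    linarith
  filter_upwards [hP.relations, hP.ε_pos, hP.tendsto_ω.eventually_ge_atTop (10 ^ 12),
    hP.r2.def (by norm_num : (0 : ℝ) < 1 / 1000), hL.eventually_ge_atTop (10 ^ 6),
    hP.tendsto_Δ.eventually_ge_atTop (10 ^ 6), hpoly] with n h1 h2 h3 h4 h5 h6 h7
  exact h1.num h2 h3 h4 h5 h6 h7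

end SemiRandom

end

theorem mainTheorem3 {ι : Type*} (l : Filter ι) (P : ι → SemiRandom.Params)
    (hP : SemiRandom.ParamsAssumptions l P) :
    ∀ᶠ n in l, ∀ (V : Type*) (K : Type*) [Fintype V] [Fintype K]
      (X : SemiRandom.RankThree V) (list : V → Finset K) (pick : SemiRandom.Rule V K),
      X.DegreesAtMost (P n).Δ (P n).Δ₂ (P n).δ →
      (∀ u, (list u).card = (P n).C) →
      pick.IsValid X →
      (∀ i < (P n).T,
        ∀ S ∈ (SemiRandom.run X list (P n).C (P n).θ (P n).phat pick i).support,
          S.NearIndependent X (P n).θ (P n).ω₀) →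
      ∃ χ : V → K, X.IsProperListColoring list χ ∧
        (fun u => some (χ u)) ∈
          (SemiRandom.output X list (P n).C (P n).θ (P n).phat pick (P n).T).support := by
  filter_upwards [hP.eventually_num] with n hn
  intro V K _ _ X list pick hX hC hpick hN
  exact SemiRandom.exists_output hn hC hX hpick hN
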